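/- **Setting.** Work over $\mathbb C$. Let $F(x,y,z)\ne 0$ be a homogeneous form of degree $d$, let $\mathscr C=\{F=0\}\subset\mathbb P^2$ be the corresponding (arbitrary, possibly reducible or non-reduced) curve, and choose coordinates so that the point under consideration is $p=(1:0:0)$ and the line under consideration is $z=0$. *Branches.* A formal branch of $\mathscr C$ at $p$ tangent to (and different from) the line $z=0$ is a nonzero Puiseux series $f(y)=\sum_{\lambda\in\mathbb Q}\gamma_\lambda y^{\lambda}$ (exponents with a common denominator) whose smallest exponent $\lambda_0$ satisfies $\lambda_0>1$ and such that $F(1,y,f(y))=0$. For $C\in\mathbb Q$ put $f_{(C)}=\sum_{\lambda<C}\gamma_\lambda y^\lambda$. A rational number $C$ is *characteristic* (for $\mathscr C$ at $p$ with respect to $z=0$) if there are two such branches $g,h$ with $g_{(C)}=h_{(C)}\neq 0$ but with different coefficients of $y^C$. *Projective normal cone.* Identify $\mathbb P^8$ with the projective space of nonzero $3\times3$ matrices, let $\mathbb P^N$ be the projective space of forms of degree $d$, and let $(F\circ\alpha)(x,y,z)=F(\alpha\,(x,y,z)^T)$. The (support of the) projective normal cone (PNC) of $\mathscr C$ is $$E=\overline{\{(\alpha,F\circ\alpha):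 F\circ\alpha\neq0\}}\ \cap\ \{(\alpha,\mathscr X): F\circ\alpha=0\}\ \subset\ \mathbb P^8\times\mathbb P^N$$ with the Zariski topology. $\mathrm{PGL}(3)$ acts on $\mathbb P^8\times\mathbb P^N$ by $(\alpha,\mathscr X)\cdot g=(\alpha g,\mathscr X\circ g)$. For a germ $\alpha(t)$ (a $3\times 3$ matrix over $\mathbb C[t]$ with $\alpha(0)\ne0$ and $\det\alpha(t)\not\equiv 0$), $\lim_{t\to0}\mathscr C\circ\alpha(t)$ is obtained by clearing the common power of $t$ in $F\circ\alpha(t)$ and then setting $t=0$. The limit *determines a component of the PNC* if the closure of the $\mathrm{PGL}(3)$-orbit of $(\alpha(0),\lim_{t\to0}\mathscr C\circ\alpha(t))$ is an irreducible component of $E$. *Germs of type V.* Let $f$ be a branch as above with initial exponent $\lambda_0$, let $C>\lambda_0$ be rational, and let $a,b,c$ be positive integers with $\frac ca=C$ and $\frac ba=\frac{C-\lambda_0}2+1$, such that $a\lambda\in\mathbb Z$ for all exponents $\lambda<C$ of $f$ (for instance with $a$ smallest possible). The corresponding germ of type V is $$\alpha_{f,C}(t)=\begin{pmatrix}1&0&0\\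 t^a&t^b&0\\ \underline{f(t^a)}&\underline{f'(t^a)t^b}&t^c\end{pmatrix},$$ where underlining denotes truncation modulo $t^c$. **Proposition.** 1. The set of characteristic rationals is finite. 2. For every germ $\alpha_{f,C}(t)$ of type V, the limit $\lim_{t\to0}\mathscr C\circ\alpha_{f,C}(t)$ determines a component of the PNC if and only if $C$ is characteristic through the truncation of $f$, that is, there are two branches $g,h$ of $\mathscr C$ at $p$ tangent to $z=0$ with $g_{(C)}=h_{(C)}=f_{(C)}$ but with different coefficients of $y^C$. 3. Consequently, a rational number $C$ is characteristic if and only if, for some branch $f$ with $\lambda_0<C$ and some $a,b,c$ as above, the limit along $\alpha_{f,C}(t)$ determines a component of the PNC. -/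

import Mathlib

open scoped Polynomial LinearAlgebra.Projectivization

noncomputable section

namespace PlaneCurve

/-- Homogeneous forms of degree `d` in the coordinates `x = X 0`, `y = X 1`, `z = X 2` of `ℙ²`. -/
abbrev Form (d : ℕ) := MvPolynomial.homogeneousSubmodule (Fin 3) ℂ d

/-- `3 × 3` complex matrices; their projectivization is `ℙ⁸`. -/
abbrev Mat := Matrix (Fin 3) (Fin 3) ℂ

/-- The right action by substitution: `F ∘ A` is `F (A (x, y, z)ᵗ)`. The matrix may have entries in
any commutative `ℂ`-algebra `R`; we use `R = ℂ` and `R = ℂ[t]`. -/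
def subst {R : Type} [CommRing R] [Algebra ℂ R] (F : MvPolynomial (Fin 3) ℂ)
    (A : Matrix (Fin 3) (Fin 3) R) : MvPolynomial (Fin 3) R :=
  MvPolynomial.aeval (fun i => ∑ j, MvPolynomial.C (A i j) * MvPolynomial.X j) F

/-! ### The ambient space `ℙ⁸ × ℙᴺ` and its Zariski topology -/

/-- `ℙ⁸ × ℙᴺ`, where `ℙᴺ = ℙ H⁰(ℙ², 𝒪(d))` parametrizes plane curves of degree `d`. -/
def Ambient (d : ℕ) : Type := ℙ ℂ Mat × ℙ ℂ (Form d)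

/-- The indices of the homogeneous coordinates: matrix entries, and coefficients of forms. -/
abbrev CoordIdx := (Fin 3 × Fin 3) ⊕ (Fin 3 →₀ ℕ)

/-- The coordinates of a pair (matrix, form). -/
def coords (A : Mat) (G : MvPolynomial (Fin 3) ℂ) : CoordIdx → ℂ :=
  Sum.elim (fun ij => A ij.1 ij.2) (fun m => MvPolynomial.coeff m G)

/-- `P` is bihomogeneous of bidegree `n` in the matrix entries and the coefficients of forms. -/
def IsBihomogeneous (P : MvPolynomial CoordIdx ℂ) (n : ℕ × ℕ) : Prop :=
  MvPolynomial.IsWeightedHomogeneous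
    (Sum.elim (fun _ => (1, 0)) (fun _ => (0, 1)) : CoordIdx → ℕ × ℕ) P n

/-- The Zariski topology of `ℙ⁸ × ℙᴺ`: the complements of the zero loci of bihomogeneous
polynomials form a basis of open sets. -/
instance zariskiTopology (d : ℕ) : TopologicalSpace (Ambient d) :=
  TopologicalSpace.generateFrom
    {U | ∃ P n, IsBihomogeneous P n ∧
      U = {q : Ambient d | MvPolynomial.eval (coords q.1.rep (q.2.rep : Form d)) P ≠ 0}}

/-- `q` is the point `([A], [G])`; in particular `A` and `G` are nonzero. -/
def Represents {d : ℕ} (q : Ambient d) (A : Mat) (G : MvPolynomial (Fin 3) ℂ) : Prop :=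
  ∃ (G' : Form d) (hA : A ≠ 0) (hG : G' ≠ 0), (G' : MvPolynomial (Fin 3) ℂ) = G ∧
    q = (Projectivization.mk ℂ A hA, Projectivization.mk ℂ G' hG)

/-- The orbit of a point under the right action of `PGL(3)`. -/
def orbit {d : ℕ} (q : Ambient d) : Set (Ambient d) :=
  {q' | ∃ A G, Represents q A G ∧
    ∃ g : GL (Fin 3) ℂ, Represents q' (A * (g : Mat)) (subst G (g : Mat))}

/-! ### The projective normal cone -/

/-- The graph of the rational map `ℙ⁸ ⇢ ℙᴺ`, `A ↦ F ∘ A`, over the complement of its base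
scheme, the locus `F ∘ A ≡ 0`. -/
def graph {d : ℕ} (F : Form d) : Set (Ambient d) :=
  {q | ∃ A, Represents q A (subst F A)}

/-- The support of the projective normal cone. The closure of the graph is the blow-up of `ℙ⁸`
along the base scheme, and the cone is its exceptional divisor, that is, the part of it that lies
over the base scheme. -/
def PNC {d : ℕ} (F : Form d) : Set (Ambient d) :=
  {q ∈ closure (graph F) | subst (F : MvPolynomial (Fin 3) ℂ) q.1.rep = 0}

/-! ### Germs and limits -/

/-- `G` generates the ideal of the flat limit as `t → 0` of the family `F ∘ α(t)`: a power of `t`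
is cleared from `F ∘ α(t)`, and then `t` is set to `0`. -/
def IsLimit (F : MvPolynomial (Fin 3) ℂ) (α : Matrix (Fin 3) (Fin 3) ℂ[X])
    (G : MvPolynomial (Fin 3) ℂ) : Prop :=
  G ≠ 0 ∧ ∃ (k : ℕ) (H : MvPolynomial (Fin 3) ℂ[X]),
    subst F α = MvPolynomial.C (Polynomial.X ^ k) * H ∧
      MvPolynomial.map (Polynomial.evalRingHom 0) H = G

/-- `q` is the centre `(α(0), lim F ∘ α(t))` of the lift of the germ `α` to the blow-up. -/
def IsLiftCenter {d : ℕ} (F : Form d) (α : Matrix (Fin 3) (Fin 3) ℂ[X]) (q : Ambient d) : Prop :=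
  ∃ G, IsLimit F α G ∧ Represents q (α.map (Polynomial.eval 0)) G

/-- The germ `α`, through its limit, determines a component of the projective normal cone: the
closure of the `PGL(3)`-orbit of the centre of its lift is an irreducible component. -/
def DeterminesComponent {d : ℕ} (F : Form d) (α : Matrix (Fin 3) (Fin 3) ℂ[X]) : Prop :=
  ∃ q, IsLiftCenter F α q ∧
    ∃ Z ∈ irreducibleComponents (PNC F), (Subtype.val '' Z : Set (Ambient d)) = closure (orbit q)

/-! ### Formal branches at `(1:0:0)` and characteristic rationals -/

/-- `z = f(y)` is a formal branch of `F = 0` at `p = (1:0:0)` tangent to, and different from, the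
line `z = 0`: a nonzero Puiseux series (the exponents have a common denominator) of order
`λ₀ > 1` with `F(1, y, f(y)) = 0`. -/
structure IsTangentBranch (F : MvPolynomial (Fin 3) ℂ) (f : HahnSeries ℚ ℂ) : Prop where
  ne_zero : f ≠ 0
  puiseux : ∃ n : ℕ, 0 < n ∧ ∀ l ∈ f.support, ∃ k : ℤ, l * n = k
  one_lt_order : 1 < f.order
  root : MvPolynomial.aeval ![1, HahnSeries.single (1 : ℚ) (1 : ℂ), f] F = 0

/-- Two tangent branches truncate below `y^C` to the given `φ` and have different coefficients
of `y^C`. -/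
def IsCharacteristicFor (F : MvPolynomial (Fin 3) ℂ) (φ : HahnSeries ℚ ℂ) (C : ℚ) : Prop :=
  ∃ g h : HahnSeries ℚ ℂ, IsTangentBranch F g ∧ IsTangentBranch F h ∧
    HahnSeries.truncLT C g = φ ∧ HahnSeries.truncLT C h = φ ∧ g.coeff C ≠ h.coeff C

/-- `C` is characteristic for `F = 0` at `(1:0:0)` with respect to `z = 0`: two tangent branches
have the same nonzero truncation, but different coefficients of `y^C`. -/
def IsCharacteristic (F : MvPolynomial (Fin 3) ℂ) (C : ℚ) : Prop :=
  ∃ φ : HahnSeries ℚ ℂ, φ ≠ 0 ∧ IsCharacteristicFor F φ C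

/-- The conditions on `(f, C)` and `(a, b, c)` for a germ of type V: with `λ₀` the order of `f`,
`C > λ₀`, `c / a = C`, `b / a = (C - λ₀) / 2 + 1`, and `f_(C)(t^a)` has integer exponents. -/
structure IsTypeV (f : HahnSeries ℚ ℂ) (C : ℚ) (a b c : ℕ) : Prop where
  order_lt : f.order < C
  a_pos : 0 < a
  hc : (c : ℚ) = C * a
  hb : (b : ℚ) = ((C - f.order) / 2 + 1) * a
  integral : ∀ l ∈ f.support, l < C → ∃ n : ℕ, l * a = n

/-- `f(t^a) = ∑ γ_l t^(a l)`, truncated modulo `t^c`; the term in `t^n` has `l = n / a`. -/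
def truncSubst (f : HahnSeries ℚ ℂ) (a c : ℕ) : ℂ[X] :=
  ∑ n ∈ Finset.range c, Polynomial.monomial n (f.coeff (n / a))

/-- `f'(t^a) t^b = ∑ l γ_l t^(a (l - 1) + b)`, truncated modulo `t^c`; the term in `t^n` has
`l = (n - b) / a + 1`. -/
def truncDerivSubst (f : HahnSeries ℚ ℂ) (a b c : ℕ) : ℂ[X] :=
  ∑ n ∈ Finset.range c, Polynomial.monomial n
    (((((n : ℚ) - b) / a + 1 : ℚ) : ℂ) * f.coeff (((n : ℚ) - b) / a + 1))

/-- The germ `α(t)` attached to a branch `f` and integers `a, b, c`. -/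
def typeVGerm (f : HahnSeries ℚ ℂ) (a b c : ℕ) : Matrix (Fin 3) (Fin 3) ℂ[X] :=
  !![1, 0, 0;
     Polynomial.X ^ a, Polynomial.X ^ b, 0;
     truncSubst f a c, truncDerivSubst f a b c, Polynomial.X ^ c]

end PlaneCurve

end

/-! Two facts combine: the projective normal cone is purely of dimension 7, and the limit along a
germ of type V can be written down.

Dimension. The closure of the graph of `A ↦ F ∘ A` is irreducible of dimension 8, and in each chart
the cone is cut out in it by one equation (`mem_PNC_iff`), the exceptional divisor being Cartier. By
Krull's principal ideal theorem an irreducible subset of the cone that meets the chart is dense in a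
component if its dimension is at least 7 (`isComponent_of_le_trdeg`) and is not if the dimension is
at most 6 (`not_isComponent_of_trdeg_le`). Dimensions are transcendence degrees of coordinate rings
in the charts where the upper left matrix entry and one coefficient of the form are nonzero. An
orbit is irreducible, so only its dimension matters.

The limit. By Newton–Puiseux, after a ramified base change `F (1, y, z)` is near the origin a unit
times a power of the parameter times a product of factors `z - h(y)`. Along the germ, put `y = t^a +
t^b Y` and `z = f + f' t^b Y + t^c Z`. The relation `λ₀ + 2 (b/a - 1) = C` says that the quadratic
Taylor error of `f` first appears exactly at order `t^c`. A factor whose `h` agrees with `f` below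
`C` therefore has leading coefficient `Z + A Y² + B Y - e`, where `e` is the coefficient of `y^C` in
`h`. Here `A ≠ 0` because `λ₀ > 1`, and `B` comes from the term of `f' t^b` lost at order `t^c` by
truncation. Every other factor has a nonzero constant as leading coefficient. In the chart `x = 1`
the limit is thus a product of parabolas of one pencil, indexed by the coefficients `e`
(`exists_limit`).

The orbit. The matrix `α(0)` has rank one, so the orbit remembers the first row of `g` and the form
`G ∘ g`. If two different `e` occur, seven entries of a normalized `g` are algebraic over the
coordinates, and the orbit has dimension at least 7 (`seven_le_trdeg_orbit`). If only one occurs,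
the stabilizer of the multiple parabola contains the translations along it and a torus; they
normalize two entries of `g` beyond the scaling, and the dimension is at most 6
(`trdeg_orbit_le_six`). Since `f` contributes its own coefficient, two different `e` occur exactly
when `C` is characteristic through the truncation of `f`.

Finiteness holds because branches are roots of one nonzero polynomial, and `C` is the order of the
difference of two of them. -/

noncomputable section

/-! ### Transcendence degree and Krull's principal ideal theorem -/

/-- The transcendence degree drops along a surjection of domains with nonzero kernel. -/
theorem Algebra.trdeg_lt_of_surjective {k A A' : Type} [Field k] [CommRing A] [IsDomain A]
    [CommRing A'] [IsDomain A'] [Algebra k A] [Algebra k A'] (f : A →ₐ[k] A')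
    (hf : Function.Surjective f) (fin : Algebra.trdeg k A < Cardinal.aleph0) {y : A} (hy : y ≠ 0)
    (hfy : f y = 0) : Algebra.trdeg k A' < Algebra.trdeg k A := by
  refine lt_of_le_of_ne (_root_.trdeg_le_of_surjective f hf) fun heq => ?_
  obtain ⟨s, hs⟩ := exists_isTranscendenceBasis k A'
  choose g hg using hf
  have hcomp : (fun i : s => f (g i)) = ((↑) : s → A') := funext fun i => hg _
  have hx : AlgebraicIndependent k (fun i : s => g i) :=
    AlgebraicIndependent.of_comp f (by
      have := hs.1
      rwa [← hcomp] at this)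
  have hb := hx.isTranscendenceBasis_of_trdeg_le fin
    (by rw [← heq, hs.cardinalMk_eq_trdeg])
  have halg := hb.isAlgebraic.isAlgebraic y
  -- The lifted basis would be a transcendence basis of `A`. An equation of `y` over it can be taken
  -- with nonzero constant term; applying `f`, which kills `y`, leaves that term as a relation in
  -- `s`.
  obtain ⟨p, hp0, hp⟩ := halg.exists_nonzero_coeff_and_aeval_eq_zero
    (mem_nonZeroDivisors_of_ne_zero hy)
  have hmem : (p.coeff 0 : A) ∈ (MvPolynomial.aeval (R := k) fun i : s => g i).range :=
    Algebra.adjoin_range_eq_range_aeval k (fun i : s => g i) ▸ (p.coeff 0).2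
  obtain ⟨P, hP⟩ := hmem
  have h0 : f (p.coeff 0 : A) = 0 := by
    rw [Polynomial.aeval_eq_sum_range, Finset.sum_range_succ'] at hp
    have := congrArg f hp
    simpa [map_sum, hfy, Algebra.smul_def] using this
  have hP' : MvPolynomial.aeval ((↑) : s → A') P = 0 := by
    have h1 := MvPolynomial.comp_aeval_apply (fun i : s => g i) f P
    rw [hcomp] at h1
    rw [← h1, ← h0, ← hP]
    rfl
  apply hp0
  ext
  rw [← hP, hs.1 (by simpa using hP' : MvPolynomial.aeval ((↑) : s → A') P
    = MvPolynomial.aeval ((↑) : s → A') 0)]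
  simp

/-- A nonzero prime element cuts the transcendence degree of a polynomial ring by at most one. -/
theorem MvPolynomial.trdeg_quotient_of_height_le_one {k : Type} [Field k] {n : ℕ}
    (p : Ideal (MvPolynomial (Fin n) k)) [p.IsPrime] (hp : p.height ≤ 1) :
    (n : Cardinal) ≤ Algebra.trdeg k (MvPolynomial (Fin n) k ⧸ p) + 1 := by
  classical
  obtain rfl | hbot := eq_or_ne p ⊥
  · have := (AlgEquiv.quotientBot k (MvPolynomial (Fin n) k)).trdeg_eq
    rw [this]
    simp
  have hht : p.height = 1 := by
    refine le_antisymm hp ?_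
    rw [Order.one_le_iff_ne_zero]
    intro h0
    rw [Ideal.height_eq_zero_iff, IsDomain.minimalPrimes_eq_singleton_bot] at h0
    exact hbot h0
  obtain ⟨f, hf⟩ := (UniqueFactorizationMonoid.isPrincipal_of_height_eq_one hht).principal
  have hf0 : f ≠ 0 := by
    rintro rfl
    exact hbot (by simpa using hf)
  have hmem : ∀ g, g ∈ p ↔ f ∣ g := fun g => by
    rw [hf]; exact Ideal.mem_span_singleton
  have hvar : ∃ i, f.degreeOf i ≠ 0 := by
    by_contra! h
    have htot : f.totalDegree = 0 := by
      rw [MvPolynomial.totalDegree_eq_zero_iff]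
      intro m hm i
      have := MvPolynomial.monomial_le_degreeOf i hm
      rw [h i] at this
      omega
    rw [MvPolynomial.totalDegree_eq_zero_iff_eq_C] at htot
    have hunit : IsUnit f := by
      rw [htot]
      refine (IsUnit.mk0 _ fun h0 => hf0 ?_).map MvPolynomial.C
      rw [htot, h0, map_zero]
    exact Ideal.IsPrime.ne_top ‹_› (Ideal.eq_top_of_isUnit_mem _ ((hmem f).2 dvd_rfl) hunit)
  obtain ⟨i, hi⟩ := hvar
  -- A nonzero multiple of `f` still involves `X i`, so the other `n - 1` variables satisfy no
  -- relation modulo `p`.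
  have hind : AlgebraicIndependent k
      (fun j : {j : Fin n // j ≠ i} => Ideal.Quotient.mkₐ k p (MvPolynomial.X j.1)) := by
    rw [algebraicIndependent_iff]
    intro P hP
    have h1 : MvPolynomial.aeval (fun j : {j : Fin n // j ≠ i} =>
        Ideal.Quotient.mkₐ k p (MvPolynomial.X j.1)) P
        = Ideal.Quotient.mkₐ k p (MvPolynomial.rename Subtype.val P) := by
      rw [MvPolynomial.rename_eq_aeval, MvPolynomial.comp_aeval_apply]
      rfl
    rw [h1] at hP
    have hdvd : f ∣ MvPolynomial.rename Subtype.val P :=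
      (hmem _).1 (Ideal.Quotient.eq_zero_iff_mem.mp hP)
    obtain ⟨q, hq⟩ := hdvd
    by_contra hP0
    have hr0 : MvPolynomial.rename (Subtype.val : {j : Fin n // j ≠ i} → Fin n) P ≠ 0 := by
      intro h
      exact hP0 (MvPolynomial.rename_injective _ Subtype.val_injective (by simpa using h))
    have hq0 : q ≠ 0 := by
      rintro rfl
      exact hr0 (by simpa using hq)
    have hdeg := MvPolynomial.degreeOf_mul_eq (n := i) hf0 hq0
    rw [← hq] at hdeg
    have : MvPolynomial.degreeOf i
        (MvPolynomial.rename (Subtype.val : {j : Fin n // j ≠ i} → Fin n) P) = 0 := by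
      refine Nat.le_zero.mp (MvPolynomial.degreeOf_le_iff.mpr fun m hm => ?_)
      by_contra hmi
      obtain ⟨u, hu, -⟩ := MvPolynomial.coeff_rename_ne_zero _ _ _
        (MvPolynomial.mem_support_iff.mp hm)
      rw [← hu] at hmi
      exact hmi (Finsupp.mapDomain_of_notMem_range _ _ (by simp)).le
    omega
  have := hind.cardinalMk_le_trdeg
  rw [Cardinal.mk_fintype, Fintype.card_subtype_compl, Fintype.card_fin,
    Fintype.card_subtype_eq] at this
  calc (n : Cardinal) ≤ ((n - 1 : ℕ) : Cardinal) + 1 := by exact_mod_cast (by omega)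
    _ ≤ _ := by gcongr

/-- A minimal prime over a principal ideal of a finitely generated domain has codimension at most
one. -/
theorem Algebra.trdeg_le_trdeg_quotient_add_one {k A : Type} [Field k] [CommRing A] [IsDomain A]
    [Algebra k A] [Algebra.FiniteType k A] (e : A) (P : Ideal A)
    (hP : P ∈ (Ideal.span {e}).minimalPrimes) :
    Algebra.trdeg k A ≤ Algebra.trdeg k (A ⧸ P) + 1 := by
  have hprime : P.IsPrime := hP.1.1
  have := Algebra.FiniteType.isNoetherianRing k A
  have hht : P.height ≤ 1 := Ideal.height_le_one_of_isPrincipal_of_mem_minimalPrimes _ P hP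
  -- Noether normalization moves the question to a polynomial ring. Going down, valid over this
  -- normal base, keeps the height of the contracted prime at most one.
  obtain ⟨n, g, ginj, gint⟩ := exists_integral_inj_algHom_of_fg k A
  algebraize [g.toRingHom]
  have hinj : Function.Injective (algebraMap (MvPolynomial (Fin n) k) A) := ginj
  have : FaithfulSMul (MvPolynomial (Fin n) k) A :=
    (faithfulSMul_iff_algebraMap_injective _ _).mpr hinj
  have : Algebra.IsIntegral (MvPolynomial (Fin n) k) A := ⟨gint⟩
  have : Module.IsTorsionFree (MvPolynomial (Fin n) k) A := inferInstance
  have hst : IsScalarTower k (MvPolynomial (Fin n) k) A := .of_algHom g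
  have : Algebra.HasGoingDown (MvPolynomial (Fin n) k) A := inferInstance
  set p := P.under (MvPolynomial (Fin n) k) with hpdef
  have hpht : p.height ≤ 1 := by
    have := Ideal.height_eq_height_add_of_liesOver_of_hasGoingDown p P
    exact le_trans (by rw [this]; exact le_self_add) hht
  have h1 := MvPolynomial.trdeg_quotient_of_height_le_one p hpht
  have h2 : Algebra.trdeg k A = n := by
    have := _root_.trdeg_add_eq k (MvPolynomial (Fin n) k) (A := A)
    rw [← this, trdeg_eq_zero (R := MvPolynomial (Fin n) k)]
    simp
  have h3 : Algebra.trdeg k (MvPolynomial (Fin n) k ⧸ p) ≤ Algebra.trdeg k (A ⧸ P) :=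
    _root_.trdeg_le_of_injective (Ideal.quotientMapₐ (I := p) P g le_rfl)
      (Ideal.quotientMap_injective' (f := g.toRingHom) (I := P) (J := p) (H := le_rfl) le_rfl)
  rw [h2]
  exact h1.trans (add_le_add_left h3 1)


/-! ### Hensel's lemma and the Newton–Puiseux theorem -/

namespace PowerSeries

/-- The substitution `t ↦ t ^ k` as a ring homomorphism. -/
abbrev ramify (k : ℕ) (hk : k ≠ 0) : PowerSeries ℂ →+* PowerSeries ℂ :=
  (expand (R := ℂ) k hk : PowerSeries ℂ →ₐ[ℂ] PowerSeries ℂ)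

theorem exists_eq_X_pow_mul {c : PowerSeries ℂ} (hc : c ≠ 0) :
    ∃ (v : ℕ) (u : PowerSeries ℂ), c = X ^ v * u ∧ constantCoeff u ≠ 0 := by
  obtain ⟨u, hu⟩ := X_pow_order_dvd (φ := c)
  refine ⟨_, u, hu, fun h => ?_⟩
  obtain ⟨w, hw⟩ := X_dvd_iff.mpr h
  have h1 : X ^ (c.order.toNat + 1) ∣ c := ⟨w, by rw [pow_succ, mul_assoc, ← hw]; exact hu⟩
  rw [X_pow_dvd_iff] at h1
  have h2 := coeff_order hc
  exact h2 (h1 _ (Nat.lt_succ_self _))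

/-- Hensel's lemma for power series in one variable: the factor `X ^ m` of a polynomial modulo the
maximal ideal lifts. -/
theorem exists_factor_of_map_constantCoeff (G : (PowerSeries ℂ)[X])
    (hG : G.map (constantCoeff (R := ℂ)) ≠ 0) :
    ∃ (D Q : (PowerSeries ℂ)[X]) (m : ℕ), G = D * Q ∧ D.Monic ∧ D.natDegree = m ∧
      D.map (constantCoeff (R := ℂ)) = Polynomial.X ^ m ∧ constantCoeff (Q.coeff 0) ≠ 0 := by
  have : IsAdicComplete (IsLocalRing.maximalIdeal (PowerSeries ℂ)) (PowerSeries ℂ) := by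
    rw [maximalIdeal_eq_span_X]
    infer_instance
  have hres : ∀ c : PowerSeries ℂ, c ∈ IsLocalRing.maximalIdeal (PowerSeries ℂ) ↔
      constantCoeff c = 0 := fun c => by
    rw [maximalIdeal_eq_span_X, Ideal.mem_span_singleton, X_dvd_iff]
  have hne : (G : PowerSeries (PowerSeries ℂ)).map (IsLocalRing.residue (PowerSeries ℂ)) ≠ 0 := by
    intro h
    apply hG
    ext i
    have := congrArg (coeff i) h
    rw [coeff_map, Polynomial.coeff_coe, map_zero, IsLocalRing.residue_eq_zero_iff, hres] at this
    simpa using this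
  obtain ⟨D, h, H⟩ := exists_isWeierstrassFactorization hne
  have hmon := H.isDistinguishedAt.monic
  have hD : IsWeierstrassFactorization (D : PowerSeries (PowerSeries ℂ)) D 1 :=
    ⟨H.isDistinguishedAt, isUnit_one, (mul_one _).symm⟩
  have hdeg := hD.natDegree_eq_toNat_order_map
  -- Weierstrass preparation only gives a power series cofactor `h`. Uniqueness of Weierstrass
  -- division identifies it with the polynomial quotient `G /ₘ D`.
  have hw1 : IsWeierstrassDivision (G : PowerSeries (PowerSeries ℂ)) D h 0 :=
    ⟨by rw [Polynomial.degree_zero]; exact WithBot.bot_lt_coe _, by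
      rw [H.eq_mul, Polynomial.coe_zero, add_zero]⟩
  have hw2 : IsWeierstrassDivision (G : PowerSeries (PowerSeries ℂ)) D
      ((G /ₘ D : (PowerSeries ℂ)[X]) : PowerSeries (PowerSeries ℂ)) (G %ₘ D) := by
    refine ⟨?_, ?_⟩
    · have := Polynomial.degree_modByMonic_lt G hmon
      rw [Polynomial.degree_eq_natDegree hmon.ne_zero, hdeg] at this
      exact this
    · rw [← Polynomial.coe_mul, ← Polynomial.coe_add, add_comm, Polynomial.modByMonic_add_div]
  obtain ⟨h1, h2⟩ := hw1.elim hD.map_ne_zero hw2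
  refine ⟨D, G /ₘ D, D.natDegree, ?_, hmon, rfl, ?_, ?_⟩
  · conv_lhs => rw [← Polynomial.modByMonic_add_div G D, ← h2, zero_add]
  · ext i
    rw [Polynomial.coeff_map, Polynomial.coeff_X_pow]
    obtain hi | hi | hi := lt_trichotomy i D.natDegree
    · rw [if_neg hi.ne]
      exact (hres _).mp (H.isDistinguishedAt.mem hi)
    · rw [if_pos hi, hi, hmon.coeff_natDegree, map_one]
    · rw [if_neg hi.ne', Polynomial.coeff_eq_zero_of_natDegree_lt hi, map_zero]
  · have hu := H.isUnit
    rw [h1, isUnit_iff_constantCoeff, isUnit_iff_constantCoeff] at hu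
    simpa using hu.ne_zero

theorem constantCoeff_expand' (k : ℕ) (hk : k ≠ 0) (c : PowerSeries ℂ) :
    constantCoeff (expand k hk c) = constantCoeff c := constantCoeff_expand k hk c

theorem splits_map_expand_mul {H : (PowerSeries ℂ)[X]} {k : ℕ} (hk : k ≠ 0)
    (h : (H.map (ramify k hk)).Splits) (l : ℕ) (hl : l ≠ 0) :
    (H.map (ramify (l * k) (mul_ne_zero hl hk))).Splits := by
  have := h.map (ramify l hl)
  rw [Polynomial.map_map] at this
  convert this using 2
  ext1 c
  exact expand_mul l hl k hk c

/-- A polynomial with vanishing subleading coefficient whose reduction is not a power of the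
variable is a product of two monic polynomials of smaller degree, up to a translation. -/
theorem exists_taylor_eq_mul {n : ℕ} (hn : 2 ≤ n) (H : (PowerSeries ℂ)[X]) (hH : H.Monic)
    (hdeg : H.natDegree = n) (h1 : constantCoeff (H.coeff (n - 1)) = 0) {j : ℕ} (hj : j < n)
    (hj0 : constantCoeff (H.coeff j) ≠ 0) :
    ∃ (r : PowerSeries ℂ) (D Q : (PowerSeries ℂ)[X]), H.taylor r = D * Q ∧ D.Monic ∧ Q.Monic ∧
      D.natDegree < n ∧ Q.natDegree < n := by
  set h := H.map (constantCoeff (R := ℂ)) with hh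
  have hmon : h.Monic := hH.map _
  have hnd : h.natDegree = n := by rw [hh, hH.natDegree_map, hdeg]
  obtain ⟨ζ, hζ⟩ := Complex.exists_root (f := h) (by
    rw [Polynomial.degree_eq_natDegree hmon.ne_zero, hnd]; exact_mod_cast (by omega))
  set G := H.taylor (C ζ) with hGdef
  have hGm : G.Monic := by
    rw [Polynomial.Monic, hGdef, Polynomial.leadingCoeff_taylor]; exact hH
  have hGd : G.natDegree = n := by rw [hGdef, Polynomial.natDegree_taylor, hdeg]
  have hGmap : G.map (constantCoeff (R := ℂ)) = h.taylor ζ := by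
    rw [hGdef, Polynomial.map_taylor, constantCoeff_C]
  obtain ⟨D, Q, m, hDQ, hD, hDm, hDmap, hQ⟩ := exists_factor_of_map_constantCoeff G
    (hGm.map _).ne_zero
  have hQm : Q.Monic := hD.of_mul_monic_left (hDQ ▸ hGm)
  have hsum : m + Q.natDegree = n := by
    rw [← hGd, hDQ, hD.natDegree_mul hQm, hDm]
  refine ⟨C ζ, D, Q, hDQ, hD, hQm, ?_, ?_⟩
  -- If `D` had full degree, the reduction would be `(X - ζ) ^ n`. The vanishing subleading
  -- coefficient then forces `ζ = 0`, against the nonzero coefficient at `j`.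
  · rw [hDm]
    by_contra hmn
    have hQ0 : Q = 1 := hQm.natDegree_eq_zero.mp (by omega)
    have hm : m = n := by rw [hQ0, Polynomial.natDegree_one] at hsum; exact hsum
    have h2 : h.taylor ζ = Polynomial.X ^ n := by
      rw [← hGmap, hDQ, hQ0, mul_one, hDmap, hm]
    have h3 : h = (Polynomial.X + Polynomial.C (-ζ)) ^ n := by
      have := congrArg (Polynomial.taylor (-ζ)) h2
      rwa [Polynomial.taylor_taylor, neg_add_cancel, Polynomial.taylor_zero,
        Polynomial.taylor_X_pow] at this
    have h4 : h.coeff (n - 1) = 0 := by rw [hh, Polynomial.coeff_map, h1]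
    rw [h3, Polynomial.coeff_X_add_C_pow, show n - (n - 1) = 1 by omega, pow_one] at h4
    have hc : ((n.choose (n - 1) : ℕ) : ℂ) ≠ 0 := by
      exact_mod_cast (Nat.choose_pos (by omega)).ne'
    have hz : ζ = 0 := by simpa [hc] using h4
    apply hj0
    have : h.coeff j = 0 := by
      rw [h3, hz, neg_zero, Polynomial.C_0, add_zero, Polynomial.coeff_X_pow, if_neg hj.ne]
    rwa [hh, Polynomial.coeff_map] at this
  · have : m ≠ 0 := by
      intro hm
      have h5 : (G.map (constantCoeff (R := ℂ))).eval 0 = 0 := by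
        rw [hGmap, Polynomial.taylor_eval, zero_add]; exact hζ
      rw [hDQ, Polynomial.map_mul, hDmap, hm, pow_zero, one_mul, ← Polynomial.coeff_zero_eq_eval_zero,
        Polynomial.coeff_map] at h5
      exact hQ h5
    omega

/-- After a ramified base change, a polynomial with vanishing subleading coefficient is obtained
by scaling from one whose reduction is not a power of the variable. -/
theorem exists_map_expand_eq_scaleRoots {n : ℕ} (H : (PowerSeries ℂ)[X]) (hH : H.Monic)
    (hdeg : H.natDegree = n) (h1 : H.coeff (n - 1) = 0) {i : ℕ} (hi : i < n)
    (hi0 : H.coeff i ≠ 0) :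
    ∃ (q : ℕ) (hq : q ≠ 0) (p j : ℕ) (K : (PowerSeries ℂ)[X]), K.Monic ∧ K.natDegree = n ∧
      H.map (ramify q hq) = K.scaleRoots (X ^ p) ∧
      K.coeff (n - 1) = 0 ∧ j < n ∧ constantCoeff (K.coeff j) ≠ 0 := by
  classical
  have hex : ∀ j, ∃ (v : ℕ) (u : PowerSeries ℂ), H.coeff j ≠ 0 →
      H.coeff j = X ^ v * u ∧ constantCoeff u ≠ 0 := fun j => by
    by_cases hj : H.coeff j = 0
    · exact ⟨0, 0, fun h => absurd hj h⟩
    · obtain ⟨v, u, h⟩ := exists_eq_X_pow_mul hj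
      exact ⟨v, u, fun _ => h⟩
  choose v u hvu using hex
  -- The index `j` realizes the extreme slope of the Newton polygon. After `t ↦ t ^ (n - j)` this
  -- slope is the integer `v j`; minimality keeps the rescaled coefficients integral, and the one at
  -- `j` becomes a unit.
  obtain ⟨j, hjmem, hjmin⟩ := Finset.exists_min_image
    ((Finset.range n).filter fun j => H.coeff j ≠ 0) (fun j => (v j : ℚ) / ((n : ℚ) - j))
    ⟨i, by simp [hi, hi0]⟩
  simp only [Finset.mem_filter, Finset.mem_range] at hjmem hjmin
  have hq : n - j ≠ 0 := by omega
  have key : ∀ l, l < n → H.coeff l ≠ 0 → v j * (n - l) ≤ (n - j) * v l := by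
    intro l hl hl0
    have := hjmin l ⟨hl, hl0⟩
    rw [div_le_div_iff₀ (by rw [sub_pos]; exact_mod_cast hjmem.1)
      (by rw [sub_pos]; exact_mod_cast hl)] at this
    have h2 : ((v j * (n - l) : ℕ) : ℚ) ≤ ((n - j) * v l : ℕ) := by
      push_cast [Nat.cast_sub hl.le, Nat.cast_sub hjmem.1.le]
      linarith
    exact_mod_cast h2
  set c : ℕ → PowerSeries ℂ := fun l => if H.coeff l = 0 then 0 else
    X ^ ((n - j) * v l - v j * (n - l)) * expand (n - j) hq (u l) with hc
  have hcl : ∀ l, l < n → expand (n - j) hq (H.coeff l) = c l * (X ^ v j) ^ (n - l) := by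
    intro l hl
    by_cases hl0 : H.coeff l = 0
    · simp [hc, hl0]
    · simp only [hc, if_neg hl0]
      conv_lhs => rw [(hvu l hl0).1, map_mul, map_pow, expand_X]
      rw [mul_right_comm, ← pow_mul, ← pow_mul, ← pow_add, Nat.sub_add_cancel (key l hl hl0)]
  set K : (PowerSeries ℂ)[X] := Polynomial.X ^ n +
    ∑ l ∈ Finset.range n, Polynomial.C (c l) * Polynomial.X ^ l with hK
  have hlt : (∑ l ∈ Finset.range n, Polynomial.C (c l) * Polynomial.X ^ l).degree
      < (n : WithBot ℕ) := Polynomial.degree_sum_fin_lt (n := n) (fun l => c l) |>.trans_eq' (by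
        rw [Finset.sum_range])
  have hKm : K.Monic := Polynomial.monic_X_pow_add hlt
  have hKd : K.natDegree = n := by
    rw [hK, Polynomial.natDegree_add_eq_left_of_degree_lt, Polynomial.natDegree_X_pow]
    rwa [Polynomial.degree_X_pow]
  have hKc : ∀ l, l < n → K.coeff l = c l := by
    intro l hl
    simp [hK, Polynomial.coeff_X_pow, hl.ne, hl]
  refine ⟨n - j, hq, v j, j, K, hKm, hKd, ?_, ?_, hjmem.1, ?_⟩
  · ext1 l
    rw [Polynomial.coeff_map, Polynomial.coeff_scaleRoots, hKd]
    obtain hl | hl | hl := lt_trichotomy l n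
    · rw [hKc l hl]
      exact hcl l hl
    · have e1 : H.coeff l = 1 := by rw [hl, ← hdeg, hH.coeff_natDegree]
      have e2 : K.coeff l = 1 := by rw [hl, ← hKd, hKm.coeff_natDegree]
      rw [e1, e2, map_one, hl, Nat.sub_self, pow_zero, one_mul]
    · rw [Polynomial.coeff_eq_zero_of_natDegree_lt (by omega),
        Polynomial.coeff_eq_zero_of_natDegree_lt (by omega)]
      simp
  · rw [hKc _ (by omega)]
    simp [hc, h1]
  · rw [hKc _ hjmem.1]
    simp only [hc, if_neg hjmem.2]
    rw [mul_comm (n - j), Nat.sub_self, pow_zero, one_mul, constantCoeff_expand']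
    exact (hvu j hjmem.2).2

/-- Translation shifts all roots equally. This is the Tschirnhaus step by which
`exists_splits_map_expand` makes the subleading coefficient vanish. -/
theorem coeff_taylor_natDegree_sub_one {n : ℕ} (hn : 2 ≤ n) (H : (PowerSeries ℂ)[X]) (hH : H.Monic)
    (hdeg : H.natDegree = n) (r : PowerSeries ℂ) :
    (H.taylor r).coeff (n - 1) = H.coeff (n - 1) + n * r := by
  have hd : (Polynomial.hasseDeriv (n - 1) H).natDegree < 2 := by
    have := Polynomial.natDegree_hasseDeriv_le H (n - 1)
    omega
  rw [Polynomial.taylor_coeff, Polynomial.eval_eq_sum_range' hd, Finset.sum_range_succ,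
    Finset.sum_range_one, Polynomial.hasseDeriv_coeff, Polynomial.hasseDeriv_coeff,
    show 1 + (n - 1) = n by omega, zero_add, Nat.choose_self, Nat.choose_symm (by omega),
    Nat.choose_one_right, ← hdeg, hH.coeff_natDegree]
  simp

/-- **Newton–Puiseux theorem**: a monic polynomial over `ℂ⟦t⟧` splits after substituting
`t ↦ t ^ k` for some positive `k`. -/
theorem exists_splits_map_expand (H : (PowerSeries ℂ)[X]) (hH : H.Monic) :
    ∃ (k : ℕ) (hk : k ≠ 0), (H.map (ramify k hk)).Splits := by
  induction hdeg : H.natDegree using Nat.strong_induction_on generalizing H with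
  | _ n ih =>
  obtain hn | hn := Nat.lt_or_ge n 2
  · refine ⟨1, one_ne_zero, Polynomial.Splits.of_natDegree_le_one_of_monic ?_ (hH.map _)⟩
    rw [hH.natDegree_map]
    omega
  suffices key : ∀ H : (PowerSeries ℂ)[X], H.Monic → H.natDegree = n → H.coeff (n - 1) = 0 →
      ∃ (k : ℕ) (hk : k ≠ 0), (H.map (ramify k hk)).Splits by
    set r : PowerSeries ℂ := C ((n : ℂ)⁻¹) * -H.coeff (n - 1)
    obtain ⟨k, hk, hs⟩ := key (H.taylor r)
      (by rw [Polynomial.Monic, Polynomial.leadingCoeff_taylor]; exact hH)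
      (by rw [Polynomial.natDegree_taylor, hdeg]) (by
        rw [coeff_taylor_natDegree_sub_one hn H hH hdeg, ← mul_assoc,
          ← map_natCast (C (R := ℂ)), ← map_mul, mul_inv_cancel₀ (by exact_mod_cast (by omega)),
          map_one, one_mul, add_neg_cancel])
    refine ⟨k, hk, ?_⟩
    have := hs.taylor (-expand k hk r)
    rw [Polynomial.map_taylor, Polynomial.taylor_taylor] at this
    simpa using this
  clear! H
  intro H hH hdeg h1
  by_cases hall : ∀ i, i < n → H.coeff i = 0
  · have : H = Polynomial.X ^ n := by
      ext1 i
      rw [Polynomial.coeff_X_pow]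
      obtain hi | hi | hi := lt_trichotomy i n
      · rw [if_neg hi.ne, hall i hi]
      · rw [if_pos hi, hi, ← hdeg, hH.coeff_natDegree]
      · rw [if_neg hi.ne', Polynomial.coeff_eq_zero_of_natDegree_lt (by omega)]
    exact ⟨1, one_ne_zero, by rw [this]; exact (Polynomial.Splits.X_pow n).map _⟩
  push Not at hall
  obtain ⟨i, hi, hi0⟩ := hall
  obtain ⟨q, hq, p, j, K, hKm, hKd, hHK, hK1, hj, hKj⟩ :=
    exists_map_expand_eq_scaleRoots H hH hdeg h1 hi hi0
  -- After rescaling, the reduction has at least two distinct roots, so Hensel splits off factors of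
  -- smaller degree. The two ramifications supplied by induction are then merged into their product.
  obtain ⟨r, D, Q, hDQ, hD, hQ, hDn, hQn⟩ := exists_taylor_eq_mul hn K hKm hKd
    (by rw [hK1, map_zero]) hj hKj
  obtain ⟨k, hk, hDs⟩ := ih _ hDn D hD rfl
  obtain ⟨l, hl, hQs⟩ := ih _ hQn Q hQ rfl
  have hDs' := splits_map_expand_mul hk hDs l hl
  have hQs' := splits_map_expand_mul hl hQs k hk
  simp only [mul_comm k l] at hQs'
  have hs := (hDs'.mul hQs').taylor (-expand (l * k) (mul_ne_zero hl hk) r)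
  rw [← Polynomial.map_mul, ← hDQ, Polynomial.map_taylor, Polynomial.taylor_taylor] at hs
  simp only [RingHom.coe_coe, neg_add_cancel, Polynomial.taylor_zero] at hs
  refine ⟨l * k * q, mul_ne_zero (mul_ne_zero hl hk) hq, ?_⟩
  have h2 : H.map (ramify (l * k * q) (mul_ne_zero (mul_ne_zero hl hk) hq)) = (K.map (ramify (l * k) (mul_ne_zero hl hk))).scaleRoots (expand (l * k) (mul_ne_zero hl hk) (X ^ p)) := by
    have := Polynomial.map_scaleRoots K (X ^ p) (ramify (l * k) (mul_ne_zero hl hk)) (by rw [hKm.leadingCoeff, map_one]; exact one_ne_zero)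
    rw [← hHK, Polynomial.map_map] at this
    rw [RingHom.coe_coe] at this
    rw [← this]
    congr 1
    ext1 c
    exact expand_mul (l * k) (mul_ne_zero hl hk) q hq c
  rw [h2]
  exact hs.scaleRoots _

/-- The local factorization of a polynomial over `ℂ⟦t⟧` at the origin, after a ramified base
change. -/
theorem exists_local_factorization (G : (PowerSeries ℂ)[X]) (hG : G ≠ 0) :
    ∃ (k : ℕ) (hk : k ≠ 0) (e : ℕ) (Q : (PowerSeries ℂ)[X]) (s : Multiset (PowerSeries ℂ)),
      G.map (ramify k hk) = Polynomial.C (X ^ e) * Q *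
        (s.map fun h => Polynomial.X - Polynomial.C h).prod ∧
      constantCoeff (Q.coeff 0) ≠ 0 ∧ ∀ h ∈ s, constantCoeff h = 0 := by
  have h0 : ∃ (e : ℕ) (G' : (PowerSeries ℂ)[X]), G = Polynomial.C (X ^ e) * G' ∧
      G'.map (constantCoeff (R := ℂ)) ≠ 0 := by
    have hX : ¬ IsUnit (Polynomial.C (X : PowerSeries ℂ)) := by
      rw [Polynomial.isUnit_C]; exact X_prime.not_isUnit
    obtain ⟨G', hG', hnd⟩ :=
      (FiniteMultiplicity.of_not_isUnit hX hG).exists_eq_pow_mul_and_not_dvd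
    refine ⟨_, G', by rw [hG', map_pow], fun h => hnd ?_⟩
    rw [Polynomial.C_dvd_iff_dvd_coeff]
    intro i
    rw [X_dvd_iff, ← Polynomial.coeff_map, h, Polynomial.coeff_zero]
  obtain ⟨e, G', hG', hne⟩ := h0
  obtain ⟨D, Q, m, hDQ, hD, hDm, hDmap, hQ⟩ := exists_factor_of_map_constantCoeff G' hne
  obtain ⟨k, hk, hs⟩ := exists_splits_map_expand D hD
  obtain ⟨s, hs⟩ := Polynomial.splits_iff_exists_multiset.mp hs
  rw [(hD.map _).leadingCoeff, Polynomial.C_1, one_mul] at hs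
  refine ⟨k, hk, k * e, Q.map (ramify k hk), s, ?_, ?_, ?_⟩
  · rw [← hs, hG', hDQ]
    simp only [Polynomial.map_mul, Polynomial.map_C, RingHom.coe_coe, map_pow (expand k hk), expand_X,
      pow_mul]
    ring
  · rw [Polynomial.coeff_map]
    exact fun h => hQ (by rw [← h]; exact (constantCoeff_expand' k hk _).symm)
  -- Modulo `t` the factorization of `D` reads `X ^ m = ∏ (X - h(0))`, so every `h(0)` is zero.
  · intro h hh
    have h1 := congrArg (Polynomial.map (constantCoeff (R := ℂ))) hs
    have h2 : (D.map (ramify k hk)).map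
        (constantCoeff (R := ℂ)) = Polynomial.X ^ m := by
      rw [← hDmap, Polynomial.map_map]
      congr 1
      ext1 c
      exact constantCoeff_expand' k hk c
    rw [h2, Polynomial.map_multiset_prod, Multiset.map_map] at h1
    have h3 := congrArg (Polynomial.eval (constantCoeff h)) h1
    rw [Polynomial.eval_multiset_prod, Multiset.map_map, Multiset.prod_eq_zero] at h3
    · rw [Polynomial.eval_pow, Polynomial.eval_X] at h3
      exact pow_eq_zero_iff (M₀ := ℂ) (n := m) (fun hm => by simp [hm] at h3) |>.mp h3
    · rw [Multiset.mem_map]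
      exact ⟨h, hh, by simp⟩

end PowerSeries


namespace PlaneCurve

variable {d : ℕ}

/-! ### Zariski topology -/

/-- The polynomial ring in the homogeneous coordinates. -/
abbrev CoordRing := MvPolynomial CoordIdx ℂ

/-- The coordinates of the chosen representatives of a point. -/
def repCoords (q : Ambient d) : CoordIdx → ℂ := coords q.1.rep (q.2.rep : Form d)

/-- Rescaling the two groups of coordinates. -/
def scale {K : Type} [Mul K] (r s : K) (v : CoordIdx → K) : CoordIdx → K :=
  Sum.elim (fun j => r * v (Sum.inl j)) (fun m => s * v (Sum.inr m))

theorem IsBihomogeneous.aeval_scale {K : Type} [CommRing K] [Algebra ℂ K] {P : CoordRing}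
    {n : ℕ × ℕ} (hP : IsBihomogeneous P n) (r s : K) (v : CoordIdx → K) :
    MvPolynomial.aeval (scale r s v) P = r ^ n.1 * s ^ n.2 * MvPolynomial.aeval v P := by
  rw [MvPolynomial.aeval_def, MvPolynomial.eval₂_eq, MvPolynomial.aeval_def, MvPolynomial.eval₂_eq,
    Finset.mul_sum]
  refine Finset.sum_congr rfl fun m hm => ?_
  have hw := hP (MvPolynomial.mem_support_iff.mp hm)
  rw [Finsupp.weight_apply, Finsupp.sum] at hw
  have h1 : ∏ i ∈ m.support, scale r s v i ^ m i =
      (r ^ n.1 * s ^ n.2) * ∏ i ∈ m.support, v i ^ m i := by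
    have hn1 : n.1 = ∑ i ∈ m.support, m i * (Sum.elim (fun _ => 1) (fun _ => 0) i : ℕ) := by
      rw [← hw, Prod.fst_sum]
      refine Finset.sum_congr rfl fun i _ => ?_
      cases i <;> simp
    have hn2 : n.2 = ∑ i ∈ m.support, m i * (Sum.elim (fun _ => 0) (fun _ => 1) i : ℕ) := by
      rw [← hw, Prod.snd_sum]
      refine Finset.sum_congr rfl fun i _ => ?_
      cases i <;> simp
    rw [hn1, hn2, ← Finset.prod_pow_eq_pow_sum, ← Finset.prod_pow_eq_pow_sum,
      ← Finset.prod_mul_distrib, ← Finset.prod_mul_distrib]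
    refine Finset.prod_congr rfl fun i _ => ?_
    cases i <;> simp [scale, mul_pow]
  rw [h1]
  ring

theorem IsBihomogeneous.mul {P Q : CoordRing} {m n : ℕ × ℕ} (hP : IsBihomogeneous P m)
    (hQ : IsBihomogeneous Q n) : IsBihomogeneous (P * Q) (m + n) :=
  MvPolynomial.IsWeightedHomogeneous.mul hP hQ

theorem isBihomogeneous_C (c : ℂ) : IsBihomogeneous (MvPolynomial.C c) 0 :=
  MvPolynomial.isWeightedHomogeneous_C _ c

theorem isBihomogeneous_X (i : CoordIdx) : IsBihomogeneous (MvPolynomial.X i)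
    (Sum.elim (fun _ => (1, 0)) (fun _ => (0, 1)) i) :=
  MvPolynomial.isWeightedHomogeneous_X _ _ _

theorem IsBihomogeneous.pow {P : CoordRing} {m : ℕ × ℕ} (hP : IsBihomogeneous P m) (k : ℕ) :
    IsBihomogeneous (P ^ k) (k • m) :=
  MvPolynomial.IsWeightedHomogeneous.pow hP k

theorem exists_repCoords_eq {q : Ambient d} {A : Mat} {G : MvPolynomial (Fin 3) ℂ}
    (h : Represents q A G) : ∃ r s : ℂ, r ≠ 0 ∧ s ≠ 0 ∧ q.1.rep = r • A ∧
      ((q.2.rep : Form d) : MvPolynomial (Fin 3) ℂ) = s • G ∧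
      repCoords q = scale r s (coords A G) := by
  obtain ⟨G', hA, hG, rfl, rfl⟩ := h
  obtain ⟨r, hr⟩ := Projectivization.exists_smul_eq_mk_rep ℂ A hA
  obtain ⟨s, hs⟩ := Projectivization.exists_smul_eq_mk_rep ℂ G' hG
  have h2 : (((Projectivization.mk ℂ G' hG).rep : Form d) : MvPolynomial (Fin 3) ℂ) =
      (s : ℂ) • (G' : MvPolynomial (Fin 3) ℂ) := by
    rw [← hs]; rfl
  have h1 : (Projectivization.mk ℂ A hA).rep = (r : ℂ) • A := by rw [← hr]; rfl
  refine ⟨r, s, r.ne_zero, s.ne_zero, h1, h2, ?_⟩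
  funext i
  cases i with
  | inl ij => simp [repCoords, coords, scale, h1]
  | inr m => simp [repCoords, coords, scale, h2]

theorem represents_rep (q : Ambient d) :
    Represents q q.1.rep ((q.2.rep : Form d) : MvPolynomial (Fin 3) ℂ) :=
  ⟨q.2.rep, q.1.rep_nonzero, q.2.rep_nonzero, rfl, by
    rw [Projectivization.mk_rep, Projectivization.mk_rep]; rfl⟩

theorem exists_represents {A : Mat} {G : MvPolynomial (Fin 3) ℂ} (hA : A ≠ 0) (hG : G ≠ 0)
    (hGd : G.IsHomogeneous d) : ∃ q : Ambient d, Represents q A G :=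
  ⟨(Projectivization.mk ℂ A hA, Projectivization.mk ℂ (⟨G, hGd⟩ : Form d)
    fun h => hG (congrArg Subtype.val h)), ⟨G, hGd⟩, hA, _, rfl, rfl⟩

theorem Represents.smul {q : Ambient d} {A : Mat} {G : MvPolynomial (Fin 3) ℂ}
    (h : Represents q A G) {r s : ℂ} (hr : r ≠ 0) (hs : s ≠ 0) :
    Represents q (r • A) (s • G) := by
  obtain ⟨G', hA, hG, rfl, rfl⟩ := h
  refine ⟨s • G', smul_ne_zero hr hA, smul_ne_zero hs hG, rfl, ?_⟩
  congr 1
  · exact ((Projectivization.mk_eq_mk_iff' ℂ _ _ _ _).mpr ⟨r, rfl⟩).symm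
  · exact ((Projectivization.mk_eq_mk_iff' ℂ _ _ _ _).mpr ⟨s, rfl⟩).symm

theorem Represents.eq {q q' : Ambient d} {A : Mat} {G : MvPolynomial (Fin 3) ℂ}
    (h : Represents q A G) (h' : Represents q' A G) : q = q' := by
  obtain ⟨G₁, hA, hG, h1, rfl⟩ := h
  obtain ⟨G₂, hA', hG', h2, rfl⟩ := h'
  obtain rfl : G₁ = G₂ := Subtype.ext (h1.trans h2.symm)
  rfl

theorem Represents.isHomogeneous {q : Ambient d} {A : Mat} {G : MvPolynomial (Fin 3) ℂ}
    (h : Represents q A G) : G.IsHomogeneous d := by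
  obtain ⟨G', -, -, rfl, -⟩ := h
  exact G'.2

theorem Represents.ne_zero {q : Ambient d} {A : Mat} {G : MvPolynomial (Fin 3) ℂ}
    (h : Represents q A G) : A ≠ 0 ∧ G ≠ 0 := by
  obtain ⟨G', hA, hG, rfl, -⟩ := h
  exact ⟨hA, fun h0 => hG (Subtype.ext h0)⟩

/-- Rescaling multiplies the value by nonzero powers, by bihomogeneity. Membership in a basic open
set can thus be tested on any representatives, not only on the chosen `rep`. -/
theorem Represents.eval_ne_zero_iff {q : Ambient d} {A : Mat} {G : MvPolynomial (Fin 3) ℂ}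
    (h : Represents q A G) {P : CoordRing} {n : ℕ × ℕ} (hP : IsBihomogeneous P n) :
    MvPolynomial.eval (repCoords q) P ≠ 0 ↔ MvPolynomial.eval (coords A G) P ≠ 0 := by
  obtain ⟨r, s, hr, hs, -, -, he⟩ := exists_repCoords_eq h
  have := hP.aeval_scale r s (coords A G)
  simp only [MvPolynomial.aeval_eq_eval] at this
  rw [he]
  change MvPolynomial.eval _ P = _ * MvPolynomial.eval _ P at this
  rw [this]
  simp [hr, hs]

/-- The basic open set of a polynomial. -/
def basicOpen (d : ℕ) (P : CoordRing) : Set (Ambient d) :=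
  {q | MvPolynomial.eval (repCoords q) P ≠ 0}

/-- Products of bihomogeneous polynomials are bihomogeneous, so the generating family is already
closed under intersection. -/
theorem isTopologicalBasis_basicOpen (d : ℕ) : TopologicalSpace.IsTopologicalBasis
    {U : Set (Ambient d) | ∃ P n, IsBihomogeneous P n ∧ U = basicOpen d P} := by
  have h := TopologicalSpace.isTopologicalBasis_of_subbasis_of_inter
    (r := {U : Set (Ambient d) | ∃ P n, IsBihomogeneous P n ∧ U = basicOpen d P}) rfl (by
      rintro _ ⟨P, m, hP, rfl⟩ _ ⟨Q, n, hQ, rfl⟩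
      refine ⟨P * Q, m + n, hP.mul hQ, ?_⟩
      ext q
      simp [basicOpen])
  rwa [Set.insert_eq_of_mem] at h
  refine ⟨1, 0, isBihomogeneous_C 1, ?_⟩
  ext q
  simp [basicOpen]

theorem isOpen_basicOpen {P : CoordRing} {n : ℕ × ℕ} (hP : IsBihomogeneous P n) :
    IsOpen (basicOpen d P) :=
  (isTopologicalBasis_basicOpen d).isOpen ⟨P, n, hP, rfl⟩

theorem mem_closure_iff_basicOpen {T : Set (Ambient d)} {q : Ambient d} :
    q ∈ closure T ↔ ∀ P n, IsBihomogeneous P n → q ∈ basicOpen d P →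
      (basicOpen d P ∩ T).Nonempty := by
  rw [(isTopologicalBasis_basicOpen d).mem_closure_iff]
  exact ⟨fun h P n hP => h _ ⟨P, n, hP, rfl⟩, by rintro h _ ⟨P, n, hP, rfl⟩; exact h P n hP⟩

theorem isPreirreducible_of_basicOpen {T : Set (Ambient d)}
    (h : ∀ P Q m n, IsBihomogeneous P m → IsBihomogeneous Q n → (T ∩ basicOpen d P).Nonempty →
      (T ∩ basicOpen d Q).Nonempty → (T ∩ (basicOpen d P ∩ basicOpen d Q)).Nonempty) :
    IsPreirreducible T := by
  rintro U V hU hV ⟨x, hxT, hxU⟩ ⟨y, hyT, hyV⟩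
  obtain ⟨_, ⟨P, m, hP, rfl⟩, hxP, hPU⟩ :=
    (isTopologicalBasis_basicOpen d).exists_subset_of_mem_open hxU hU
  obtain ⟨_, ⟨Q, n, hQ, rfl⟩, hyQ, hQV⟩ :=
    (isTopologicalBasis_basicOpen d).exists_subset_of_mem_open hyV hV
  exact (h P Q m n hP hQ ⟨x, hxT, hxP⟩ ⟨y, hyT, hyQ⟩).mono
    (Set.inter_subset_inter_right _ (Set.inter_subset_inter hPU hQV))

/-! ### Affine charts -/

/-- The points with nonzero upper left matrix entry and nonzero coefficient of the monomial `m`. -/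
def chart (d : ℕ) (m : Fin 3 →₀ ℕ) : Set (Ambient d) :=
  {q | repCoords q (Sum.inl (0, 0)) ≠ 0 ∧ repCoords q (Sum.inr m) ≠ 0}

/-- Dehomogenization of coordinates. -/
def nrm {K : Type} [Field K] (m : Fin 3 →₀ ℕ) (v : CoordIdx → K) : CoordIdx → K :=
  scale (v (Sum.inl (0, 0)))⁻¹ (v (Sum.inr m))⁻¹ v

/-- The affine coordinates of a point of a chart. -/
def affCoords (m : Fin 3 →₀ ℕ) (q : Ambient d) : CoordIdx → ℂ := nrm m (repCoords q)

theorem nrm_scale {K : Type} [Field K] (m : Fin 3 →₀ ℕ) (v : CoordIdx → K) {r s : K} (hr : r ≠ 0)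
    (hs : s ≠ 0) : nrm m (scale r s v) = nrm m v := by
  funext i
  cases i <;> simp [nrm, scale] <;> field_simp

theorem Represents.affCoords_eq {q : Ambient d} {A : Mat} {G : MvPolynomial (Fin 3) ℂ}
    (h : Represents q A G) (m : Fin 3 →₀ ℕ) : affCoords m q = nrm m (coords A G) := by
  obtain ⟨r, s, hr, hs, -, -, he⟩ := exists_repCoords_eq h
  rw [affCoords, he, nrm_scale m _ hr hs]

theorem Represents.mem_chart_iff {q : Ambient d} {A : Mat} {G : MvPolynomial (Fin 3) ℂ}
    (h : Represents q A G) (m : Fin 3 →₀ ℕ) : q ∈ chart d m ↔ A 0 0 ≠ 0 ∧ G.coeff m ≠ 0 := by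
  obtain ⟨r, s, hr, hs, -, -, he⟩ := exists_repCoords_eq h
  simp [chart, he, scale, hr, hs, coords]

theorem isOpen_chart (m : Fin 3 →₀ ℕ) : IsOpen (chart d m) := by
  have h := isOpen_basicOpen (d := d)
    ((isBihomogeneous_X (Sum.inl (0, 0))).mul (isBihomogeneous_X (Sum.inr m)))
  convert h using 1
  ext q
  simp [chart, basicOpen]

theorem IsBihomogeneous.aeval_eq_nrm {K : Type} [Field K] [Algebra ℂ K] {P : CoordRing}
    {n : ℕ × ℕ} (hP : IsBihomogeneous P n) (m : Fin 3 →₀ ℕ) (v : CoordIdx → K)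
    (h0 : v (Sum.inl (0, 0)) ≠ 0) (hm : v (Sum.inr m) ≠ 0) :
    MvPolynomial.aeval v P =
      v (Sum.inl (0, 0)) ^ n.1 * v (Sum.inr m) ^ n.2 * MvPolynomial.aeval (nrm m v) P := by
  rw [nrm, hP.aeval_scale, inv_pow, inv_pow]
  field_simp

/-- Homogenization of polynomials in the affine coordinates. -/
theorem exists_homogenization (m : Fin 3 →₀ ℕ) (P : CoordRing) :
    ∃ (P' : CoordRing) (n : ℕ × ℕ), IsBihomogeneous P' n ∧
      ∀ (K : Type) [Field K] [Algebra ℂ K] (v : CoordIdx → K), v (Sum.inl (0, 0)) ≠ 0 →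
        v (Sum.inr m) ≠ 0 → MvPolynomial.aeval v P' =
          v (Sum.inl (0, 0)) ^ n.1 * v (Sum.inr m) ^ n.2 * MvPolynomial.aeval (nrm m v) P := by
  induction P using MvPolynomial.induction_on with
  | C c =>
    refine ⟨MvPolynomial.C c, 0, isBihomogeneous_C c, fun K _ _ v _ _ => ?_⟩
    simp
  | add P Q hP hQ =>
    obtain ⟨P', a, hP', hPe⟩ := hP
    obtain ⟨Q', b, hQ', hQe⟩ := hQ
    refine ⟨P' * (MvPolynomial.X (Sum.inl (0, 0)) ^ b.1 * MvPolynomial.X (Sum.inr m) ^ b.2) +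
      Q' * (MvPolynomial.X (Sum.inl (0, 0)) ^ a.1 * MvPolynomial.X (Sum.inr m) ^ a.2), a + b, ?_,
      fun K _ _ v h0 hm => ?_⟩
    · have hmon : ∀ c : ℕ × ℕ, IsBihomogeneous (MvPolynomial.X (Sum.inl (0, 0)) ^ c.1 *
          MvPolynomial.X (Sum.inr m) ^ c.2) c := by
        intro c
        have := ((isBihomogeneous_X (Sum.inl (0, 0))).pow c.1).mul
          ((isBihomogeneous_X (Sum.inr m)).pow c.2)
        convert this using 1
        ext <;> simp
      refine MvPolynomial.IsWeightedHomogeneous.add (hP'.mul (hmon b)) ?_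
      rw [add_comm a b]
      exact hQ'.mul (hmon a)
    · simp only [map_add, map_mul, map_pow, MvPolynomial.aeval_X, hPe K v h0 hm, hQe K v h0 hm,
        Prod.fst_add, Prod.snd_add]
      ring
  | mul_X P i hP =>
    obtain ⟨P', a, hP', hPe⟩ := hP
    refine ⟨P' * MvPolynomial.X i, _, hP'.mul (isBihomogeneous_X i), fun K _ _ v h0 hm => ?_⟩
    simp only [map_mul, MvPolynomial.aeval_X, hPe K v h0 hm]
    cases i with
    | inl ij => simp [nrm, scale, pow_succ]; field_simp
    | inr l => simp [nrm, scale, pow_succ]; field_simp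

/-- The ideal of polynomials in the affine coordinates that vanish on `T`. -/
def affIdeal (m : Fin 3 →₀ ℕ) (T : Set (Ambient d)) : Ideal CoordRing where
  carrier := {P | ∀ q ∈ T, q ∈ chart d m → MvPolynomial.aeval (affCoords m q) P = 0}
  add_mem' {P Q} hP hQ q hq hm := by rw [map_add, hP q hq hm, hQ q hq hm, add_zero]
  zero_mem' q _ _ := map_zero _
  smul_mem' c P hP q hq hm := by rw [smul_eq_mul, map_mul, hP q hq hm, mul_zero]

theorem mem_affIdeal {m : Fin 3 →₀ ℕ} {T : Set (Ambient d)} {P : CoordRing} :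
    P ∈ affIdeal m T ↔ ∀ q ∈ T, q ∈ chart d m → MvPolynomial.aeval (affCoords m q) P = 0 :=
  Iff.rfl

theorem affIdeal_anti {m : Fin 3 →₀ ℕ} {T T' : Set (Ambient d)} (h : T ⊆ T') :
    affIdeal m T' ≤ affIdeal m T := fun _ hP q hq hm => hP q (h hq) hm

theorem mem_basicOpen_iff_of_chart {m : Fin 3 →₀ ℕ} {q : Ambient d} (hq : q ∈ chart d m)
    {P : CoordRing} {n : ℕ × ℕ} (hP : IsBihomogeneous P n) :
    q ∈ basicOpen d P ↔ MvPolynomial.aeval (affCoords m q) P ≠ 0 := by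
  have := hP.aeval_eq_nrm m (repCoords q) hq.1 hq.2
  change MvPolynomial.aeval (repCoords q) P ≠ 0 ↔ _
  rw [this]
  simp [hq.1, hq.2, affCoords]

theorem isOpen_affine_ne_zero (m : Fin 3 →₀ ℕ) (P : CoordRing) :
    IsOpen {q ∈ chart d m | MvPolynomial.aeval (affCoords m q) P ≠ 0} := by
  obtain ⟨P', n, hP', he⟩ := exists_homogenization m P
  have : {q ∈ chart d m | MvPolynomial.aeval (affCoords m q) P ≠ 0} =
      chart d m ∩ basicOpen d P' := by
    ext q
    refine and_congr_right fun hq => ?_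
    change _ ↔ MvPolynomial.aeval (repCoords q) P' ≠ 0
    rw [he ℂ (repCoords q) hq.1 hq.2]
    simp [hq.1, hq.2, affCoords]
  rw [this]
  exact (isOpen_chart m).inter (isOpen_basicOpen hP')

theorem affIdeal_closure (m : Fin 3 →₀ ℕ) (T : Set (Ambient d)) :
    affIdeal m (closure T) = affIdeal m T := by
  refine le_antisymm (affIdeal_anti subset_closure) fun P hP q hq hm => ?_
  by_contra h
  obtain ⟨q', ⟨hc, hne⟩, hT⟩ := mem_closure_iff.mp hq _ (isOpen_affine_ne_zero m P) ⟨hm, h⟩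
  exact hne (hP q' hT hc)

theorem mem_closure_of_affIdeal {m : Fin 3 →₀ ℕ} {T : Set (Ambient d)} {q : Ambient d}
    (hq : q ∈ chart d m) (h : ∀ P ∈ affIdeal m T, MvPolynomial.aeval (affCoords m q) P = 0) :
    q ∈ closure T := by
  rw [mem_closure_iff_basicOpen]
  intro P n hP hqP
  rw [mem_basicOpen_iff_of_chart hq hP] at hqP
  by_contra hemp
  refine hqP (h P fun q' hq' hm => ?_)
  by_contra hne
  exact hemp ⟨q', (mem_basicOpen_iff_of_chart hm hP).mpr hne, hq'⟩

theorem affIdeal_isPrime {m : Fin 3 →₀ ℕ} {T : Set (Ambient d)} (hT : IsPreirreducible T)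
    (hne : (T ∩ chart d m).Nonempty) : (affIdeal m T).IsPrime := by
  rw [Ideal.isPrime_iff]
  refine ⟨fun h => ?_, fun {P Q} hPQ => ?_⟩
  · obtain ⟨q, hq, hm⟩ := hne
    have h1 : (1 : CoordRing) ∈ affIdeal m T := h ▸ Submodule.mem_top
    have := h1 q hq hm
    rw [map_one] at this
    exact one_ne_zero this
  · by_contra! hcon
    obtain ⟨hP, hQ⟩ := hcon
    simp only [mem_affIdeal] at hP hQ
    push Not at hP hQ
    obtain ⟨x, hx, hxm, hxP⟩ := hP
    obtain ⟨y, hy, hym, hyQ⟩ := hQ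
    obtain ⟨z, hz, ⟨hzm, hzP⟩, -, hzQ⟩ := hT _ _ (isOpen_affine_ne_zero m P)
      (isOpen_affine_ne_zero m Q) ⟨x, hx, hxm, hxP⟩ ⟨y, hy, hym, hyQ⟩
    have := hPQ z hz hzm
    rw [map_mul] at this
    exact (mul_ne_zero hzP hzQ) this

/-- An irreducible set lies in the closure of its trace on any chart that it meets, so inclusions of
closures can be read off from ideals in one chart. -/
theorem subset_closure_of_affIdeal_le {m : Fin 3 →₀ ℕ} {T Z : Set (Ambient d)}
    (hZ : IsPreirreducible Z) (hne : (Z ∩ chart d m).Nonempty)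
    (h : affIdeal m T ≤ affIdeal m Z) : Z ⊆ closure T := by
  refine (subset_closure_inter_of_isPreirreducible_of_isOpen hZ (isOpen_chart m) hne).trans
    (closure_minimal (fun q hq => ?_) isClosed_closure)
  exact mem_closure_of_affIdeal hq.2 fun P hP => h hP q hq.1 hq.2

/-! ### Polynomial families of pairs (matrix, form) -/

/-- The coordinates of a pair (matrix, form) over a ring. -/
def famCoords {S : Type} [CommRing S] (A : Matrix (Fin 3) (Fin 3) S) (G : MvPolynomial (Fin 3) S) :
    CoordIdx → S :=
  Sum.elim (fun ij => A ij.1 ij.2) (fun m => MvPolynomial.coeff m G)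

variable {τ : Type}

/-- The affine coordinates of a family, as rational functions of the parameters. -/
def famHom (m : Fin 3 →₀ ℕ) (A : Matrix (Fin 3) (Fin 3) (MvPolynomial τ ℂ))
    (G : MvPolynomial (Fin 3) (MvPolynomial τ ℂ)) :
    CoordRing →ₐ[ℂ] FractionRing (MvPolynomial τ ℂ) :=
  MvPolynomial.aeval (nrm m (fun i => algebraMap _ _ (famCoords A G i)))

theorem coords_specialize (A : Matrix (Fin 3) (Fin 3) (MvPolynomial τ ℂ))
    (G : MvPolynomial (Fin 3) (MvPolynomial τ ℂ)) (v : τ → ℂ) :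
    coords (A.map (MvPolynomial.eval v)) (G.map (MvPolynomial.eval v)) =
      fun i => MvPolynomial.eval v (famCoords A G i) := by
  funext i
  cases i <;> simp [coords, famCoords, MvPolynomial.coeff_map]

/-- A polynomial vanishes on a family iff it vanishes at all its sufficiently general members. -/
theorem famHom_eq_zero_iff {m : Fin 3 →₀ ℕ} {A : Matrix (Fin 3) (Fin 3) (MvPolynomial τ ℂ)}
    {G : MvPolynomial (Fin 3) (MvPolynomial τ ℂ)} {D : MvPolynomial τ ℂ} (hD : D ≠ 0)
    (hA : A 0 0 ≠ 0) (hG : G.coeff m ≠ 0) (P : CoordRing) :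
    famHom m A G P = 0 ↔ ∀ v : τ → ℂ, MvPolynomial.eval v D ≠ 0 →
      MvPolynomial.eval v (A 0 0) ≠ 0 → MvPolynomial.eval v (G.coeff m) ≠ 0 →
      MvPolynomial.aeval (nrm m (coords (A.map (MvPolynomial.eval v))
        (G.map (MvPolynomial.eval v)))) P = 0 := by
  obtain ⟨P', n, hP', he⟩ := exists_homogenization m P
  have hinj := IsFractionRing.injective (MvPolynomial τ ℂ) (FractionRing (MvPolynomial τ ℂ))
  have h1 : famHom m A G P = 0 ↔ MvPolynomial.aeval (famCoords A G) P' = 0 := by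
    have h2 := he (FractionRing (MvPolynomial τ ℂ)) (fun i => algebraMap _ _ (famCoords A G i))
      (by simpa [famCoords] using hA) (by simpa [famCoords] using hG)
    have h3 : MvPolynomial.aeval (fun i => algebraMap (MvPolynomial τ ℂ)
        (FractionRing (MvPolynomial τ ℂ)) (famCoords A G i)) P' =
        algebraMap _ _ (MvPolynomial.aeval (famCoords A G) P') :=
      MvPolynomial.aeval_algebraMap_apply _ _ _
    rw [← map_eq_zero_iff _ hinj, ← h3, h2, famHom]
    simp [famCoords, hA, hG]
  have h4 : ∀ v : τ → ℂ, MvPolynomial.eval v (A 0 0) ≠ 0 → MvPolynomial.eval v (G.coeff m) ≠ 0 →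
      (MvPolynomial.aeval (nrm m (coords (A.map (MvPolynomial.eval v))
        (G.map (MvPolynomial.eval v)))) P = 0 ↔
      MvPolynomial.eval v (MvPolynomial.aeval (famCoords A G) P') = 0) := by
    intro v hvA hvG
    have h5 := he ℂ (coords (A.map (MvPolynomial.eval v)) (G.map (MvPolynomial.eval v)))
      (by simpa [coords] using hvA) (by simpa [coords, MvPolynomial.coeff_map] using hvG)
    have h6 : MvPolynomial.eval v (MvPolynomial.aeval (famCoords A G) P') =
        MvPolynomial.aeval (coords (A.map (MvPolynomial.eval v))
          (G.map (MvPolynomial.eval v))) P' := by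
      rw [coords_specialize]
      exact MvPolynomial.comp_aeval_apply (famCoords A G) (MvPolynomial.aeval v) P'
    rw [h6, h5]
    simp [coords, MvPolynomial.coeff_map, hvA, hvG]
  rw [h1]
  constructor
  · intro h v _ hvA hvG
    rw [h4 v hvA hvG, h, map_zero]
  · intro h
    -- The extra factors absorb the excluded parameters: the product vanishes at every point, hence
    -- is the zero polynomial.
    have h7 : D * A 0 0 * G.coeff m * MvPolynomial.aeval (famCoords A G) P' = 0 := by
      refine MvPolynomial.funext fun v => ?_
      rw [map_mul, map_mul, map_mul, map_zero]
      by_cases hvD : MvPolynomial.eval v D = 0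
      · rw [hvD]; ring
      by_cases hvA : MvPolynomial.eval v (A 0 0) = 0
      · rw [hvA]; ring
      by_cases hvG : MvPolynomial.eval v (G.coeff m) = 0
      · rw [hvG]; ring
      rw [(h4 v hvA hvG).mp (h v hvD hvA hvG), mul_zero]
    exact (mul_eq_zero.mp h7).resolve_left (mul_ne_zero (mul_ne_zero hD hA) hG)

theorem trdeg_fractionRing [Fintype τ] :
    Algebra.trdeg ℂ (FractionRing (MvPolynomial τ ℂ)) = Fintype.card τ := by
  have : Algebra.IsAlgebraic (MvPolynomial τ ℂ) (FractionRing (MvPolynomial τ ℂ)) :=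
    IsLocalization.isAlgebraic _ (nonZeroDivisors (MvPolynomial τ ℂ))
  rw [← trdeg_add_eq ℂ (MvPolynomial τ ℂ), trdeg_eq_zero (R := MvPolynomial τ ℂ)]
  simp

/-- A family covers at most as many dimensions as it has parameters, since modulo the kernel its
coordinates live in the function field of the parameter space. -/
theorem trdeg_quotient_ker_famHom_le [Fintype τ] (m : Fin 3 →₀ ℕ)
    (A : Matrix (Fin 3) (Fin 3) (MvPolynomial τ ℂ)) (G : MvPolynomial (Fin 3) (MvPolynomial τ ℂ))
    {I : Ideal CoordRing} (hI : RingHom.ker (famHom m A G) ≤ I) :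
    Algebra.trdeg ℂ (CoordRing ⧸ I) ≤ Fintype.card τ := by
  rw [← trdeg_fractionRing]
  refine le_trans (trdeg_le_of_surjective (Ideal.Quotient.factorₐ ℂ hI)
    (Ideal.Quotient.factor_surjective hI)) ?_
  exact trdeg_le_of_injective (Ideal.kerLiftAlg (famHom m A G))
    (Ideal.kerLiftAlg_injective (famHom m A G))

/-- The counterpart for lower bounds: a set whose equations hold on a family is at least as large as
the image of that family. -/
theorem le_trdeg_of_le_ker_famHom {m : Fin 3 →₀ ℕ}
    {A : Matrix (Fin 3) (Fin 3) (MvPolynomial τ ℂ)} {G : MvPolynomial (Fin 3) (MvPolynomial τ ℂ)}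
    {I : Ideal CoordRing} (hI : I ≤ RingHom.ker (famHom m A G)) :
    Algebra.trdeg ℂ (famHom m A G).range ≤ Algebra.trdeg ℂ (CoordRing ⧸ I) := by
  refine trdeg_le_of_surjective (Ideal.Quotient.liftₐ I (famHom m A G).rangeRestrict fun P hP => ?_)
    ?_
  · exact Subtype.ext (hI hP)
  · rintro ⟨_, P, rfl⟩
    exact ⟨Ideal.Quotient.mk I P, rfl⟩

end PlaneCurve


/-! ### Nullstellensatz and components of a subspace -/

/-- Weak Nullstellensatz: a nonzero element of a reduced finitely generated `ℂ`-algebra does not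
vanish at some point. -/
theorem exists_algHom_ne_zero {A : Type} [CommRing A] [IsReduced A] [Algebra ℂ A]
    [Algebra.FiniteType ℂ A] {x : A} (hx : x ≠ 0) : ∃ φ : A →ₐ[ℂ] ℂ, φ x ≠ 0 := by
  have hJ : IsJacobsonRing A := isJacobsonRing_of_finiteType (A := ℂ)
  have hrad : (⊥ : Ideal A).IsRadical := fun y ⟨n, hn⟩ =>
    (Submodule.mem_bot A).mpr (IsReduced.eq_zero y ⟨n, (Submodule.mem_bot A).mp hn⟩)
  obtain ⟨M, ⟨-, hM⟩, hxM⟩ := Ideal.eq_jacobson_iff_notMem.mp (hJ.out' ⊥ hrad) x (by simpa using hx)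
  let := Ideal.Quotient.field M
  have : Module.Finite ℂ (A ⧸ M) := finite_of_finite_type_of_isJacobsonRing ℂ (A ⧸ M)
  have hbij := IsAlgClosed.algebraMap_bijective_of_isIntegral (k := ℂ) (K := A ⧸ M)
  let e : ℂ ≃ₐ[ℂ] A ⧸ M := AlgEquiv.ofBijective (Algebra.ofId ℂ (A ⧸ M)) hbij
  refine ⟨(e.symm : (A ⧸ M) →ₐ[ℂ] ℂ).comp (Ideal.Quotient.mkₐ ℂ M), fun h => hxM ?_⟩
  have h1 : e.symm (Ideal.Quotient.mk M x) = 0 := h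
  rw [map_eq_zero_iff _ e.symm.injective] at h1
  exact Ideal.Quotient.eq_zero_iff_mem.mp h1

/-- Components of the subspace become maximal irreducible subsets of the ambient space, which is how
the dimension criteria are phrased. -/
theorem exists_mem_irreducibleComponents_iff {X : Type} [TopologicalSpace X] (E W : Set X) :
    (∃ Z ∈ irreducibleComponents E, (Subtype.val '' Z : Set X) = W) ↔
      W ⊆ E ∧ IsIrreducible W ∧ ∀ W', W' ⊆ E → IsIrreducible W' → W ⊆ W' → W' ⊆ W := by
  have hpre : ∀ W', W' ⊆ E → IsIrreducible W' → IsIrreducible (Subtype.val ⁻¹' W' : Set E) := by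
    rintro W' hE ⟨⟨x, hx⟩, hirr⟩
    refine ⟨⟨⟨x, hE hx⟩, hx⟩, ?_⟩
    rintro _ _ ⟨U, hU, rfl⟩ ⟨V, hV, rfl⟩ ⟨y, hy, hyU⟩ ⟨z, hz, hzV⟩
    obtain ⟨w, hw, hwUV⟩ := hirr U V hU hV ⟨y, hy, hyU⟩ ⟨z, hz, hzV⟩
    exact ⟨⟨w, hE hw⟩, hw, hwUV⟩
  constructor
  · rintro ⟨Z, hZ, rfl⟩
    refine ⟨Subtype.coe_image_subset E Z, hZ.1.image _ continuous_subtype_val.continuousOn,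
      fun W' hE hW' hle x hx => ?_⟩
    have := hZ.2 (hpre W' hE hW') (fun z hz => hle ⟨z, hz, rfl⟩)
    exact ⟨⟨x, hE hx⟩, this hx, rfl⟩
  · rintro ⟨hE, hirr, hmax⟩
    refine ⟨Subtype.val ⁻¹' W, ⟨hpre W hE hirr, fun Z hZ hle z hz => ?_⟩, ?_⟩
    · exact hmax _ (Subtype.coe_image_subset E Z) (hZ.image _ continuous_subtype_val.continuousOn)
        (fun x hx => ⟨⟨x, hE hx⟩, hle hx, rfl⟩) ⟨z, hz, rfl⟩
    · rw [Subtype.image_preimage_coe, Set.inter_eq_right.mpr hE]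

namespace PlaneCurve

variable {d : ℕ}

/-! ### Substitution -/

section subst

variable {R R' : Type} [CommRing R] [CommRing R']

/-- The linear form given by the `i`-th row of a matrix. -/
def rowForm (A : Matrix (Fin 3) (Fin 3) R) (i : Fin 3) : MvPolynomial (Fin 3) R :=
  ∑ j, MvPolynomial.C (A i j) * MvPolynomial.X j

theorem isHomogeneous_rowForm (A : Matrix (Fin 3) (Fin 3) R) (i : Fin 3) :
    (rowForm A i).IsHomogeneous 1 :=
  MvPolynomial.IsHomogeneous.sum _ _ _ fun _ _ => MvPolynomial.isHomogeneous_C_mul_X _ _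

theorem map_rowForm (φ : R →+* R') (A : Matrix (Fin 3) (Fin 3) R) (i : Fin 3) :
    MvPolynomial.map φ (rowForm A i) = rowForm (A.map φ) i := by
  simp [rowForm]

theorem aeval_rowForm_rowForm (A B : Matrix (Fin 3) (Fin 3) R) (i : Fin 3) :
    MvPolynomial.aeval (rowForm B) (rowForm A i) = rowForm (A * B) i := by
  simp only [rowForm, map_sum, map_mul, MvPolynomial.aeval_X, MvPolynomial.aeval_C,
    MvPolynomial.algebraMap_eq, Matrix.mul_apply, Finset.mul_sum, Finset.sum_mul]
  rw [Finset.sum_comm]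
  refine Finset.sum_congr rfl fun j _ => Finset.sum_congr rfl fun k _ => ?_
  ring

variable [Algebra ℂ R] [Algebra ℂ R']

theorem subst_eq (F : MvPolynomial (Fin 3) ℂ) (A : Matrix (Fin 3) (Fin 3) R) :
    subst F A = MvPolynomial.aeval (rowForm A) F := rfl

theorem isHomogeneous_subst {F : MvPolynomial (Fin 3) ℂ} (hF : F.IsHomogeneous d)
    (A : Matrix (Fin 3) (Fin 3) R) : (subst F A).IsHomogeneous d := by
  have := hF.aeval (rowForm A) (isHomogeneous_rowForm A)
  rwa [one_mul] at this

theorem map_subst (φ : R →+* R') (hφ : φ.comp (algebraMap ℂ R) = algebraMap ℂ R')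
    (F : MvPolynomial (Fin 3) ℂ) (A : Matrix (Fin 3) (Fin 3) R) :
    MvPolynomial.map φ (subst F A) = subst F (A.map φ) := by
  rw [subst_eq, subst_eq, MvPolynomial.aeval_def, MvPolynomial.aeval_def,
    ← MvPolynomial.coe_eval₂Hom, ← MvPolynomial.coe_eval₂Hom, ← RingHom.comp_apply]
  congr 1
  apply MvPolynomial.ringHom_ext
  · intro c
    rw [RingHom.comp_apply, MvPolynomial.coe_eval₂Hom, MvPolynomial.coe_eval₂Hom,
      MvPolynomial.eval₂_C, MvPolynomial.eval₂_C, MvPolynomial.algebraMap_apply,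
      MvPolynomial.algebraMap_apply, MvPolynomial.map_C, ← hφ, RingHom.comp_apply]
  · intro i
    simp [map_rowForm]

theorem map_eval_subst {τ : Type} (v : τ → ℂ) (F : MvPolynomial (Fin 3) ℂ)
    (A : Matrix (Fin 3) (Fin 3) (MvPolynomial τ ℂ)) :
    MvPolynomial.map (MvPolynomial.eval v) (subst F A) = subst F (A.map (MvPolynomial.eval v)) :=
  map_subst _ (by ext c; simp [MvPolynomial.algebraMap_eq]) F A

theorem aeval_rowForm_subst (F : MvPolynomial (Fin 3) ℂ) (A B : Matrix (Fin 3) (Fin 3) R) :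
    MvPolynomial.aeval (R := R) (rowForm B) (subst F A) = subst F (A * B) := by
  rw [subst_eq, subst_eq]
  have := MvPolynomial.comp_aeval_apply (R := ℂ) (rowForm A)
    ((MvPolynomial.aeval (R := R) (rowForm B)).restrictScalars ℂ) F
  simp only [AlgHom.restrictScalars_apply, aeval_rowForm_rowForm] at this
  exact this

theorem subst_subst (F : MvPolynomial (Fin 3) ℂ) (A B : Mat) :
    subst (subst F A) B = subst F (A * B) := aeval_rowForm_subst F A B

theorem subst_one (F : MvPolynomial (Fin 3) ℂ) : subst F (1 : Mat) = F := by
  have : rowForm (1 : Mat) = MvPolynomial.X := by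
    funext i
    simp [rowForm, Matrix.one_apply]
  rw [subst_eq, this, MvPolynomial.aeval_X_left, AlgHom.id_apply]

theorem subst_zero_left (A : Matrix (Fin 3) (Fin 3) R) : subst 0 A = 0 := map_zero _

theorem subst_smul_left (c : ℂ) (F : MvPolynomial (Fin 3) ℂ) (A : Mat) :
    subst (c • F) A = c • subst F A := by
  rw [subst_eq, subst_eq, map_smul]

theorem subst_smul {F : MvPolynomial (Fin 3) ℂ} (hF : F.IsHomogeneous d) (r : R)
    (A : Matrix (Fin 3) (Fin 3) R) : subst F (r • A) = MvPolynomial.C (r ^ d) * subst F A := by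
  have h : ∀ i, rowForm (r • A) i = MvPolynomial.C r * rowForm A i := by
    intro i
    simp [rowForm, Finset.mul_sum, mul_assoc]
  rw [subst_eq, subst_eq, MvPolynomial.aeval_def, MvPolynomial.eval₂_eq, MvPolynomial.aeval_def,
    MvPolynomial.eval₂_eq, Finset.mul_sum]
  refine Finset.sum_congr rfl fun m hm => ?_
  have hd : ∑ i ∈ m.support, m i = d := by
    have := hF (MvPolynomial.mem_support_iff.mp hm)
    exact (DFunLike.congr_fun Finsupp.degree_eq_weight_one m).trans this
  simp_rw [h, mul_pow, Finset.prod_mul_distrib, Finset.prod_pow_eq_pow_sum, hd, map_pow]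
  ring

theorem subst_ne_zero {F : MvPolynomial (Fin 3) ℂ} (hF : F ≠ 0) (g : GL (Fin 3) ℂ) :
    subst F (g : Mat) ≠ 0 := by
  intro h
  apply hF
  have := subst_subst F (g : Mat) ((g⁻¹ : GL (Fin 3) ℂ) : Mat)
  rw [h, subst_zero_left, ← Units.val_mul, mul_inv_cancel, Units.val_one, subst_one] at this
  exact this.symm

end subst

/-! ### The graph and the projective normal cone in a chart -/

/-- The coefficient of `m` in `F ∘ A`, as a polynomial in the entries of `A`. -/
def baseEq (F : MvPolynomial (Fin 3) ℂ) (m : Fin 3 →₀ ℕ) : CoordRing :=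
  MvPolynomial.rename Sum.inl (MvPolynomial.coeff m
    (subst F (Matrix.of fun i j => (MvPolynomial.X (i, j) : MvPolynomial (Fin 3 × Fin 3) ℂ))))

theorem aeval_baseEq (F : MvPolynomial (Fin 3) ℂ) (m : Fin 3 →₀ ℕ) (v : CoordIdx → ℂ) :
    MvPolynomial.aeval v (baseEq F m) =
      MvPolynomial.coeff m (subst F (Matrix.of fun i j => v (Sum.inl (i, j)))) := by
  rw [baseEq, MvPolynomial.aeval_rename, MvPolynomial.aeval_eq_eval, ← MvPolynomial.coeff_map,
    map_eval_subst]
  congr 2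
  ext i j
  simp

theorem isBihomogeneous_sum {ι : Type} {s : Finset ι} {P : ι → CoordRing} {n : ℕ × ℕ}
    (h : ∀ i ∈ s, IsBihomogeneous (P i) n) : IsBihomogeneous (∑ i ∈ s, P i) n :=
  MvPolynomial.IsWeightedHomogeneous.sum _ _ _ h

theorem isBihomogeneous_coeff_mul {G H : MvPolynomial (Fin 3) CoordRing} {n n' : ℕ × ℕ}
    (hG : ∀ l, IsBihomogeneous (G.coeff l) n) (hH : ∀ l, IsBihomogeneous (H.coeff l) n')
    (l : Fin 3 →₀ ℕ) : IsBihomogeneous ((G * H).coeff l) (n + n') := by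
  rw [MvPolynomial.coeff_mul]
  exact isBihomogeneous_sum fun p _ => (hG p.1).mul (hH p.2)

theorem isBihomogeneous_coeff_one (l : Fin 3 →₀ ℕ) :
    IsBihomogeneous ((1 : MvPolynomial (Fin 3) CoordRing).coeff l) 0 := by
  rw [MvPolynomial.coeff_one]
  split_ifs
  · exact MvPolynomial.isWeightedHomogeneous_one _ _
  · exact MvPolynomial.isWeightedHomogeneous_zero _ _ _

theorem isBihomogeneous_coeff_pow {G : MvPolynomial (Fin 3) CoordRing} {n : ℕ × ℕ}
    (hG : ∀ l, IsBihomogeneous (G.coeff l) n) (e : ℕ) (l : Fin 3 →₀ ℕ) :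
    IsBihomogeneous ((G ^ e).coeff l) (e • n) := by
  induction e generalizing l with
  | zero => simpa using isBihomogeneous_coeff_one l
  | succ e ih =>
    rw [pow_succ, succ_nsmul]
    exact isBihomogeneous_coeff_mul ih hG l

/-- Each coefficient of `F ∘ A` is a combination of products of `d` entries of `A`. This makes the
base locus closed, hence also the cone (`isClosed_PNC`). -/
theorem isBihomogeneous_baseEq {F : MvPolynomial (Fin 3) ℂ} (hF : F.IsHomogeneous d)
    (l : Fin 3 →₀ ℕ) : IsBihomogeneous (baseEq F l) (d, 0) := by
  set A : Matrix (Fin 3) (Fin 3) CoordRing :=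
    Matrix.of fun i j => MvPolynomial.X (Sum.inl (i, j)) with hA
  have h1 : baseEq F l = (subst F A).coeff l := by
    rw [baseEq, ← AlgHom.coe_toRingHom, ← MvPolynomial.coeff_map, map_subst]
    · congr 2
      ext1 i j
      simp [hA]
    · ext c
      simp [MvPolynomial.algebraMap_eq]
  have hrow : ∀ i l, IsBihomogeneous ((rowForm A i).coeff l) (1, 0) := by
    intro i l
    rw [rowForm, MvPolynomial.coeff_sum]
    refine isBihomogeneous_sum fun j _ => ?_
    rw [MvPolynomial.coeff_C_mul, MvPolynomial.coeff_X]
    split_ifs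
    · rw [mul_one]
      exact isBihomogeneous_X (Sum.inl (i, j))
    · rw [mul_zero]
      exact MvPolynomial.isWeightedHomogeneous_zero _ _ _
  rw [h1, subst_eq, MvPolynomial.aeval_def, MvPolynomial.eval₂_eq, MvPolynomial.coeff_sum]
  refine isBihomogeneous_sum fun e he => ?_
  have hd : e 0 + e 1 + e 2 = d := by
    have := hF (MvPolynomial.mem_support_iff.mp he)
    rw [← this, ← Fin.sum_univ_three, ← Finsupp.degree_eq_sum]
    exact DFunLike.congr_fun Finsupp.degree_eq_weight_one e
  rw [MvPolynomial.algebraMap_apply, MvPolynomial.coeff_C_mul,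
    ← Finsupp.prod, Finsupp.prod_fintype _ _ fun _ => pow_zero _, Fin.prod_univ_three]
  have h2 := isBihomogeneous_coeff_mul (isBihomogeneous_coeff_mul
    (isBihomogeneous_coeff_pow (hrow 0) (e 0)) (isBihomogeneous_coeff_pow (hrow 1) (e 1)))
    (isBihomogeneous_coeff_pow (hrow 2) (e 2)) l
  have h3 := (isBihomogeneous_C (F.coeff e)).mul h2
  convert h3 using 1
  · rfl
  · rw [zero_add, ← add_smul, ← add_smul, hd, Prod.smul_mk, smul_zero, smul_eq_mul, mul_one]

/-- The generic matrix with upper left entry `1`. -/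
def genericMatrix : Matrix (Fin 3) (Fin 3) (MvPolynomial {p : Fin 3 × Fin 3 // p ≠ (0, 0)} ℂ) :=
  Matrix.of fun i j => if h : (i, j) ≠ (0, 0) then MvPolynomial.X ⟨(i, j), h⟩ else 1

theorem genericMatrix_apply_of_ne {i j : Fin 3} (h : (i, j) ≠ (0, 0)) :
    genericMatrix i j = MvPolynomial.X ⟨(i, j), h⟩ := dif_pos h

theorem genericMatrix_zero_zero : genericMatrix 0 0 = 1 := by
  simp [genericMatrix]

theorem genericMatrix_eval (A : Mat) (hA : A 0 0 = 1) :
    genericMatrix.map (MvPolynomial.eval fun p => A p.1.1 p.1.2) = A := by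
  ext i j
  by_cases h : (i, j) = (0, 0)
  · obtain ⟨rfl, rfl⟩ := Prod.mk.inj h
    rw [Matrix.map_apply, genericMatrix_zero_zero, map_one, hA]
  · rw [Matrix.map_apply, genericMatrix_apply_of_ne h, MvPolynomial.eval_X]

variable {F : Form d} {m : Fin 3 →₀ ℕ}

theorem exists_normalized {q : Ambient d} (hq : q ∈ graph F) (hm : q ∈ chart d m) :
    ∃ A : Mat, A 0 0 = 1 ∧ Represents q A (subst F A) := by
  obtain ⟨A, hA⟩ := hq
  have h0 := ((hA.mem_chart_iff m).mp hm).1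
  refine ⟨(A 0 0)⁻¹ • A, by simp [h0], ?_⟩
  rw [subst_smul F.2, ← MvPolynomial.smul_eq_C_mul]
  exact hA.smul (inv_ne_zero h0) (pow_ne_zero _ (inv_ne_zero h0))

theorem coeff_generic_ne_zero (h : (closure (graph F) ∩ chart d m).Nonempty) :
    MvPolynomial.coeff m (subst F genericMatrix) ≠ 0 := by
  obtain ⟨q, hq, hm⟩ := h
  obtain ⟨q', hm', hq'⟩ := mem_closure_iff.mp hq _ (isOpen_chart m) hm
  obtain ⟨A, hA, hrep⟩ := exists_normalized hq' hm'
  intro h0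
  apply ((hrep.mem_chart_iff m).mp hm').2
  rw [← genericMatrix_eval A hA, ← map_eval_subst, MvPolynomial.coeff_map, h0, map_zero]

/-- Up to scaling, every graph point in the chart is a specialization of `genericMatrix`. The ideal
is therefore the kernel of a map into a field, which gives its primality and the upper bound 8. -/
theorem affIdeal_graph (h : (closure (graph F) ∩ chart d m).Nonempty) :
    affIdeal m (graph F) = RingHom.ker (famHom m genericMatrix (subst F genericMatrix)) := by
  have hc := coeff_generic_ne_zero h
  have h00 : genericMatrix 0 0 ≠ 0 := by rw [genericMatrix_zero_zero]; exact one_ne_zero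
  ext P
  rw [RingHom.mem_ker, famHom_eq_zero_iff one_ne_zero h00 hc, mem_affIdeal]
  constructor
  · intro hP v _ hv0 hvm
    rw [map_eval_subst]
    set A := genericMatrix.map (MvPolynomial.eval v)
    have hA0 : A 0 0 ≠ 0 := hv0
    have hAm : MvPolynomial.coeff m (subst F A) ≠ 0 := by
      rwa [← MvPolynomial.coeff_map, map_eval_subst] at hvm
    obtain ⟨q, hq⟩ := exists_represents (d := d) (A := A) (G := subst F A)
      (fun h0 => hA0 (by rw [h0]; rfl)) (fun h0 => hAm (by rw [h0, MvPolynomial.coeff_zero]))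
      (isHomogeneous_subst F.2 A)
    rw [← hq.affCoords_eq m]
    exact hP q ⟨A, hq⟩ ((hq.mem_chart_iff m).mpr ⟨hA0, hAm⟩)
  · intro hP q hq hm
    obtain ⟨A, hA, hrep⟩ := exists_normalized hq hm
    have hm' := (hrep.mem_chart_iff m).mp hm
    have := hP (fun p => A p.1.1 p.1.2) (by simp) (by simp [genericMatrix_zero_zero])
      (by rw [← MvPolynomial.coeff_map, map_eval_subst, genericMatrix_eval A hA]; exact hm'.2)
    rw [map_eval_subst, genericMatrix_eval A hA] at this
    rwa [hrep.affCoords_eq m]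

theorem affIdeal_graph_isPrime (h : (closure (graph F) ∩ chart d m).Nonempty) :
    (affIdeal m (graph F)).IsPrime := by
  rw [affIdeal_graph h]
  exact RingHom.ker_isPrime _

theorem card_matrix_entries : Fintype.card {p : Fin 3 × Fin 3 // p ≠ (0, 0)} = 8 := by
  decide

theorem trdeg_graph_le (h : (closure (graph F) ∩ chart d m).Nonempty) :
    Algebra.trdeg ℂ (CoordRing ⧸ affIdeal m (graph F)) ≤ 8 := by
  have := trdeg_quotient_ker_famHom_le m genericMatrix (subst F genericMatrix)
    (affIdeal_graph h).ge
  rw [card_matrix_entries] at this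
  exact_mod_cast this

/-- The eight free matrix entries are themselves among the coordinates of the family. -/
theorem le_trdeg_graph (h : (closure (graph F) ∩ chart d m).Nonempty) :
    8 ≤ Algebra.trdeg ℂ (CoordRing ⧸ affIdeal m (graph F)) := by
  refine le_trans ?_ (le_trdeg_of_le_ker_famHom (affIdeal_graph h).le)
  set φ := famHom m genericMatrix (subst F genericMatrix)
  have hφ : ∀ p : {p : Fin 3 × Fin 3 // p ≠ (0, 0)}, φ (MvPolynomial.X (Sum.inl p.1)) =
      algebraMap (MvPolynomial {p : Fin 3 × Fin 3 // p ≠ (0, 0)} ℂ) _ (MvPolynomial.X p) := by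
    rintro ⟨⟨i, j⟩, hp⟩
    simp [φ, famHom, nrm, scale, famCoords, genericMatrix_zero_zero, genericMatrix_apply_of_ne hp]
  have hind : AlgebraicIndependent ℂ
      (fun p : {p : Fin 3 × Fin 3 // p ≠ (0, 0)} =>
        φ.rangeRestrict (MvPolynomial.X (Sum.inl p.1))) := by
    refine AlgebraicIndependent.of_comp φ.range.val ?_
    have h1 := (MvPolynomial.algebraicIndependent_X {p : Fin 3 × Fin 3 // p ≠ (0, 0)} ℂ).map'
      (f := IsScalarTower.toAlgHom ℂ (MvPolynomial {p : Fin 3 × Fin 3 // p ≠ (0, 0)} ℂ)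
        (FractionRing (MvPolynomial {p : Fin 3 × Fin 3 // p ≠ (0, 0)} ℂ)))
      (IsFractionRing.injective _ _)
    convert h1 using 1
    funext p
    exact hφ p
  have := hind.cardinalMk_le_trdeg
  rw [Cardinal.mk_fintype, card_matrix_entries] at this
  exact_mod_cast this

theorem matrix_affCoords (q : Ambient d) :
    (Matrix.of fun i j => affCoords m q (Sum.inl (i, j))) = (q.1.rep 0 0)⁻¹ • q.1.rep := by
  ext i j
  simp [affCoords, nrm, scale, repCoords, coords]

theorem affCoords_inl_zero {q : Ambient d} (hq : q ∈ chart d m) :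
    affCoords m q (Sum.inl (0, 0)) = 1 := by
  simp [affCoords, nrm, scale, hq.1]

theorem affCoords_inr_self {q : Ambient d} (hq : q ∈ chart d m) :
    affCoords m q (Sum.inr m) = 1 := by
  simp [affCoords, nrm, scale, hq.2]

theorem affCoords_inr_of_degree_ne {q : Ambient d} {l : Fin 3 →₀ ℕ} (hl : l.degree ≠ d) :
    affCoords m q (Sum.inr l) = 0 := by
  have : MvPolynomial.coeff l ((q.2.rep : Form d) : MvPolynomial (Fin 3) ℂ) = 0 :=
    MvPolynomial.IsHomogeneous.coeff_eq_zero (q.2.rep : Form d).2 hl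
  simp [affCoords, nrm, scale, repCoords, coords, this]

/-- On the graph the form is proportional to `F ∘ A`. Where its coefficient at `m` is invertible,
the equation at `m` therefore generates all base equations: the exceptional divisor is locally
principal. -/
theorem baseEq_relation_mem (F : Form d) (m l : Fin 3 →₀ ℕ) :
    baseEq F l * MvPolynomial.X (Sum.inr m) - MvPolynomial.X (Sum.inr l) * baseEq F m ∈
      affIdeal m (graph F) := by
  intro q hq hm
  obtain ⟨A, hA, hrep⟩ := exists_normalized hq hm
  have hm' := (hrep.mem_chart_iff m).mp hm
  have h1 : (Matrix.of fun i j => nrm m (coords A (subst F A)) (Sum.inl (i, j))) = A := by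
    ext i j
    simp [nrm, scale, coords, hA]
  simp only [map_sub, map_mul, aeval_baseEq, MvPolynomial.aeval_X, hrep.affCoords_eq m, h1]
  simp only [nrm, scale, coords, Sum.elim_inr]
  field_simp
  ring

/-- In a chart, the projective normal cone is cut out in the closure of the graph by a single
equation. -/
theorem mem_PNC_iff {q : Ambient d} (hq : q ∈ closure (graph F)) (hm : q ∈ chart d m) :
    q ∈ PNC F ↔ MvPolynomial.aeval (affCoords m q) (baseEq F m) = 0 := by
  have h0 : q.1.rep 0 0 ≠ 0 := hm.1
  have hsub : ∀ l, MvPolynomial.aeval (affCoords m q) (baseEq F l) =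
      (q.1.rep 0 0)⁻¹ ^ d * MvPolynomial.coeff l (subst F q.1.rep) := by
    intro l
    rw [aeval_baseEq, matrix_affCoords, subst_smul F.2, MvPolynomial.coeff_C_mul]
  constructor
  · intro h
    rw [hsub, h.2, MvPolynomial.coeff_zero, mul_zero]
  · intro h
    refine ⟨hq, ?_⟩
    ext l
    have h1 := baseEq_relation_mem F m l
    rw [← affIdeal_closure] at h1
    have h2 := h1 q hq hm
    rw [map_sub, map_mul, map_mul, h, MvPolynomial.aeval_X, affCoords_inr_self hm, mul_one,
      mul_zero, sub_zero, hsub] at h2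
    rw [MvPolynomial.coeff_zero]
    exact (mul_eq_zero.mp h2).resolve_left (pow_ne_zero _ (inv_ne_zero h0))

theorem baseEq_notMem (h : (closure (graph F) ∩ chart d m).Nonempty) :
    baseEq F m ∉ affIdeal m (graph F) := by
  intro hmem
  obtain ⟨q, hq, hm⟩ := h
  obtain ⟨q', hm', hq'⟩ := mem_closure_iff.mp hq _ (isOpen_chart m) hm
  obtain ⟨A, hA, hrep⟩ := exists_normalized hq' hm'
  have h1 := hmem q' hq' hm'
  have h2 : (Matrix.of fun i j => nrm m (coords A (subst F A)) (Sum.inl (i, j))) = A := by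
    ext i j
    simp [nrm, scale, coords, hA]
  rw [aeval_baseEq, hrep.affCoords_eq m, h2] at h1
  exact ((hrep.mem_chart_iff m).mp hm').2 h1

theorem finite_degree_eq (d : ℕ) : {l : Fin 3 →₀ ℕ | l.degree = d}.Finite := by
  refine Set.Finite.subset (Finset.finite_toSet (Finset.univ.finsuppAntidiag d)) fun l hl => ?_
  simp only [Finset.mem_coe, Finset.mem_finsuppAntidiag]
  refine ⟨?_, Finset.subset_univ _⟩
  rw [← hl, Finsupp.degree_eq_sum]

/-- `CoordRing` has a variable for every monomial of every degree; only the finitely many of degree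
`d` survive in the quotient. -/
theorem finiteType_quotient {I : Ideal CoordRing}
    (hI : ∀ l : Fin 3 →₀ ℕ, l.degree ≠ d → MvPolynomial.X (Sum.inr l) ∈ I) :
    Algebra.FiniteType ℂ (CoordRing ⧸ I) := by
  have : Finite {l : Fin 3 →₀ ℕ | l.degree = d} := finite_degree_eq d
  let φ : MvPolynomial ((Fin 3 × Fin 3) ⊕ {l : Fin 3 →₀ ℕ | l.degree = d}) ℂ →ₐ[ℂ]
      CoordRing ⧸ I := MvPolynomial.aeval
    (Sum.elim (fun p => Ideal.Quotient.mk I (MvPolynomial.X (Sum.inl p)))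
      (fun l => Ideal.Quotient.mk I (MvPolynomial.X (Sum.inr l.1))))
  refine Algebra.FiniteType.of_surjective φ fun y => ?_
  obtain ⟨P, rfl⟩ := Ideal.Quotient.mk_surjective y
  change Ideal.Quotient.mk I P ∈ φ.range
  induction P using MvPolynomial.induction_on with
  | C c => exact φ.range.algebraMap_mem c
  | add P Q hP hQ => rw [map_add]; exact add_mem hP hQ
  | mul_X P i hP =>
    rw [map_mul]
    refine mul_mem hP ?_
    cases i with
    | inl p => exact ⟨MvPolynomial.X (Sum.inl p), by simp [φ]⟩
    | inr l =>
      by_cases hl : l.degree = d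
      · exact ⟨MvPolynomial.X (Sum.inr ⟨l, hl⟩), by simp [φ]⟩
      · rw [Ideal.Quotient.eq_zero_iff_mem.mpr (hI l hl)]
        exact zero_mem _

/-- A zero of the ideal of the graph in a chart comes from a point of its closure. -/
theorem exists_point_of_zero {v : CoordIdx → ℂ}
    (hv : ∀ P ∈ affIdeal m (graph F), MvPolynomial.aeval v P = 0) :
    ∃ q ∈ closure (graph F), q ∈ chart d m ∧ affCoords m q = v := by
  -- The ideal contains `X - 1` for both normalized coordinates and the variables of the wrong
  -- degrees, so `v` consists of the coordinates of an actual matrix and form.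
  have h00 : v (Sum.inl (0, 0)) = 1 := by
    have := hv (MvPolynomial.X (Sum.inl (0, 0)) - 1) fun q _ hm => by
      simp [affCoords_inl_zero hm]
    simpa [sub_eq_zero] using this
  have hm1 : v (Sum.inr m) = 1 := by
    have := hv (MvPolynomial.X (Sum.inr m) - 1) fun q _ hm => by
      simp [affCoords_inr_self hm]
    simpa [sub_eq_zero] using this
  have hdeg : ∀ l : Fin 3 →₀ ℕ, l.degree ≠ d → v (Sum.inr l) = 0 := fun l hl => by
    have := hv (MvPolynomial.X (Sum.inr l)) fun q _ hm => by
      simp [affCoords_inr_of_degree_ne hl]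
    simpa using this
  set A : Mat := Matrix.of fun i j => v (Sum.inl (i, j)) with hA
  set G : MvPolynomial (Fin 3) ℂ :=
    ∑ l ∈ (finite_degree_eq d).toFinset, MvPolynomial.monomial l (v (Sum.inr l)) with hG
  have hGc : ∀ l, MvPolynomial.coeff l G = v (Sum.inr l) := by
    intro l
    rw [hG, MvPolynomial.coeff_sum]
    simp only [MvPolynomial.coeff_monomial, Finset.sum_ite_eq', Set.Finite.mem_toFinset,
      Set.mem_ofPred_eq]
    split_ifs with h
    · rfl
    · exact (hdeg l h).symm
  have hco : coords A G = v := by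
    funext i
    cases i with
    | inl p => simp [coords, hA]
    | inr l => simp [coords, hGc]
  have hA0 : A 0 0 = 1 := h00
  have hGm : G.coeff m = 1 := by rw [hGc, hm1]
  obtain ⟨q, hq⟩ := exists_represents (d := d) (A := A) (G := G)
    (fun h => by rw [h] at hA0; simp at hA0)
    (fun h => by rw [h] at hGm; simp at hGm)
    (MvPolynomial.IsHomogeneous.sum _ _ _ fun l hl => by
      refine MvPolynomial.isHomogeneous_monomial _ ?_
      simpa using hl)
  have hchart : q ∈ chart d m := (hq.mem_chart_iff m).mpr (by simp [hA0, hGm])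
  have haff : affCoords m q = v := by
    rw [hq.affCoords_eq m, hco]
    funext i
    cases i <;> simp [nrm, scale, h00, hm1]
  exact ⟨q, mem_closure_of_affIdeal hchart fun P hP => by rw [haff]; exact hv P hP, hchart, haff⟩

/-- An irreducible subset of the projective normal cone of dimension at least `7` is dense in a
component. -/
theorem isComponent_of_le_trdeg {O : Set (Ambient d)} (hO : O ⊆ PNC F) (hirr : IsIrreducible O)
    (hne : (O ∩ chart d m).Nonempty)
    (htr : 7 ≤ Algebra.trdeg ℂ (CoordRing ⧸ affIdeal m O))
    {W : Set (Ambient d)} (hW : W ⊆ PNC F) (hWirr : IsIrreducible W) (hOW : O ⊆ W) :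
    W ⊆ closure O := by
  have hBne : (closure (graph F) ∩ chart d m).Nonempty := by
    obtain ⟨q, hq, hm⟩ := hne
    exact ⟨q, (hO hq).1, hm⟩
  have hWne : (W ∩ chart d m).Nonempty := hne.mono (Set.inter_subset_inter_left _ hOW)
  have hle1 : affIdeal m (graph F) ≤ affIdeal m W := by
    rw [← affIdeal_closure]
    exact affIdeal_anti (hW.trans fun q hq => hq.1)
  have hle2 : affIdeal m W ≤ affIdeal m O := affIdeal_anti hOW
  refine subset_closure_of_affIdeal_le hWirr.2 hWne ?_
  by_contra hcon
  obtain ⟨P, hPO, hPW⟩ := SetLike.not_le_iff_exists.mp hcon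
  have hpB := affIdeal_graph_isPrime hBne
  have hpW := affIdeal_isPrime hWirr.2 hWne
  have hpO := affIdeal_isPrime hirr.2 hne
  have h8 := trdeg_graph_le hBne
  -- Two strict drops, from the graph to `W` because of `baseEq F m` and from `W` to `O` because of
  -- `P`, would push the dimension of `O` below 7.
  have hlt1 := Algebra.trdeg_lt_of_surjective (Ideal.Quotient.factorₐ ℂ hle1)
    (Ideal.Quotient.factor_surjective hle1)
    (h8.trans_lt (by exact_mod_cast Cardinal.natCast_lt_aleph0 (n := 8)))
    (y := Ideal.Quotient.mk _ (baseEq F m))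
    (fun h => baseEq_notMem hBne (Ideal.Quotient.eq_zero_iff_mem.mp h))
    (Ideal.Quotient.eq_zero_iff_mem.mpr fun q hq hm => (mem_PNC_iff (hW hq).1 hm).mp (hW hq))
  have hlt2 := Algebra.trdeg_lt_of_surjective (Ideal.Quotient.factorₐ ℂ hle2)
    (Ideal.Quotient.factor_surjective hle2)
    ((hlt1.trans_le h8).trans (by exact_mod_cast Cardinal.natCast_lt_aleph0 (n := 8)))
    (y := Ideal.Quotient.mk _ P)
    (fun h => hPW (Ideal.Quotient.eq_zero_iff_mem.mp h))
    (Ideal.Quotient.eq_zero_iff_mem.mpr hPO)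
  have h7 := htr.trans_lt hlt2
  have h9 : (7 : Cardinal) + 1 ≤ Algebra.trdeg ℂ (CoordRing ⧸ affIdeal m W) :=
    Cardinal.add_one_le_of_lt h7
  have := h9.trans_lt (hlt1.trans_le h8)
  norm_num at this

theorem isClosed_PNC (F : Form d) : IsClosed (PNC F) := by
  have h1 : PNC F = closure (graph F) ∩ ⋂ l, (basicOpen d (baseEq F l))ᶜ := by
    ext q
    simp only [PNC, Set.mem_ofPred_eq, Set.mem_inter_iff, Set.mem_iInter, Set.mem_compl_iff,
      basicOpen, not_not]
    refine and_congr_right fun _ => ?_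
    rw [MvPolynomial.ext_iff]
    refine forall_congr' fun l => ?_
    have := aeval_baseEq F l (repCoords q)
    rw [MvPolynomial.aeval_eq_eval] at this
    rw [MvPolynomial.coeff_zero]
    change _ ↔ MvPolynomial.eval _ _ = 0
    exact (Eq.congr_left this).symm
  rw [h1]
  refine isClosed_closure.inter (isClosed_iInter fun l => IsOpen.isClosed_compl ?_)
  exact isOpen_basicOpen (isBihomogeneous_baseEq F.2 l)

/-- An irreducible subset of the projective normal cone of dimension at most `6` is not dense in a
component. -/
theorem not_isComponent_of_trdeg_le {O : Set (Ambient d)} (hO : O ⊆ PNC F) (hirr : IsIrreducible O)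
    (hne : (O ∩ chart d m).Nonempty)
    (htr : Algebra.trdeg ℂ (CoordRing ⧸ affIdeal m O) ≤ 6) :
    ∃ W ⊆ PNC F, IsIrreducible W ∧ closure O ⊆ W ∧ ¬ W ⊆ closure O := by
  have hBne : (closure (graph F) ∩ chart d m).Nonempty := by
    obtain ⟨q, hq, hm⟩ := hne
    exact ⟨q, (hO hq).1, hm⟩
  have hpB := affIdeal_graph_isPrime hBne
  have hpO := affIdeal_isPrime hirr.2 hne
  have hle : affIdeal m (graph F) ≤ affIdeal m O := by
    rw [← affIdeal_closure]
    exact affIdeal_anti (hO.trans fun q hq => hq.1)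
  have hbO : baseEq F m ∈ affIdeal m O := fun q hq hm => (mem_PNC_iff (hO hq).1 hm).mp (hO hq)
  have hdegB : ∀ l : Fin 3 →₀ ℕ, l.degree ≠ d →
      (MvPolynomial.X (Sum.inr l) : CoordRing) ∈ affIdeal m (graph F) := fun l hl q _ _ => by
    rw [MvPolynomial.aeval_X, affCoords_inr_of_degree_ne hl]
  have hftB : Algebra.FiniteType ℂ (CoordRing ⧸ affIdeal m (graph F)) := finiteType_quotient hdegB
  -- If no such strictly smaller prime existed, the ideal of `O` would be minimal over the single
  -- equation of the cone, and `O` would have dimension at least 7 by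
  -- `Algebra.trdeg_le_trdeg_quotient_add_one`.
  obtain ⟨𝔭, hp, hBp, hbp, hpO', hne'⟩ : ∃ 𝔭 : Ideal CoordRing, 𝔭.IsPrime ∧
      affIdeal m (graph F) ≤ 𝔭 ∧ baseEq F m ∈ 𝔭 ∧ 𝔭 ≤ affIdeal m O ∧ ¬ affIdeal m O ≤ 𝔭 := by
    by_contra! hcon
    set π := Ideal.Quotient.mkₐ ℂ (affIdeal m (graph F))
    have hπ : Function.Surjective π := Ideal.Quotient.mkₐ_surjective _ _
    have hker : RingHom.ker π ≤ affIdeal m O := fun P hP =>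
      hle (Ideal.Quotient.eq_zero_iff_mem.mp hP)
    have hcm : ((affIdeal m O).map π).comap π = affIdeal m O := by
      rw [Ideal.comap_map_of_surjective' π hπ, sup_eq_left]
      exact hker
    have hprime : ((affIdeal m O).map π).IsPrime := Ideal.map_isPrime_of_surjective hπ hker
    have hmin : (affIdeal m O).map π ∈ (Ideal.span {π (baseEq F m)}).minimalPrimes := by
      refine ⟨⟨hprime, ?_⟩, ?_⟩
      · rw [Ideal.span_singleton_le_iff_mem]
        exact Ideal.mem_map_of_mem _ hbO
      · rintro 𝔮 ⟨hq, hbq⟩ hle'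
        rw [Ideal.span_singleton_le_iff_mem] at hbq
        have h1 := hcon (𝔮.comap π) (hq.comap π) (fun P hP => by
          rw [Ideal.mem_comap]
          have : π P = 0 := Ideal.Quotient.eq_zero_iff_mem.mpr hP
          rw [this]; exact zero_mem _) hbq (by
            rw [← hcm]; exact Ideal.comap_mono hle')
        exact Ideal.map_le_iff_le_comap.mpr h1
    have h1 := Algebra.trdeg_le_trdeg_quotient_add_one (k := ℂ) _ _ hmin
    have h2 : Algebra.trdeg ℂ ((CoordRing ⧸ affIdeal m (graph F)) ⧸ (affIdeal m O).map π) =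
        Algebra.trdeg ℂ (CoordRing ⧸ affIdeal m O) :=
      (DoubleQuot.quotQuotEquivQuotOfLEₐ ℂ hle).trdeg_eq
    have h3 : (8 : Cardinal) ≤ 6 + 1 := by
      refine (le_trdeg_graph hBne).trans (h1.trans ?_)
      gcongr
      exact h2.le.trans htr
    norm_num at h3
  have hft : Algebra.FiniteType ℂ (CoordRing ⧸ 𝔭) := finiteType_quotient fun l hl => hBp (hdegB l hl)
  set V : Set (Ambient d) := {q | q ∈ closure (graph F) ∧ q ∈ chart d m ∧
    ∀ P ∈ 𝔭, MvPolynomial.aeval (affCoords m q) P = 0} with hV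
  have hVE : V ⊆ PNC F := fun q hq => (mem_PNC_iff hq.1 hq.2.1).mpr (hq.2.2 _ hbp)
  -- By the Nullstellensatz the ideal of `V` is exactly `𝔭`. Hence `V` is irreducible, and it is not
  -- contained in `closure O`.
  have hnull : ∀ P ∉ 𝔭, ∃ q ∈ V, MvPolynomial.aeval (affCoords m q) P ≠ 0 := by
    intro P hP
    obtain ⟨φ, hφ⟩ := exists_algHom_ne_zero (A := CoordRing ⧸ 𝔭) (x := Ideal.Quotient.mk 𝔭 P)
      (fun h => hP (Ideal.Quotient.eq_zero_iff_mem.mp h))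
    set v : CoordIdx → ℂ := fun i => φ (Ideal.Quotient.mk 𝔭 (MvPolynomial.X i)) with hv
    have hvφ : ∀ Q, MvPolynomial.aeval v Q = φ (Ideal.Quotient.mk 𝔭 Q) := by
      intro Q
      have : MvPolynomial.aeval v = φ.comp (Ideal.Quotient.mkₐ ℂ 𝔭) := by
        apply MvPolynomial.algHom_ext
        intro i
        simp [hv]
      rw [this]
      rfl
    have hv0 : ∀ Q ∈ 𝔭, MvPolynomial.aeval v Q = 0 := fun Q hQ => by
      rw [hvφ, Ideal.Quotient.eq_zero_iff_mem.mpr hQ, map_zero]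
    obtain ⟨q, hq, hqm, hqv⟩ := exists_point_of_zero (F := F) fun Q hQ => hv0 Q (hBp hQ)
    exact ⟨q, ⟨hq, hqm, by rw [hqv]; exact hv0⟩, by rw [hqv, hvφ]; exact hφ⟩
  have hOV : O ∩ chart d m ⊆ V := fun q hq =>
    ⟨(hO hq.1).1, hq.2, fun P hP => hpO' hP q hq.1 hq.2⟩
  have hVirr : IsIrreducible V := by
    refine ⟨hne.mono hOV, isPreirreducible_of_basicOpen fun P Q a b hP hQ hPne hQne => ?_⟩
    obtain ⟨x, hxV, hx⟩ := hPne
    obtain ⟨y, hyV, hy⟩ := hQne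
    rw [mem_basicOpen_iff_of_chart hxV.2.1 hP] at hx
    rw [mem_basicOpen_iff_of_chart hyV.2.1 hQ] at hy
    obtain ⟨q, hqV, hq⟩ := hnull (P * Q) fun hPQ => (hp.mem_or_mem hPQ).elim
      (fun h => hx (hxV.2.2 _ h)) (fun h => hy (hyV.2.2 _ h))
    rw [map_mul] at hq
    refine ⟨q, hqV, ?_, ?_⟩
    · rw [mem_basicOpen_iff_of_chart hqV.2.1 hP]; exact left_ne_zero_of_mul hq
    · rw [mem_basicOpen_iff_of_chart hqV.2.1 hQ]; exact right_ne_zero_of_mul hq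
  have hOcl : O ⊆ closure V :=
    (subset_closure_inter_of_isPreirreducible_of_isOpen hirr.2 (isOpen_chart m) hne).trans
      (closure_mono hOV)
  refine ⟨closure V, closure_minimal hVE (isClosed_PNC F), ⟨hVirr.1.mono subset_closure,
    hVirr.2.closure⟩, closure_minimal hOcl isClosed_closure, fun hcon => hne' ?_⟩
  intro P hP
  by_contra hPp
  obtain ⟨q, hqV, hq⟩ := hnull P hPp
  rw [← affIdeal_closure] at hP
  exact hq (hP q (hcon (subset_closure hqV)) hqV.2.1)

end PlaneCurve


/-! ### Power series as Puiseux series -/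

namespace PowerSeries

variable {N : ℕ}

theorem mulRight_inv_injective (hN : 0 < N) :
    Function.Injective (AddMonoidHom.mulRight ((N : ℚ)⁻¹)) := fun _ _ h =>
  mul_left_injective₀ (inv_ne_zero (Nat.cast_ne_zero.mpr hN.ne')) h

theorem mulRight_inv_le_iff (hN : 0 < N) (x y : ℚ) :
    AddMonoidHom.mulRight ((N : ℚ)⁻¹) x ≤ AddMonoidHom.mulRight ((N : ℚ)⁻¹) y ↔ x ≤ y :=
  mul_le_mul_iff_left₀ (inv_pos.mpr (Nat.cast_pos.mpr hN))

variable (hN : 0 < N)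

/-- The embedding `t ↦ y ^ (1 / N)` of formal power series into Puiseux series. -/
def toPuiseux : PowerSeries ℂ →+* HahnSeries ℚ ℂ :=
  (HahnSeries.embDomainRingHom _ (mulRight_inv_injective hN) (mulRight_inv_le_iff hN)).comp
    (HahnSeries.ofPowerSeries ℚ ℂ)

theorem coeff_toPuiseux (h : PowerSeries ℂ) (l : ℚ) :
    (toPuiseux hN h).coeff l = (HahnSeries.ofPowerSeries ℚ ℂ h).coeff (l * N) := by
  have hN' : (N : ℚ) ≠ 0 := Nat.cast_ne_zero.mpr hN.ne'
  rw [toPuiseux, RingHom.comp_apply, HahnSeries.embDomainRingHom_apply]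
  conv_lhs => rw [show l = (l * N) * (N : ℚ)⁻¹ by field_simp]
  exact HahnSeries.embDomain_coeff

theorem coeff_toPuiseux_div (h : PowerSeries ℂ) (n : ℕ) :
    (toPuiseux hN h).coeff (n / N) = coeff n h := by
  rw [coeff_toPuiseux, div_mul_cancel₀ _ (Nat.cast_ne_zero.mpr hN.ne'),
    HahnSeries.ofPowerSeries_apply_coeff]

theorem coeff_toPuiseux_eq_zero (h : PowerSeries ℂ) {l : ℚ} (hl : ∀ n : ℕ, l * N ≠ n) :
    (toPuiseux hN h).coeff l = 0 := by
  rw [coeff_toPuiseux, HahnSeries.ofPowerSeries_apply, HahnSeries.embDomain_of_notMem_range]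
  rintro ⟨n, hn⟩
  exact hl n hn.symm

theorem toPuiseux_injective : Function.Injective (toPuiseux hN) := fun h h' H => by
  ext n
  rw [← coeff_toPuiseux_div hN, H, coeff_toPuiseux_div]

theorem toPuiseux_X_pow : toPuiseux hN (X ^ N) = HahnSeries.single 1 1 := by
  ext l
  rw [coeff_toPuiseux, HahnSeries.ofPowerSeries_X_pow, HahnSeries.coeff_single,
    HahnSeries.coeff_single]
  have hN' : (N : ℚ) ≠ 0 := Nat.cast_ne_zero.mpr hN.ne'
  congr 1
  rw [mul_eq_right₀ hN']

theorem toPuiseux_comp_algebraMap : (toPuiseux hN).comp (algebraMap ℂ (PowerSeries ℂ)) =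
    algebraMap ℂ (HahnSeries ℚ ℂ) := by
  ext1 c
  rw [RingHom.comp_apply, algebraMap_apply, toPuiseux, RingHom.comp_apply]
  change HahnSeries.embDomainRingHom _ _ _ (HahnSeries.ofPowerSeries ℚ ℂ (C c)) = _
  rw [HahnSeries.ofPowerSeries_C, HahnSeries.embDomainRingHom_C,
    HahnSeries.algebraMap_apply']
  exact (HahnSeries.ofPowerSeries_C c).symm

/-- The power series whose coefficients are those of a Puiseux series at the multiples of
`1 / N`. -/
def ofPuiseux (N : ℕ) (f : HahnSeries ℚ ℂ) : PowerSeries ℂ := mk fun n => f.coeff (n / N)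

theorem toPuiseux_ofPuiseux {f : HahnSeries ℚ ℂ} (hf : ∀ l ∈ f.support, ∃ n : ℕ, l * N = n) :
    toPuiseux hN (ofPuiseux N f) = f := by
  ext l
  by_cases hl : ∃ n : ℕ, l * N = n
  · obtain ⟨n, hn⟩ := hl
    have : l = n / N := by
      rw [← hn, mul_div_cancel_right₀ _ (Nat.cast_ne_zero.mpr hN.ne')]
    rw [this, coeff_toPuiseux_div, ofPuiseux, coeff_mk]
  · push Not at hl
    rw [coeff_toPuiseux_eq_zero hN _ hl]
    by_contra h
    obtain ⟨n, hn⟩ := hf l (Ne.symm h)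
    exact hl n hn

end PowerSeries

namespace PlaneCurve

variable {d : ℕ}

/-! ### The branches of a curve -/

/-- The equation `F (1, t ^ N, z)`. -/
def branchPoly (F : MvPolynomial (Fin 3) ℂ) (N : ℕ) : (PowerSeries ℂ)[X] :=
  MvPolynomial.aeval ![1, Polynomial.C (PowerSeries.X ^ N), Polynomial.X] F

/-- Puiseux series, the germ in the variable `s`, and evaluation at `t = 0` are all instances of
this substitution. -/
theorem eval₂_branchPoly {W : Type*} [CommRing W] [Algebra ℂ W] (F : MvPolynomial (Fin 3) ℂ)
    (N : ℕ) (ψ : PowerSeries ℂ →+* W)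
    (hψ : ψ.comp (algebraMap ℂ (PowerSeries ℂ)) = algebraMap ℂ W) (w : W) :
    (branchPoly F N).eval₂ ψ w = MvPolynomial.aeval ![1, ψ PowerSeries.X ^ N, w] F := by
  rw [branchPoly, ← Polynomial.coe_eval₂RingHom, MvPolynomial.map_aeval, MvPolynomial.aeval_def,
    MvPolynomial.coe_eval₂Hom]
  congr 1
  · rw [← hψ]
    ext1 c
    simp [Polynomial.algebraMap_apply]
  · funext i
    fin_cases i
    · simp
    · change Polynomial.eval₂ ψ w (Polynomial.C (PowerSeries.X ^ N)) = _
      rw [Polynomial.eval₂_C, map_pow]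
      rfl
    · exact Polynomial.eval₂_X _ _

theorem map_branchPoly (F : MvPolynomial (Fin 3) ℂ) (N k : ℕ) (hk : k ≠ 0) :
    (branchPoly F N).map (PowerSeries.ramify k hk) = branchPoly F (k * N) := by
  rw [branchPoly, ← Polynomial.coe_mapRingHom, MvPolynomial.map_aeval, branchPoly,
    MvPolynomial.aeval_def, MvPolynomial.coe_eval₂Hom]
  congr 1
  · ext1 c
    simp only [RingHom.comp_apply, Polynomial.algebraMap_apply, Polynomial.coe_mapRingHom,
      Polynomial.map_C]
    congr 1
    exact (PowerSeries.expand k hk).commutes c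
  · funext i
    fin_cases i <;> simp [pow_mul]

/-- For a form of degree `d` the exponents of `y` and `z` determine that of `x`, so setting `x = 1`
causes no cancellation. -/
theorem branchPoly_ne_zero {F : MvPolynomial (Fin 3) ℂ} (hF : F.IsHomogeneous d) (hF0 : F ≠ 0)
    {N : ℕ} (hN : 0 < N) : branchPoly F N ≠ 0 := by
  obtain ⟨m, hm⟩ := MvPolynomial.support_nonempty.mpr hF0
  have hdeg : ∀ m ∈ F.support, m 0 + m 1 + m 2 = d := fun m hm => by
    have := hF (MvPolynomial.mem_support_iff.mp hm)
    rw [← this, ← Fin.sum_univ_three, ← Finsupp.degree_eq_sum]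
    exact DFunLike.congr_fun Finsupp.degree_eq_weight_one m
  intro h
  have h1 : PowerSeries.coeff (N * m 1) ((branchPoly F N).coeff (m 2)) = F.coeff m := by
    rw [branchPoly, MvPolynomial.aeval_def, MvPolynomial.eval₂_eq', Polynomial.finsetSum_coeff,
      map_sum, Finset.sum_eq_single m]
    · rw [Fin.prod_univ_three]
      simp only [Polynomial.algebraMap_apply, Matrix.cons_val_zero, one_pow, one_mul,
        Matrix.cons_val_one, Matrix.cons_val, ← Polynomial.C_pow, ← pow_mul,
        Polynomial.coeff_C_mul, Polynomial.coeff_X_pow, ← PowerSeries.C_eq_algebraMap,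
        PowerSeries.coeff_C_mul, if_true, mul_one, PowerSeries.coeff_X_pow]
    · intro m' hm' hne
      rw [Fin.prod_univ_three]
      simp only [Polynomial.algebraMap_apply, Matrix.cons_val_zero, one_pow, one_mul,
        Matrix.cons_val_one, Matrix.cons_val, ← Polynomial.C_pow, ← pow_mul,
        Polynomial.coeff_C_mul, Polynomial.coeff_X_pow, ← PowerSeries.C_eq_algebraMap,
        PowerSeries.coeff_C_mul]
      split_ifs with h2
      · rw [mul_one, PowerSeries.coeff_X_pow, if_neg, mul_zero]
        intro h3
        apply hne
        have h4 := Nat.eq_of_mul_eq_mul_left hN h3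
        have h5 := hdeg m hm
        have h6 := hdeg m' hm'
        ext i
        fin_cases i <;> simp <;> omega
      · simp
    · intro h
      exact absurd hm h
  rw [h] at h1
  exact (MvPolynomial.mem_support_iff.mp hm) (by simpa using h1.symm)

theorem toPuiseux_eval_branchPoly (F : MvPolynomial (Fin 3) ℂ) {N : ℕ} (hN : 0 < N)
    (h : PowerSeries ℂ) : PowerSeries.toPuiseux hN ((branchPoly F N).eval h) =
      MvPolynomial.aeval ![1, HahnSeries.single (1 : ℚ) (1 : ℂ), PowerSeries.toPuiseux hN h] F := by
  rw [← Polynomial.eval₂_id, Polynomial.hom_eval₂, RingHom.comp_id,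
    eval₂_branchPoly _ _ _ (PowerSeries.toPuiseux_comp_algebraMap hN), ← map_pow,
    PowerSeries.toPuiseux_X_pow]

theorem IsTangentBranch.integral {F : MvPolynomial (Fin 3) ℂ} {f : HahnSeries ℚ ℂ}
    (hf : IsTangentBranch F f) :
    ∃ n : ℕ, 0 < n ∧ ∀ N, n ∣ N → ∀ l ∈ f.support, ∃ k : ℕ, l * N = k := by
  obtain ⟨n, hn, h⟩ := hf.puiseux
  refine ⟨n, hn, ?_⟩
  rintro _ ⟨r, rfl⟩ l hl
  obtain ⟨k, hk⟩ := h l hl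
  have hl0 : 0 < l := (zero_lt_one.trans hf.one_lt_order).trans_le
    (HahnSeries.order_le_of_coeff_ne_zero hl)
  have : 0 ≤ k := by
    have : (0 : ℚ) ≤ k := by rw [← hk]; positivity
    exact_mod_cast this
  lift k to ℕ using this
  exact ⟨k * r, by push_cast at hk ⊢; rw [← hk]; ring⟩

theorem isTangentBranch_toPuiseux_iff {F : MvPolynomial (Fin 3) ℂ} {N : ℕ} (hN : 0 < N)
    (h : PowerSeries ℂ) : IsTangentBranch F (PowerSeries.toPuiseux hN h) ↔
      PowerSeries.toPuiseux hN h ≠ 0 ∧ 1 < (PowerSeries.toPuiseux hN h).order ∧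
        (branchPoly F N).eval h = 0 := by
  rw [← map_eq_zero_iff _ (PowerSeries.toPuiseux_injective hN), toPuiseux_eval_branchPoly]
  refine ⟨fun H => ⟨H.ne_zero, H.one_lt_order, H.root⟩, fun H => ⟨H.1, ⟨N, hN, fun l hl => ?_⟩,
    H.2.1, H.2.2⟩⟩
  by_contra! hcon
  exact hl (PowerSeries.coeff_toPuiseux_eq_zero hN h fun n => by exact_mod_cast hcon n)

/-- All branches are roots of `F (1, y, z)`, one nonzero polynomial in `z` over Hahn series. -/
theorem finite_isTangentBranch {F : MvPolynomial (Fin 3) ℂ} (hF : F.IsHomogeneous d) (hF0 : F ≠ 0) :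
    {f | IsTangentBranch F f}.Finite := by
  set P := (branchPoly F 1).map (PowerSeries.toPuiseux one_pos)
  have hP : P ≠ 0 := (Polynomial.map_ne_zero_iff (PowerSeries.toPuiseux_injective one_pos)).mpr
    (branchPoly_ne_zero hF hF0 one_pos)
  refine (Polynomial.finite_setOfPred_isRoot hP).subset fun f hf => ?_
  change P.eval f = 0
  rw [Polynomial.eval_map, eval₂_branchPoly _ _ _ (PowerSeries.toPuiseux_comp_algebraMap one_pos),
    ← map_pow, PowerSeries.toPuiseux_X_pow]
  exact hf.root

theorem order_sub_eq {f g : HahnSeries ℚ ℂ} {C : ℚ}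
    (h : HahnSeries.truncLT C f = HahnSeries.truncLT C g) (hC : f.coeff C ≠ g.coeff C) :
    (f - g).order = C := by
  have h1 : (f - g).coeff C ≠ 0 := by rwa [HahnSeries.coeff_sub, sub_ne_zero]
  refine le_antisymm (HahnSeries.order_le_of_coeff_ne_zero h1) ?_
  by_contra! hlt
  have h2 := congrArg (fun x => x.coeff (f - g).order) h
  simp only [HahnSeries.coeff_truncLT, if_pos hlt] at h2
  have h3 : (f - g).coeff (f - g).order = 0 := by rw [HahnSeries.coeff_sub, h2, sub_self]
  rw [HahnSeries.coeff_order_eq_zero] at h3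
  rw [h3] at h1
  exact h1 rfl

/-- `C` is recovered as the order of `g - h`, and there are finitely many pairs of branches. -/
theorem finite_isCharacteristic {F : MvPolynomial (Fin 3) ℂ} (hF : F.IsHomogeneous d)
    (hF0 : F ≠ 0) : {C : ℚ | IsCharacteristic F C}.Finite := by
  have hfin := finite_isTangentBranch hF hF0
  refine ((hfin.prod hfin).image fun p => (p.1 - p.2).order).subset ?_
  rintro C ⟨φ, -, g, h, hg, hh, hgφ, hhφ, hC⟩
  exact ⟨(g, h), ⟨hg, hh⟩, order_sub_eq (hgφ.trans hhφ.symm) hC⟩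

end PlaneCurve


/-! ### Leading terms of power series -/

namespace PowerSeries

variable {B : Type} [CommRing B]

/-- `L` is the coefficient of `w` in order `n`, and `w` vanishes to that order. -/
def HasLead (n : ℕ) (L : B) (w : PowerSeries B) : Prop :=
  ∃ r, w = X ^ n * r ∧ constantCoeff r = L

namespace HasLead

variable {n n' : ℕ} {L L' : B} {w w' : PowerSeries B}

theorem add (h : HasLead n L w) (h' : HasLead n L' w') : HasLead n (L + L') (w + w') := by
  obtain ⟨r, rfl, rfl⟩ := h
  obtain ⟨r', rfl, rfl⟩ := h'
  exact ⟨r + r', by ring, map_add _ _ _⟩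

theorem mul (h : HasLead n L w) (h' : HasLead n' L' w') :
    HasLead (n + n') (L * L') (w * w') := by
  obtain ⟨r, rfl, rfl⟩ := h
  obtain ⟨r', rfl, rfl⟩ := h'
  exact ⟨r * r', by ring, map_mul _ _ _⟩

theorem sum {ι : Type*} {s : Finset ι} {L : ι → B} {w : ι → PowerSeries B}
    (h : ∀ i ∈ s, HasLead n (L i) (w i)) : HasLead n (∑ i ∈ s, L i) (∑ i ∈ s, w i) := by
  classical
  induction s using Finset.induction_on with
  | empty => exact ⟨0, by simp, by simp⟩
  | insert i s hi ih =>
    rw [Finset.sum_insert hi, Finset.sum_insert hi]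
    exact (h i (Finset.mem_insert_self _ _)).add
      (ih fun j hj => h j (Finset.mem_insert_of_mem hj))

theorem X_pow_mul (n : ℕ) (r : PowerSeries B) : HasLead n (constantCoeff r) (X ^ n * r) :=
  ⟨r, rfl, rfl⟩

theorem X_pow_mul_of_lt (h : n < n') (r : PowerSeries B) : HasLead n 0 (X ^ n' * r) := by
  obtain ⟨k, rfl⟩ := Nat.exists_eq_add_of_lt h
  exact ⟨X ^ (k + 1) * r, by ring, by simp⟩

theorem of_lt (h : HasLead n' L w) (hn : n < n') : HasLead n 0 w := by
  obtain ⟨r, rfl, -⟩ := h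
  exact X_pow_mul_of_lt hn r

theorem zero (n : ℕ) : HasLead n 0 (0 : PowerSeries B) := ⟨0, by simp, by simp⟩

theorem unique [IsDomain B] (h : HasLead n L w) (h' : HasLead n' L' w) (hL : L ≠ 0)
    (hL' : L' ≠ 0) : n = n' ∧ L = L' := by
  wlog hle : n ≤ n' generalizing n n' L L'
  · obtain ⟨h1, h2⟩ := this h' h hL' hL (not_le.mp hle).le
    exact ⟨h1.symm, h2.symm⟩
  rcases hle.eq_or_lt with rfl | hlt
  · obtain ⟨r, hr, rfl⟩ := h
    obtain ⟨r', hr', rfl⟩ := h'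
    rw [mul_left_cancel₀ (pow_ne_zero n X_ne_zero) (hr.symm.trans hr')]
    exact ⟨rfl, rfl⟩
  · obtain ⟨r, hr, rfl⟩ := h
    obtain ⟨r', hr', hL0⟩ := h'.of_lt hlt
    rw [mul_left_cancel₀ (pow_ne_zero n X_ne_zero) (hr.symm.trans hr')] at hL
    exact absurd hL0 hL

theorem ne_zero (h : HasLead n L w) (hL : L ≠ 0) : w ≠ 0 := by
  rintro rfl
  obtain ⟨r, hr, rfl⟩ := h
  apply hL
  have := congrArg (coeff n) hr
  rwa [map_zero, coeff_X_pow_mul', if_pos le_rfl, Nat.sub_self, coeff_zero_eq_constantCoeff_apply,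
    eq_comm] at this

theorem constantCoeff_eq (h : HasLead n L w) : constantCoeff w = if n = 0 then L else 0 := by
  obtain ⟨r, rfl, rfl⟩ := h
  split_ifs with h0
  · simp [h0]
  · simp [h0]

end HasLead

variable [Algebra ℂ B]

/-- Second order suffices: in `hasLead_germ` the quadratic term at the initial exponent `j₀` already
lands at order `a * c'`, so cubic terms do not reach the leading coefficient. -/
theorem one_add_pow_eq {W : Type*} [CommRing W] [Algebra ℂ W] (u : W) (j : ℕ) :
    ∃ R : W, (1 + u) ^ j = 1 + algebraMap ℂ W j * u +
      algebraMap ℂ W (j * (j - 1) / 2) * u ^ 2 + u ^ 3 * R := by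
  induction j with
  | zero => exact ⟨0, by simp⟩
  | succ j ih =>
    obtain ⟨R, hR⟩ := ih
    refine ⟨algebraMap ℂ W (j * (j - 1) / 2) + (1 + u) * R, ?_⟩
    have h1 : algebraMap ℂ W (((j + 1 : ℕ) : ℂ) * ((j + 1 : ℕ) - 1) / 2) =
        algebraMap ℂ W (j * (j - 1) / 2) + algebraMap ℂ W j := by
      rw [← map_add]
      congr 1
      push_cast
      ring
    rw [pow_succ, hR, h1]
    push_cast
    ring

/-- The expansion of the germ along its own branch, in the coordinate `τ = s ^ a (1 + s ^ M η)`. -/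
theorem hasLead_germ {N a c' j₀ M : ℕ} (hN : 0 < N) (ha : 0 < a) (hM : 0 < M)
    (hMc : a * j₀ + 2 * M = a * c') {p : ℕ → ℂ} (hp : ∀ j < j₀, p j = 0) (η z : B)
    {Y : PowerSeries B} (hY : X ^ M * Y = (1 + X ^ M * C η) ^ N - 1) :
    ∃ b : ℂ, HasLead (a * c') (z + algebraMap ℂ B (p j₀ * (j₀ * (N - j₀) / 2)) * η ^ 2 +
        algebraMap ℂ B b * η)
      ((∑ j ∈ Finset.range c', algebraMap ℂ (PowerSeries B) (p j) * X ^ (a * j)) +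
        (∑ j ∈ (Finset.range c').filter (fun j => a * j + M < a * c'),
          algebraMap ℂ (PowerSeries B) (j / N * p j) * X ^ (a * j + M)) * Y +
        X ^ (a * c') * C z -
        ∑ j ∈ Finset.range c',
          algebraMap ℂ (PowerSeries B) (p j) * (X ^ a * (1 + X ^ M * C η)) ^ j) := by
  have hconst : ∀ x : ℂ, constantCoeff (algebraMap ℂ (PowerSeries B) x) = algebraMap ℂ B x :=
    fun x => by rw [algebraMap_apply, constantCoeff_C]
  set u : PowerSeries B := X ^ M * C η with hu
  have hu0 : constantCoeff u = 0 := by simp [hu, hM.ne']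
  have hj₀ : j₀ < c' := lt_of_mul_lt_mul_left (show a * j₀ < a * c' by omega) (Nat.zero_le a)
  set T : ℕ → PowerSeries B := fun j => algebraMap ℂ (PowerSeries B) (p j) * X ^ (a * j) *
    (1 + (if a * j + M < a * c' then algebraMap ℂ (PowerSeries B) (j / N) * ((1 + u) ^ N - 1)
      else 0) - (1 + u) ^ j) with hT
  set L : ℕ → B := fun j =>
    (if j = j₀ then algebraMap ℂ B (p j₀ * (j₀ * (N - j₀) / 2)) * η ^ 2 else 0) +
    (if a * j + M = a * c' then algebraMap ℂ B (-(j * p j)) * η else 0) with hL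
  have key : ∀ j ∈ Finset.range c', HasLead (a * c') (L j) (T j) := by
    intro j _
    obtain ⟨R, hR⟩ := one_add_pow_eq u j
    by_cases hlt : a * j + M < a * c'
    · obtain ⟨R', hR'⟩ := one_add_pow_eq u N
      have hTj : T j = X ^ (a * j + 2 * M) * (algebraMap ℂ (PowerSeries B) (p j) *
          C η ^ 2 * (algebraMap ℂ (PowerSeries B) (j * (N - j) / 2) +
            u * (algebraMap ℂ (PowerSeries B) (j / N) * R' - R))) := by
        have e1 : algebraMap ℂ (PowerSeries B) (j / N) * algebraMap ℂ (PowerSeries B) N =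
            algebraMap ℂ (PowerSeries B) j := by
          rw [← map_mul, div_mul_cancel₀ _ (Nat.cast_ne_zero.mpr hN.ne')]
        have e2 : algebraMap ℂ (PowerSeries B) (j / N) *
            algebraMap ℂ (PowerSeries B) (N * (N - 1) / 2) =
            algebraMap ℂ (PowerSeries B) (j * (N - j) / 2) +
              algebraMap ℂ (PowerSeries B) (j * (j - 1) / 2) := by
          rw [← map_mul, ← map_add]
          congr 1
          have : (N : ℂ) ≠ 0 := Nat.cast_ne_zero.mpr hN.ne'
          field_simp
          ring
        have e3 : X ^ (a * j + 2 * M) * C η ^ 2 = X ^ (a * j) * u ^ 2 := by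
          rw [hu]; ring
        calc T j = X ^ (a * j) * u ^ 2 * (algebraMap ℂ (PowerSeries B) (p j) *
              (algebraMap ℂ (PowerSeries B) (j * (N - j) / 2) +
                u * (algebraMap ℂ (PowerSeries B) (j / N) * R' - R))) := by
              simp only [hT, if_pos hlt]
              rw [hR, hR']
              linear_combination (algebraMap ℂ (PowerSeries B) (p j) * X ^ (a * j) * u) * e1 +
                (algebraMap ℂ (PowerSeries B) (p j) * X ^ (a * j) * u ^ 2) * e2
          _ = _ := by rw [← e3]; ring
      have hne : a * j + M ≠ a * c' := hlt.ne
      rcases lt_trichotomy j j₀ with h | rfl | h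
      · have h1 : T j = 0 := by simp [hT, hp j h]
        have h2 : L j = 0 := by simp [hL, h.ne, hne]
        rw [h1, h2]
        exact .zero _
      · have h2 : L j = algebraMap ℂ B (p j * (j * (N - j) / 2)) * η ^ 2 := by simp [hL, hne]
        rw [hTj, h2, hMc]
        convert HasLead.X_pow_mul (a * c') _ using 1
        simp only [map_mul, map_add, map_pow, hconst, hu0, constantCoeff_C]
        ring
      · have h2 : L j = 0 := by simp [hL, h.ne', hne]
        rw [hTj, h2]
        exact .X_pow_mul_of_lt (by nlinarith) _
    · have hTj : T j = X ^ (a * j + M) * (algebraMap ℂ (PowerSeries B) (p j) * C η *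
          -(algebraMap ℂ (PowerSeries B) j +
            u * (algebraMap ℂ (PowerSeries B) (j * (j - 1) / 2) + u * R))) := by
        have e3 : X ^ (a * j + M) * C η = X ^ (a * j) * u := by rw [hu]; ring
        calc T j = X ^ (a * j) * u * (algebraMap ℂ (PowerSeries B) (p j) *
              -(algebraMap ℂ (PowerSeries B) j +
                u * (algebraMap ℂ (PowerSeries B) (j * (j - 1) / 2) + u * R))) := by
              simp only [hT, if_neg hlt]
              rw [hR]
              ring
          _ = _ := by rw [← e3]; ring
      have hne : j ≠ j₀ := by
        rintro rfl
        omega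
      rcases (not_lt.mp hlt).eq_or_lt with h | h
      · have h2 : L j = algebraMap ℂ B (-(j * p j)) * η := by simp [hL, hne, h]
        rw [hTj, h2, ← h]
        convert HasLead.X_pow_mul (a * c') _ using 1
        simp only [map_mul, map_add, map_neg, hconst, hu0, constantCoeff_C]
        ring
      · have h2 : L j = 0 := by simp [hL, hne, h.ne']
        rw [hTj, h2]
        exact .X_pow_mul_of_lt h _
  have hz : HasLead (a * c') z (X ^ (a * c') * C z) := by
    simpa using HasLead.X_pow_mul (a * c') (C z)
  refine ⟨∑ j ∈ (Finset.range c').filter (fun j => a * j + M = a * c'), -(j * p j), ?_⟩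
  convert hz.add (HasLead.sum key) using 1
  · simp only [hL, Finset.sum_add_distrib, Finset.sum_ite_eq', Finset.mem_range, if_pos hj₀,
      ← Finset.sum_filter, map_sum, Finset.sum_mul]
    ring
  · have e4 : ∀ j, T j = algebraMap ℂ (PowerSeries B) (p j) * X ^ (a * j) +
        (if a * j + M < a * c' then
          algebraMap ℂ (PowerSeries B) (j / N * p j) * X ^ (a * j + M) * Y else 0) -
        algebraMap ℂ (PowerSeries B) (p j) * (X ^ a * (1 + u)) ^ j := by
      intro j
      simp only [hT]
      split_ifs
      · rw [← hY, map_mul, mul_pow, ← pow_mul]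
        ring
      · rw [mul_pow, ← pow_mul]
        ring
    simp only [e4, Finset.sum_add_distrib, Finset.sum_sub_distrib, ← Finset.sum_filter,
      Finset.sum_mul]
    ring

/-- The substitution `t ↦ τ`, for `τ` of positive order. -/
theorem exists_substHom {τ : PowerSeries B} (hτ : constantCoeff τ = 0) :
    ∃ ψ : PowerSeries ℂ →ₐ[ℂ] PowerSeries B, ψ X = τ ∧
      ∀ h, constantCoeff (ψ h) = algebraMap ℂ B (constantCoeff h) := by
  have hs : HasSubst τ := HasSubst.of_constantCoeff_zero' hτ
  let ψ : PowerSeries ℂ →ₐ[ℂ] PowerSeries B := substAlgHom hs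
  have hX : ψ X = τ := by
    change substAlgHom hs X = τ
    rw [coe_substAlgHom, subst_X hs]
  refine ⟨ψ, hX, fun h => ?_⟩
  obtain ⟨r, hr⟩ := X_dvd_iff.mpr (show constantCoeff (h - C (constantCoeff h)) = 0 by simp)
  rw [sub_eq_iff_eq_add'] at hr
  have hC : ψ (C (constantCoeff h)) = C (algebraMap ℂ B (constantCoeff h)) := by
    have := ψ.commutes (constantCoeff h)
    rwa [algebraMap_apply, algebraMap_apply] at this
  conv_lhs => rw [hr]
  rw [map_add, map_mul, hX, hC, map_add, map_mul, hτ, zero_mul, add_zero, constantCoeff_C]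

end PowerSeries


/-! ### The equation of the curve along a germ -/

namespace PowerSeries

variable {B : Type} [CommRing B] [Algebra ℂ B]

open scoped Classical in
/-- The leading term of a product of linear factors along a germ which is close to `pt` up to
order `c`. -/
theorem exists_hasLead_eval₂ {a c : ℕ} (ha : 0 < a) (hc : 0 < c) {v : PowerSeries B}
    (hv : constantCoeff v = 1) {ψ : PowerSeries ℂ →ₐ[ℂ] PowerSeries B} (hψX : ψ X = X ^ a * v)
    (hψ : ∀ h, constantCoeff (ψ h) = algebraMap ℂ B (constantCoeff h))
    {pt : PowerSeries ℂ} (hpt : constantCoeff pt = 0) (hptc : coeff c pt = 0) {w : PowerSeries B}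
    {q : B} (hw : HasLead (a * c) q (w - ψ pt)) {P Q : (PowerSeries ℂ)[X]} {e : ℕ}
    {s : Multiset (PowerSeries ℂ)}
    (hP : P = Polynomial.C (X ^ e) * Q * (s.map fun h => Polynomial.X - Polynomial.C h).prod)
    (hQ : constantCoeff (Q.coeff 0) ≠ 0) :
    ∃ (E : ℕ) (κ : ℂ), κ ≠ 0 ∧ HasLead E (algebraMap ℂ B κ *
      ((s.filter fun h => ∀ j < c, coeff j h = coeff j pt).map
        fun h => q - algebraMap ℂ B (coeff c h)).prod)
      (P.eval₂ (ψ : PowerSeries ℂ →+* PowerSeries B) w) := by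
  have hψpow : ∀ n r, HasLead (a * n) (algebraMap ℂ B (constantCoeff r)) (ψ (X ^ n * r)) := by
    intro n r
    refine ⟨v ^ n * ψ r, ?_, ?_⟩
    · rw [map_mul, map_pow, hψX]
      ring
    · rw [map_mul, map_pow, hv, hψ, one_pow, one_mul]
  have hfac : ∀ h : PowerSeries ℂ, ∃ (E : ℕ) (κ : ℂ), κ ≠ 0 ∧ HasLead E (algebraMap ℂ B κ *
      if ∀ j < c, coeff j h = coeff j pt then q - algebraMap ℂ B (coeff c h) else 1)
      (w - ψ h) := by
    intro h
    -- Either `h` agrees with `pt` below order `c`, and both summands start at order `a * c`; or `pt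
    -- - h` has smaller order and dominates with a nonzero constant.
    have hsub : w - ψ h = (w - ψ pt) + ψ (pt - h) := by rw [map_sub]; ring
    split_ifs with hm
    · refine ⟨a * c, 1, one_ne_zero, ?_⟩
      obtain ⟨r, hr⟩ : X ^ c ∣ pt - h := X_pow_dvd_iff.mpr fun j hj => by
        rw [map_sub, hm j hj, sub_self]
      have hr0 : constantCoeff r = -coeff c h := by
        have := congrArg (coeff c) hr
        rw [coeff_X_pow_mul', if_pos le_rfl, Nat.sub_self, coeff_zero_eq_constantCoeff_apply,
          map_sub, hptc, zero_sub] at this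
        exact this.symm
      rw [hsub, map_one, one_mul, sub_eq_add_neg, ← map_neg, ← hr0, hr]
      exact hw.add (hψpow c r)
    · push Not at hm
      obtain ⟨j, hj, hne⟩ := hm
      obtain ⟨n, r, hr, hr0⟩ := exists_eq_X_pow_mul (c := pt - h) fun h0 => hne (by
        rw [sub_eq_zero.mp h0])
      have hnj : n ≤ j := by
        by_contra! hlt
        have := X_pow_dvd_iff.mp (Dvd.intro r hr.symm) j hlt
        rw [map_sub, sub_eq_zero] at this
        exact hne this.symm
      refine ⟨a * n, constantCoeff r, hr0, ?_⟩
      rw [hsub, mul_one, hr, ← zero_add (algebraMap ℂ B _)]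
      exact (hw.of_lt (Nat.mul_lt_mul_of_pos_left (hnj.trans_lt hj) ha)).add (hψpow n r)
  have hprod : ∃ (E : ℕ) (κ : ℂ), κ ≠ 0 ∧ HasLead E (algebraMap ℂ B κ *
      ((s.filter fun h => ∀ j < c, coeff j h = coeff j pt).map
        fun h => q - algebraMap ℂ B (coeff c h)).prod) (s.map fun h => w - ψ h).prod := by
    clear hP
    induction s using Multiset.induction_on with
    | empty => exact ⟨0, 1, one_ne_zero, 1, by simp, by simp⟩
    | cons h s ih =>
      obtain ⟨E, κ, hκ, hE⟩ := ih
      obtain ⟨E', κ', hκ', hE'⟩ := hfac h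
      refine ⟨E' + E, κ' * κ, mul_ne_zero hκ' hκ, ?_⟩
      rw [Multiset.map_cons, Multiset.prod_cons]
      convert hE'.mul hE using 1
      by_cases hm : ∀ j < c, coeff j h = coeff j pt
      · rw [Multiset.filter_cons_of_pos _ hm, Multiset.map_cons, Multiset.prod_cons, if_pos hm,
          map_mul]
        ring
      · rw [Multiset.filter_cons_of_neg _ hm, if_neg hm, map_mul]
        ring
  obtain ⟨E, κ, hκ, hE⟩ := hprod
  have hw0 : constantCoeff w = 0 := by
    have h1 := hw.constantCoeff_eq
    rw [if_neg (Nat.mul_pos ha hc).ne', map_sub, hψ, hpt, map_zero, sub_zero] at h1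
    exact h1
  have hQ' : HasLead 0 (algebraMap ℂ B (constantCoeff (Q.coeff 0)))
      (Q.eval₂ (ψ : PowerSeries ℂ →+* PowerSeries B) w) := by
    refine ⟨_, by rw [pow_zero, one_mul], ?_⟩
    rw [Polynomial.hom_eval₂, hw0, Polynomial.eval₂_at_zero]
    exact hψ _
  have hX' := hψpow e 1
  refine ⟨a * e + 0 + E, constantCoeff (Q.coeff 0) * κ, mul_ne_zero hQ hκ, ?_⟩
  rw [hP, Polynomial.eval₂_mul, Polynomial.eval₂_mul, Polynomial.eval₂_C,
    ← Polynomial.coe_eval₂RingHom, map_multiset_prod, Multiset.map_map]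
  convert (hX'.mul hQ').mul hE using 1
  · simp only [map_one, one_mul, map_mul]
    ring
  · simp

end PowerSeries

namespace PlaneCurve

variable {d : ℕ}

/-- There are finitely many branches, so one exponent clears all their denominators. Multiplying it
by the ramification needed for the factorization keeps this property. -/
theorem exists_branch_factorization {F : MvPolynomial (Fin 3) ℂ} (hF : F.IsHomogeneous d)
    (hF0 : F ≠ 0) {a : ℕ} (ha : 0 < a) :
    ∃ N' : ℕ, 0 < N' ∧ ∃ (e : ℕ) (Q : (PowerSeries ℂ)[X]) (s : Multiset (PowerSeries ℂ)),
      branchPoly F (a * N') = Polynomial.C (PowerSeries.X ^ e) * Q *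
        (s.map fun h => Polynomial.X - Polynomial.C h).prod ∧
      PowerSeries.constantCoeff (Q.coeff 0) ≠ 0 ∧
      (∀ h ∈ s, PowerSeries.constantCoeff h = 0) ∧
      ∀ g, IsTangentBranch F g → ∀ l ∈ g.support, ∃ k : ℕ, l * (a * N' : ℕ) = k := by
  classical
  have hfin := finite_isTangentBranch hF hF0
  choose! n hn hn' using fun g (hg : IsTangentBranch F g) => hg.integral
  set N₀ := ∏ g ∈ hfin.toFinset, n g with hN₀
  have hN₀pos : 0 < N₀ := Finset.prod_pos fun g hg => hn g (by simpa using hg)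
  obtain ⟨k, hk, e, Q, s, h1, h2, h3⟩ := PowerSeries.exists_local_factorization _
    (branchPoly_ne_zero hF hF0 (Nat.mul_pos ha hN₀pos))
  rw [map_branchPoly, show k * (a * N₀) = a * (k * N₀) by ring] at h1
  refine ⟨k * N₀, Nat.mul_pos (Nat.pos_of_ne_zero hk) hN₀pos, e, Q, s, h1, h2, h3, ?_⟩
  intro g hg
  exact hn' g hg _ (((Finset.dvd_prod_of_mem n (by simpa using hg)).mul_left k).mul_left a)

section germ

variable {B : Type} [CommRing B] [Algebra ℂ B] {f : HahnSeries ℚ ℂ} {C : ℚ} {a b c N' : ℕ}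

/-- The expansion uses exponents in `ℤ / (a N')`, finer than the `ℤ / a` of the germ. The
integrality condition below `C` makes the additional coefficients vanish. -/
theorem aeval_truncSubst (hV : IsTypeV f C a b c) (hN' : 0 < N') :
    Polynomial.aeval (PowerSeries.X ^ (a * N') : PowerSeries B) (truncSubst f a c) =
      ∑ j ∈ Finset.range (N' * c),
        algebraMap ℂ (PowerSeries B) (f.coeff (j / (a * N' : ℕ))) * PowerSeries.X ^ (a * j) := by
  have ha : (a : ℚ) ≠ 0 := Nat.cast_ne_zero.mpr hV.a_pos.ne'
  have hN : (N' : ℚ) ≠ 0 := Nat.cast_ne_zero.mpr hN'.ne'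
  rw [truncSubst, map_sum]
  refine Finset.sum_of_injOn (fun n => N' * n) (fun x _ y _ h => Nat.eq_of_mul_eq_mul_left hN' h)
    (fun n hn => ?_) (fun j hj hne => ?_) (fun n _ => ?_)
  · simp only [Finset.coe_range, Set.mem_Iio] at hn ⊢
    exact Nat.mul_lt_mul_of_pos_left hn hN'
  · by_cases h0 : f.coeff (j / (a * N' : ℕ)) = 0
    · rw [h0, map_zero, zero_mul]
    exfalso
    have hj' : (j : ℚ) < N' * c := by exact_mod_cast Finset.mem_range.mp hj
    have hlt : (j : ℚ) / (a * N' : ℕ) < C := by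
      have := hV.a_pos
      rw [div_lt_iff₀ (by positivity)]
      rw [hV.hc] at hj'
      push_cast
      linarith
    obtain ⟨n, hn⟩ := hV.integral _ h0 hlt
    have hjn : j = N' * n := by
      have : (j : ℚ) = N' * n := by
        rw [← hn]
        push_cast
        field_simp
      exact_mod_cast this
    refine hne ⟨n, ?_, hjn.symm⟩
    rw [hjn] at hj
    exact Finset.mem_coe.mpr (Finset.mem_range.mpr
      (lt_of_mul_lt_mul_left (Finset.mem_range.mp hj) (Nat.zero_le _)))
  · rw [Polynomial.aeval_monomial, ← pow_mul]
    have : ((N' * n : ℕ) : ℚ) / (a * N' : ℕ) = n / a := by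
      push_cast
      field_simp
    rw [this]
    ring_nf

theorem IsTypeV.a_lt_b (hV : IsTypeV f C a b c) : a < b := by
  have ha : (0 : ℚ) < a := Nat.cast_pos.mpr hV.a_pos
  have h1 := hV.order_lt
  have : (a : ℚ) < b := by
    rw [hV.hb]
    nlinarith
  exact_mod_cast this

theorem aeval_truncDerivSubst (hV : IsTypeV f C a b c) (hN' : 0 < N')
    (hf : ∀ l ≤ 1, f.coeff l = 0) :
    Polynomial.aeval (PowerSeries.X ^ (a * N') : PowerSeries B) (truncDerivSubst f a b c) =
      ∑ j ∈ (Finset.range (N' * c)).filter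
          (fun j => a * j + a * N' * (b - a) < a * (N' * c)),
        algebraMap ℂ (PowerSeries B) (j / (a * N' : ℕ) * f.coeff (j / (a * N' : ℕ))) *
          PowerSeries.X ^ (a * j + a * N' * (b - a)) := by
  have ha : (a : ℚ) ≠ 0 := Nat.cast_ne_zero.mpr hV.a_pos.ne'
  have hN : (N' : ℚ) ≠ 0 := Nat.cast_ne_zero.mpr hN'.ne'
  have hab := hV.a_lt_b
  -- The terms with `n + a < b` belong to exponents of `f` below its order and vanish; discarding
  -- them makes the natural subtraction `n + a - b` exact.
  rw [truncDerivSubst, map_sum, ← Finset.sum_filter_of_ne (p := fun n => b ≤ n + a)]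
  · refine Finset.sum_of_injOn (fun n => N' * (n + a - b)) (fun x hx y hy h => ?_)
      (fun n hn => ?_) (fun j hj hne => ?_) (fun n hn => ?_)
    · simp only [Finset.coe_filter, Finset.mem_range, Set.mem_ofPred_eq] at hx hy
      have := Nat.eq_of_mul_eq_mul_left hN' h
      omega
    · simp only [Finset.coe_filter, Finset.mem_range, Set.mem_ofPred_eq] at hn ⊢
      have h1 : n + a - b < c := by omega
      refine ⟨Nat.mul_lt_mul_of_pos_left h1 hN', ?_⟩
      have h2 : n + a - b + (b - a) < c := by omega
      calc a * (N' * (n + a - b)) + a * N' * (b - a) = a * N' * (n + a - b + (b - a)) := by ring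
        _ < a * N' * c := Nat.mul_lt_mul_of_pos_left h2 (Nat.mul_pos hV.a_pos hN')
        _ = a * (N' * c) := by ring
    · by_cases h0 : f.coeff (j / (a * N' : ℕ)) = 0
      · rw [h0, mul_zero, map_zero, zero_mul]
      exfalso
      obtain ⟨hj1, hj2⟩ := Finset.mem_filter.mp hj
      have hj' : (j : ℚ) < N' * c := by exact_mod_cast Finset.mem_range.mp hj1
      have hlt : (j : ℚ) / (a * N' : ℕ) < C := by
        have := hV.a_pos
        rw [div_lt_iff₀ (by positivity)]
        rw [hV.hc] at hj'
        push_cast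
        linarith
      obtain ⟨n, hn⟩ := hV.integral _ h0 hlt
      have hjn : j = N' * n := by
        have : (j : ℚ) = N' * n := by
          rw [← hn]
          push_cast
          field_simp
        exact_mod_cast this
      have h3 : n + (b - a) < c := by
        rw [hjn] at hj2
        refine lt_of_mul_lt_mul_left (a := a * N') ?_ (Nat.zero_le _)
        calc a * N' * (n + (b - a)) = a * (N' * n) + a * N' * (b - a) := by ring
          _ < a * (N' * c) := hj2
          _ = a * N' * c := by ring
      refine hne ⟨n + (b - a), ?_, ?_⟩
      · simp only [Finset.coe_filter, Finset.mem_range, Set.mem_ofPred_eq]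
        omega
      · rw [hjn]
        change N' * (n + (b - a) + a - b) = N' * n
        congr 1
        omega
    · obtain ⟨-, hn2⟩ := Finset.mem_filter.mp hn
      obtain ⟨k, hk⟩ := Nat.exists_eq_add_of_le hn2
      have e1 : ((n : ℚ) - b) / a + 1 = k / a := by
        have : (n : ℚ) + a = b + k := by exact_mod_cast hk
        field_simp
        linarith
      have e2 : n + a - b = k := by omega
      have e3 : ((N' * k : ℕ) : ℚ) / (a * N' : ℕ) = k / a := by
        push_cast
        field_simp
      have e4 : ((N' * k : ℕ) : ℂ) / (a * N' : ℕ) = ((k / a : ℚ) : ℂ) := by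
        rw [← e3]
        push_cast
        rfl
      have e5 : a * (N' * k) + a * N' * (b - a) = a * N' * n := by
        rw [show n = k + (b - a) by omega]
        ring
      rw [Polynomial.aeval_monomial, ← pow_mul, e1, e2, e3, e4, e5]
  · intro n _ hne
    by_contra! hlt
    apply hne
    have : ((n : ℚ) - b) / a + 1 ≤ 1 := by
      have h1 : (n : ℚ) + a < b := by exact_mod_cast hlt
      have h2 : (0 : ℚ) < a := Nat.cast_pos.mpr hV.a_pos
      have : ((n : ℚ) - b) / a ≤ 0 := div_nonpos_of_nonpos_of_nonneg (by linarith) h2.le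
      linarith
    rw [hf _ this, mul_zero, Polynomial.monomial_zero_right, map_zero]

end germ


/-! ### Existence and uniqueness of limits -/

theorem exists_eq_C_X_pow_mul {P : MvPolynomial (Fin 3) ℂ[X]} (hP : P ≠ 0) :
    ∃ (k : ℕ) (H : MvPolynomial (Fin 3) ℂ[X]), P = MvPolynomial.C (Polynomial.X ^ k) * H ∧
      MvPolynomial.map (Polynomial.evalRingHom 0) H ≠ 0 := by
  have hX : ¬ IsUnit (MvPolynomial.C Polynomial.X : MvPolynomial (Fin 3) ℂ[X]) := by
    intro h
    have := h.map (MvPolynomial.constantCoeff (σ := Fin 3) (R := ℂ[X]))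
    rw [MvPolynomial.constantCoeff_C] at this
    exact Polynomial.not_isUnit_X this
  obtain ⟨k, H, hH, hPH⟩ := WfDvdMonoid.max_power_factor' hP hX
  refine ⟨k, H, by rw [hPH, map_pow], fun h0 => hH ?_⟩
  rw [MvPolynomial.C_dvd_iff_dvd_coeff]
  intro m
  rw [Polynomial.X_dvd_iff, Polynomial.coeff_zero_eq_eval_zero]
  have := congrArg (MvPolynomial.coeff m) h0
  rwa [MvPolynomial.coeff_map, MvPolynomial.coeff_zero] at this

theorem IsLimit.unique {F : MvPolynomial (Fin 3) ℂ} {α : Matrix (Fin 3) (Fin 3) ℂ[X]}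
    {G G' : MvPolynomial (Fin 3) ℂ} (h : IsLimit F α G) (h' : IsLimit F α G') : G = G' := by
  obtain ⟨hG, k, H, hk, rfl⟩ := h
  obtain ⟨hG', k', H', hk', rfl⟩ := h'
  wlog hle : k ≤ k' generalizing k k' H H'
  · exact (this k' H' hk' hG' k H hk hG (not_le.mp hle).le).symm
  obtain ⟨r, rfl⟩ := Nat.exists_eq_add_of_le hle
  have hX : (MvPolynomial.C (Polynomial.X ^ k) : MvPolynomial (Fin 3) ℂ[X]) ≠ 0 := by
    rw [Ne, MvPolynomial.C_eq_zero]
    exact pow_ne_zero _ Polynomial.X_ne_zero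
  have h1 : H = MvPolynomial.C (Polynomial.X ^ r) * H' := by
    apply mul_left_cancel₀ hX
    rw [← hk, hk', pow_add, map_mul, mul_assoc]
  rcases r.eq_zero_or_pos with rfl | hr
  · rw [h1, pow_zero, map_one, one_mul]
  · refine absurd ?_ hG
    rw [h1, map_mul, MvPolynomial.map_C, Polynomial.coe_evalRingHom, Polynomial.eval_pow,
      Polynomial.eval_X, zero_pow hr.ne', map_zero, zero_mul]

theorem IsLimit.isHomogeneous {F : MvPolynomial (Fin 3) ℂ} (hF : F.IsHomogeneous d)
    {α : Matrix (Fin 3) (Fin 3) ℂ[X]} {G : MvPolynomial (Fin 3) ℂ} (h : IsLimit F α G) :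
    G.IsHomogeneous d := by
  obtain ⟨-, k, H, hk, rfl⟩ := h
  refine MvPolynomial.IsHomogeneous.map (φ := H) ?_ _
  intro m hm
  refine (isHomogeneous_subst hF α) (d := m) ?_
  rw [hk, MvPolynomial.coeff_C_mul]
  exact mul_ne_zero (pow_ne_zero _ Polynomial.X_ne_zero) hm

theorem eval_smul_of_isHomogeneous {G : MvPolynomial (Fin 3) ℂ} (hG : G.IsHomogeneous d) (r : ℂ)
    (v : Fin 3 → ℂ) : MvPolynomial.eval (r • v) G = r ^ d * MvPolynomial.eval v G := by
  rw [MvPolynomial.eval_eq, MvPolynomial.eval_eq, Finset.mul_sum]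
  refine Finset.sum_congr rfl fun m hm => ?_
  have hd : ∑ i ∈ m.support, m i = d :=
    (DFunLike.congr_fun Finsupp.degree_eq_weight_one m).trans
      (hG (MvPolynomial.mem_support_iff.mp hm))
  simp_rw [Pi.smul_apply, smul_eq_mul, mul_pow, Finset.prod_mul_distrib,
    Finset.prod_pow_eq_pow_sum, hd]
  ring

/-- A form is determined by its restriction to the affine chart `x = 1`. -/
theorem eval_eq_dehomogenize {G : MvPolynomial (Fin 3) ℂ} (hG : G.IsHomogeneous d)
    {v : Fin 3 → ℂ} (hv : v 0 ≠ 0) :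
    MvPolynomial.eval v G = v 0 ^ d * MvPolynomial.eval ![1, v 1 / v 0, v 2 / v 0] G := by
  rw [← eval_smul_of_isHomogeneous hG]
  congr 2
  funext i
  fin_cases i <;> simp [hv, mul_div_cancel₀]

theorem eq_zero_of_eval_chart {G : MvPolynomial (Fin 3) ℂ} (hG : G.IsHomogeneous d)
    (h : ∀ y z, MvPolynomial.eval ![1, y, z] G = 0) : G = 0 := by
  have h1 : MvPolynomial.X 0 * G = 0 := by
    apply MvPolynomial.funext
    intro v
    rw [map_mul, MvPolynomial.eval_X, map_zero]
    by_cases hv : v 0 = 0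
    · rw [hv, zero_mul]
    · rw [eval_eq_dehomogenize hG hv, h, mul_zero, mul_zero]
  exact (mul_eq_zero.mp h1).resolve_left (MvPolynomial.X_ne_zero 0)

/-- `λ₀ + 2 (b/a - 1) = C` without denominators: the choice of `b` that puts the quadratic Taylor
error exactly at order `t^c`. -/
theorem IsTypeV.algebra {f : HahnSeries ℚ ℂ} {C : ℚ} {a b c N' : ℕ} (hV : IsTypeV f C a b c)
    {j₀ : ℕ} (hj₀ : f.order * (a * N' : ℕ) = j₀) :
    a * j₀ + 2 * (a * N' * (b - a)) = a * (N' * c) := by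
  have hab := hV.a_lt_b
  have : ((a * j₀ + 2 * (a * N' * (b - a)) : ℕ) : ℚ) = ((a * (N' * c) : ℕ) : ℚ) := by
    push_cast [Nat.cast_sub hab.le]
    rw [← hj₀, hV.hb, hV.hc]
    push_cast
    ring
  exact_mod_cast this

/-- The image of `F ∘ α` under `t ↦ s ^ N`, `x ↦ 1`, `y ↦ Y`, `z ↦ Z`. -/
theorem eval₂Hom_subst {W : Type} [CommRing W] [Algebra ℂ W] (F : MvPolynomial (Fin 3) ℂ)
    (α : Matrix (Fin 3) (Fin 3) ℂ[X]) (σ : W) (v : Fin 3 → W) :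
    MvPolynomial.eval₂Hom (Polynomial.aeval (R := ℂ) σ : ℂ[X] →+* W) v (subst F α) =
      MvPolynomial.aeval (fun i => ∑ j, Polynomial.aeval σ (α i j) * v j) F := by
  rw [subst_eq, MvPolynomial.map_aeval, MvPolynomial.aeval_def, MvPolynomial.coe_eval₂Hom]
  congr 1
  · ext1 c
    rw [RingHom.comp_apply, MvPolynomial.algebraMap_apply, MvPolynomial.coe_eval₂Hom,
      MvPolynomial.eval₂_C]
    simp
  · funext i
    simp [rowForm]

open scoped Classical in
/-- The limit along a germ of type V: a union of conics in a pencil, and a multiple line. -/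
theorem exists_limit {F : MvPolynomial (Fin 3) ℂ} (hF : F.IsHomogeneous d) (hF0 : F ≠ 0)
    {f : HahnSeries ℚ ℂ} {C : ℚ} {a b c : ℕ} (hf : IsTangentBranch F f)
    (hV : IsTypeV f C a b c) :
    ∃ (G : MvPolynomial (Fin 3) ℂ) (δ : Multiset ℂ) (κ A B : ℂ),
      IsLimit F (typeVGerm f a b c) G ∧ κ ≠ 0 ∧ A ≠ 0 ∧
      (∀ y z, MvPolynomial.eval ![1, y, z] G =
        κ * (δ.map fun e => z + A * y ^ 2 + B * y - e).prod) ∧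
      (∀ e, e ∈ δ ↔ ∃ g, IsTangentBranch F g ∧
        HahnSeries.truncLT C g = HahnSeries.truncLT C f ∧ g.coeff C = e) := by
  obtain ⟨N', hN', e, Q, s, hfact, hQ, -, hint⟩ := exists_branch_factorization hF hF0 hV.a_pos
  set N := a * N' with hNdef
  have hN : 0 < N := Nat.mul_pos hV.a_pos hN'
  have hNQ : (N : ℚ) ≠ 0 := Nat.cast_ne_zero.mpr hN.ne'
  set c' := N' * c with hc'def
  have hCc' : (c' : ℚ) / N = C := by
    have : (a : ℚ) ≠ 0 := Nat.cast_ne_zero.mpr hV.a_pos.ne'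
    have : (N' : ℚ) ≠ 0 := Nat.cast_ne_zero.mpr hN'.ne'
    rw [hc'def, hNdef]
    push_cast
    rw [hV.hc]
    field_simp
  have hf1 : ∀ l ≤ 1, f.coeff l = 0 := fun l hl =>
    HahnSeries.coeff_eq_zero_of_lt_order (hl.trans_lt hf.one_lt_order)
  have hord : f.coeff f.order ≠ 0 := fun h => hf.ne_zero (HahnSeries.coeff_order_eq_zero.mp h)
  obtain ⟨j₀, hj₀⟩ := hint f hf _ hord
  have hj₀' : (j₀ : ℚ) / N = f.order := by rw [← hj₀, mul_div_cancel_right₀ _ hNQ]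
  set M := N * (b - a) with hMdef
  have hM : 0 < M := Nat.mul_pos hN (Nat.sub_pos_of_lt hV.a_lt_b)
  have hMc : a * j₀ + 2 * M = a * c' := hV.algebra hj₀
  set p : ℕ → ℂ := fun j => f.coeff (j / N) with hpdef
  have hp : ∀ j < j₀, p j = 0 := fun j hj => HahnSeries.coeff_eq_zero_of_lt_order (by
    rw [← hj₀']
    gcongr)
  have hpj₀ : p j₀ ≠ 0 := by rw [hpdef]; simpa only [hj₀'] using hord
  have hj₀N : j₀ ≠ N := by
    rintro rfl
    rw [div_self hNQ] at hj₀'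
    exact hf.one_lt_order.ne hj₀'
  have hj₀0 : j₀ ≠ 0 := by
    rintro rfl
    have := hf.one_lt_order
    rw [← hj₀', Nat.cast_zero, zero_div] at this
    exact absurd this (by norm_num)
  have hc'0 : 0 < c' := by
    have : 0 < a * c' := by omega
    exact Nat.pos_of_mul_pos_left this
  -- The truncation of `f` below `C`, written in the `N`-th root of `y`.
  set pt : PowerSeries ℂ := ∑ j ∈ Finset.range c', PowerSeries.monomial j (p j) with hptdef
  have hptcoeff : ∀ i, PowerSeries.coeff i pt = if i < c' then p i else 0 := by
    intro i
    simp [hptdef, PowerSeries.coeff_monomial]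
  let R := MvPolynomial (Fin 2) ℂ
  let η : R := MvPolynomial.X 0
  let z : R := MvPolynomial.X 1
  set u : PowerSeries R := PowerSeries.X ^ M * PowerSeries.C η with hudef
  -- `Y` is chosen so that `t^a + t^b Y`, with `t = s^N`, is the `N`-th power of `s^a (1 + s^M η)`.
  -- The branches can then be substituted as ordinary power series, and `Y` reduces to `N η` at `s =
  -- 0`.
  set Y : PowerSeries R := PowerSeries.C η * ∑ i ∈ Finset.range N, (1 + u) ^ i with hYdef
  have hY : PowerSeries.X ^ M * Y = (1 + u) ^ N - 1 := by
    rw [hYdef, ← mul_assoc, ← hudef, ← mul_geom_sum, add_sub_cancel_left]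
  have hu0 : PowerSeries.constantCoeff u = 0 := by simp [hudef, hM.ne']
  have hY0 : PowerSeries.constantCoeff Y = η * N := by simp [hYdef, hu0]
  obtain ⟨B₀, hlead⟩ := PowerSeries.hasLead_germ hN hV.a_pos hM hMc hp η z hY
  obtain ⟨ψ, hψX, hψ⟩ := PowerSeries.exists_substHom (B := R)
    (τ := PowerSeries.X ^ a * (1 + u)) (by simp [hV.a_pos.ne'])
  set q : R := z + algebraMap ℂ R (p j₀ * (j₀ * (N - j₀) / 2)) * η ^ 2 + algebraMap ℂ R B₀ * η
    with hqdef
  set w : PowerSeries R := (∑ j ∈ Finset.range c', algebraMap ℂ (PowerSeries R) (p j) *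
      PowerSeries.X ^ (a * j)) + (∑ j ∈ (Finset.range c').filter (fun j => a * j + M < a * c'),
        algebraMap ℂ (PowerSeries R) (j / N * p j) * PowerSeries.X ^ (a * j + M)) * Y +
      PowerSeries.X ^ (a * c') * PowerSeries.C z with hwdef
  have hψpt : ψ pt = ∑ j ∈ Finset.range c',
      algebraMap ℂ (PowerSeries R) (p j) * (PowerSeries.X ^ a * (1 + u)) ^ j := by
    rw [hptdef, map_sum]
    refine Finset.sum_congr rfl fun j _ => ?_
    rw [PowerSeries.monomial_eq_C_mul_X_pow, map_mul, map_pow, hψX]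
    congr 1
    exact ψ.commutes (p j)
  rw [← hψpt] at hlead
  obtain ⟨E, κ, hκ, hprod⟩ := PowerSeries.exists_hasLead_eval₂ hV.a_pos hc'0
    (v := 1 + u) (by simp [hu0]) hψX hψ
    (by rw [← PowerSeries.coeff_zero_eq_constantCoeff_apply, hptcoeff, if_pos hc'0]
        exact hp 0 (Nat.pos_of_ne_zero hj₀0))
    (by rw [hptcoeff, if_neg (lt_irrefl _)]) hlead hfact hQ
  rw [eval₂_branchPoly _ _ _ (by ext1 x; exact ψ.commutes x), RingHom.coe_coe] at hprod
  set s' := s.filter fun h => ∀ j < c', PowerSeries.coeff j h = PowerSeries.coeff j pt with hs'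
  set v : Fin 3 → PowerSeries R := ![1, Y, PowerSeries.C z] with hvdef
  set Ψ := MvPolynomial.eval₂Hom
    (Polynomial.aeval (R := ℂ) (PowerSeries.X ^ N : PowerSeries R) : ℂ[X] →+* PowerSeries R) v
    with hΨdef
  have hΨ : Ψ (subst F (typeVGerm f a b c)) =
      MvPolynomial.aeval ![1, ψ PowerSeries.X ^ N, w] F := by
    rw [hΨdef, eval₂Hom_subst]
    congr 2
    funext i
    rw [Fin.sum_univ_three]
    fin_cases i
    · simp [typeVGerm, hvdef]
    · have h1 : N * b = N * a + M := by
        rw [hMdef, ← mul_add, Nat.add_sub_cancel' hV.a_lt_b.le]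
      simp only [typeVGerm, hvdef, Fin.mk_one, Matrix.of_apply, Matrix.cons_val_one,
        Matrix.cons_val_zero, Matrix.cons_val, map_pow, Polynomial.aeval_X, map_zero, zero_mul,
        add_zero, mul_one]
      have h2 : ((PowerSeries.X : PowerSeries R) ^ a) ^ N = PowerSeries.X ^ (N * a) := by
        rw [← pow_mul, mul_comm]
      rw [hψX, mul_pow, h2, ← pow_mul, ← pow_mul, h1, pow_add]
      linear_combination PowerSeries.X ^ (N * a) * hY
    · have h1 : N * c = a * c' := by rw [hNdef, hc'def]; ring
      simp only [typeVGerm, hvdef, Fin.reduceFinMk, Matrix.of_apply, Matrix.cons_val_one,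
        Matrix.cons_val_zero, Matrix.cons_val, map_pow, Polynomial.aeval_X, mul_one]
      rw [hNdef, aeval_truncSubst hV hN', aeval_truncDerivSubst hV hN' hf1, ← pow_mul, ← hNdef, h1]
  have hΨ0 : ∀ H, PowerSeries.constantCoeff (Ψ H) = MvPolynomial.aeval ![1, η * N, z]
      (MvPolynomial.map (Polynomial.evalRingHom 0) H) := by
    intro H
    have : (PowerSeries.constantCoeff (R := R)).comp Ψ =
        (MvPolynomial.aeval ![1, η * N, z] : MvPolynomial (Fin 3) ℂ →ₐ[ℂ] R).toRingHom.comp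
          (MvPolynomial.map (Polynomial.evalRingHom 0)) := by
      apply MvPolynomial.ringHom_ext'
      · apply Polynomial.ringHom_ext
        · intro x
          simp [hΨdef, PowerSeries.algebraMap_apply]
        · simp [hΨdef, hN.ne']
      · intro i
        fin_cases i <;> simp [hΨdef, hvdef, hY0]
    exact DFunLike.congr_fun this H
  have hq : ∀ x : ℂ, q - algebraMap ℂ R x ≠ 0 := by
    intro x h
    have := congrArg (MvPolynomial.eval ![0, x + 1]) h
    simp [hqdef, η, z, R] at this
  have hL0 : algebraMap ℂ R κ *
      (s'.map fun h => q - algebraMap ℂ R (PowerSeries.coeff c' h)).prod ≠ 0 := by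
    refine mul_ne_zero ((map_ne_zero_iff _ (algebraMap ℂ R).injective).mpr hκ) ?_
    rw [Ne, Multiset.prod_eq_zero_iff, Multiset.mem_map]
    rintro ⟨h, -, h0⟩
    exact hq _ h0
  rw [← hΨ] at hprod
  have hsub0 : subst F (typeVGerm f a b c) ≠ 0 := fun h0 => hprod.ne_zero hL0 (by rw [h0, map_zero])
  obtain ⟨k, H, hkH, hH0⟩ := exists_eq_C_X_pow_mul hsub0
  set G := MvPolynomial.map (Polynomial.evalRingHom 0) H with hGdef
  have hlim : IsLimit F (typeVGerm f a b c) G := ⟨hH0, k, H, hkH, rfl⟩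
  have hNC : (N : ℂ) ≠ 0 := Nat.cast_ne_zero.mpr hN.ne'
  have heval : ∀ y t, MvPolynomial.eval ![1, y, t] G =
      MvPolynomial.eval ![y / N, t] (MvPolynomial.aeval ![1, η * N, z] G : R) := by
    intro y t
    rw [MvPolynomial.map_aeval, MvPolynomial.coe_eval₂Hom, MvPolynomial.eval]
    rw [MvPolynomial.coe_eval₂Hom]
    congr 1
    · ext1 x
      simp [MvPolynomial.algebraMap_eq]
    · funext i
      fin_cases i <;> simp [η, z, R, div_mul_cancel₀ _ hNC]
  have hGη : MvPolynomial.aeval ![1, η * N, z] G ≠ (0 : R) := fun h0 =>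
    hH0 (eq_zero_of_eval_chart (hlim.isHomogeneous hF) fun y t => by rw [heval, h0, map_zero])
  -- The same series has the limit `G` as leading coefficient, after clearing `t^k = s^(N k)`, and
  -- the product found from the factorization. Leading coefficients are unique, so they coincide.
  have hprod' : PowerSeries.HasLead (N * k) (MvPolynomial.aeval ![1, η * N, z] G)
      (Ψ (subst F (typeVGerm f a b c))) := by
    refine ⟨Ψ H, ?_, hΨ0 H⟩
    rw [hkH, map_mul]
    congr 1
    simp [hΨdef, pow_mul]
  have hmain := (hprod'.unique hprod hGη hL0).2
  -- The divisions by `N ^ 2` and `N` come from `η = y / N`.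
  refine ⟨G, s'.map (PowerSeries.coeff c'), κ, p j₀ * (j₀ * (N - j₀) / 2) / N ^ 2, B₀ / N, hlim, hκ,
    ?_, ?_, ?_⟩
  · refine div_ne_zero (mul_ne_zero hpj₀ (div_ne_zero (mul_ne_zero (Nat.cast_ne_zero.mpr hj₀0) ?_)
      two_ne_zero)) (pow_ne_zero _ hNC)
    rw [sub_ne_zero]
    exact_mod_cast hj₀N.symm
  · intro y t
    rw [heval, hmain, map_mul, map_multiset_prod, Multiset.map_map, Multiset.map_map]
    congr 1
    · simp [R, MvPolynomial.algebraMap_eq]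
    · congr 1
      refine Multiset.map_congr rfl fun h _ => ?_
      simp [hqdef, η, z, R, MvPolynomial.algebraMap_eq]
      field_simp
  · intro x
    have htr : ∀ g h, PowerSeries.toPuiseux hN h = g →
        ((∀ j < c', PowerSeries.coeff j h = PowerSeries.coeff j pt) ↔
          HahnSeries.truncLT C g = HahnSeries.truncLT C f) := by
      rintro _ h rfl
      have hfh : PowerSeries.toPuiseux hN (PowerSeries.ofPuiseux N f) = f :=
        PowerSeries.toPuiseux_ofPuiseux hN (hint f hf)
      constructor
      · intro H
        ext l
        rw [HahnSeries.coeff_truncLT, HahnSeries.coeff_truncLT]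
        split_ifs with hl
        · by_cases hn : ∃ n : ℕ, l * N = n
          · obtain ⟨n, hn⟩ := hn
            have hln : l = n / N := by rw [← hn, mul_div_cancel_right₀ _ hNQ]
            have hnc : n < c' := by
              rw [← hCc', hln, div_lt_div_iff_of_pos_right (Nat.cast_pos.mpr hN)] at hl
              exact_mod_cast hl
            rw [hln, PowerSeries.coeff_toPuiseux_div, H n hnc, hptcoeff, if_pos hnc]
          · push Not at hn
            rw [PowerSeries.coeff_toPuiseux_eq_zero hN _ hn]
            conv_rhs => rw [← hfh]
            rw [PowerSeries.coeff_toPuiseux_eq_zero hN _ hn]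
        · rfl
      · intro H j hj
        have hjC : (j : ℚ) / N < C := by
          rw [← hCc', div_lt_div_iff_of_pos_right (Nat.cast_pos.mpr hN)]
          exact_mod_cast hj
        have := congrArg (fun x => x.coeff ((j : ℚ) / N)) H
        simp only [HahnSeries.coeff_truncLT, if_pos hjC, PowerSeries.coeff_toPuiseux_div] at this
        rw [this, hptcoeff, if_pos hj]
    rw [Multiset.mem_map]
    constructor
    · rintro ⟨h, hh, rfl⟩
      obtain ⟨hhs, hhm⟩ := Multiset.mem_filter.mp hh
      set g := PowerSeries.toPuiseux hN h with hg
      have htrunc := (htr g h rfl).mp hhm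
      have hlt : ∀ l < C, g.coeff l = f.coeff l := by
        intro l hl
        have := congrArg (fun x => x.coeff l) htrunc
        simpa only [HahnSeries.coeff_truncLT, if_pos hl] using this
      have hg0 : g ≠ 0 := by
        intro h0
        have := hlt _ hV.order_lt
        rw [h0, HahnSeries.coeff_zero] at this
        exact hord this.symm
      refine ⟨g, (isTangentBranch_toPuiseux_iff hN h).mpr ⟨hg0, ?_, ?_⟩, htrunc, ?_⟩
      · by_contra! hle
        have h1 := hlt g.order (hle.trans_lt (hf.one_lt_order.trans hV.order_lt))
        rw [hf1 _ hle, HahnSeries.coeff_order_eq_zero] at h1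
        exact hg0 h1
      · rw [hfact, Polynomial.eval_mul, Polynomial.eval_multiset_prod, Multiset.map_map,
          Multiset.prod_eq_zero (Multiset.mem_map.mpr ⟨h, hhs, by simp⟩), mul_zero]
      · rw [← hCc', hg, PowerSeries.coeff_toPuiseux_div]
    · rintro ⟨g, hg, hgf, rfl⟩
      have hgh : PowerSeries.toPuiseux hN (PowerSeries.ofPuiseux N g) = g :=
        PowerSeries.toPuiseux_ofPuiseux hN (hint g hg)
      set h := PowerSeries.ofPuiseux N g
      refine ⟨h, Multiset.mem_filter.mpr ⟨?_, (htr g h hgh).mpr hgf⟩, ?_⟩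
      · have h1 := ((isTangentBranch_toPuiseux_iff (F := F) hN h).mp (by rwa [hgh])).2.2
        have hh0 : PowerSeries.constantCoeff h = 0 := by
          rw [← PowerSeries.coeff_zero_eq_constantCoeff_apply, ← PowerSeries.coeff_toPuiseux_div hN,
            hgh, Nat.cast_zero, zero_div]
          exact HahnSeries.coeff_eq_zero_of_lt_order (zero_lt_one.trans hg.one_lt_order)
        rw [hfact, Polynomial.eval_mul, Polynomial.eval_mul, Polynomial.eval_C,
          Polynomial.eval_multiset_prod, Multiset.map_map, mul_eq_zero, mul_eq_zero] at h1
        rcases h1 with (h1 | h1) | h1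
        · exact absurd h1 (pow_ne_zero _ PowerSeries.X_ne_zero)
        · refine absurd ?_ hQ
          have h2 := congrArg PowerSeries.constantCoeff h1
          rwa [← Polynomial.eval₂_id, Polynomial.hom_eval₂, hh0, Polynomial.eval₂_at_zero,
            map_zero] at h2
        · rw [Multiset.prod_eq_zero_iff, Multiset.mem_map] at h1
          obtain ⟨h', hh', h0⟩ := h1
          have : h = h' := by simpa [sub_eq_zero] using h0
          rwa [this]
      · rw [← PowerSeries.coeff_toPuiseux_div hN, hgh, hCc']


/-! ### Orbits -/

/-- A constant invertible substitution commutes with clearing `t` and setting `t = 0`, so the whole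
orbit of a lift centre consists of lift centres. -/
theorem IsLimit.mul {F G : MvPolynomial (Fin 3) ℂ} {α : Matrix (Fin 3) (Fin 3) ℂ[X]}
    (h : IsLimit F α G) (g : GL (Fin 3) ℂ) :
    IsLimit F (α * (g : Mat).map Polynomial.C) (subst G (g : Mat)) := by
  obtain ⟨hG, k, H, hk, rfl⟩ := h
  refine ⟨subst_ne_zero hG g, k, MvPolynomial.aeval (rowForm ((g : Mat).map Polynomial.C)) H,
    ?_, ?_⟩
  · rw [← aeval_rowForm_subst, hk, map_mul, MvPolynomial.aeval_C, MvPolynomial.algebraMap_eq]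
  · rw [subst_eq, MvPolynomial.map_aeval, MvPolynomial.aeval_def, MvPolynomial.eval₂_map,
      MvPolynomial.coe_eval₂Hom]
    congr 1
    · ext x <;> simp [MvPolynomial.algebraMap_eq]
    · funext i
      rw [map_rowForm]
      congr 1
      ext i j
      simp

/-- For `t ≠ 0` the form `H(t)` is proportional to `F ∘ α(t)`, and a bihomogeneous polynomial that
is nonzero at `t = 0` is nonzero for general `t`. -/
theorem mem_closure_graph {F : Form d} {α : Matrix (Fin 3) (Fin 3) ℂ[X]}
    {G : MvPolynomial (Fin 3) ℂ} (h : IsLimit F α G) {q : Ambient d}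
    (hq : Represents q (α.map (Polynomial.eval 0)) G) : q ∈ closure (graph F) := by
  obtain ⟨hG, k, H, hk, rfl⟩ := h
  have hsp : ∀ t : ℂ, coords (α.map (Polynomial.eval t)) (H.map (Polynomial.evalRingHom t)) =
      fun i => Polynomial.eval t (famCoords α H i) := by
    intro t
    funext i
    cases i <;> simp [coords, famCoords, MvPolynomial.coeff_map]
  rw [mem_closure_iff_basicOpen]
  intro P n hP hqP
  replace hqP := (hq.eval_ne_zero_iff hP).mp hqP
  set p : ℂ[X] := MvPolynomial.aeval (famCoords α H) P with hp
  have hpt : ∀ t, p.eval t = MvPolynomial.eval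
      (coords (α.map (Polynomial.eval t)) (H.map (Polynomial.evalRingHom t))) P := by
    intro t
    rw [hsp, hp, ← Polynomial.coe_evalRingHom, MvPolynomial.map_aeval, MvPolynomial.eval,
      MvPolynomial.coe_eval₂Hom, MvPolynomial.coe_eval₂Hom]
    congr 1
    ext1 x
    simp
  obtain ⟨hα0, hH0⟩ := hq.ne_zero
  obtain ⟨i, j, hij⟩ : ∃ i j, (α i j).eval 0 ≠ 0 := by
    by_contra! hcon
    exact hα0 (by ext i j; simpa using hcon i j)
  obtain ⟨m, hm⟩ := MvPolynomial.ne_zero_iff.mp hH0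
  rw [MvPolynomial.coeff_map] at hm
  -- One polynomial collects all open conditions on `t`; its factor `X` imposes `t ≠ 0`.
  have hne : p * α i j * H.coeff m * Polynomial.X ≠ 0 := by
    refine mul_ne_zero (fun h0 => ?_) Polynomial.X_ne_zero
    have h1 := congrArg (Polynomial.eval 0) h0
    rw [Polynomial.eval_mul, Polynomial.eval_mul, hpt, Polynomial.eval_zero] at h1
    exact mul_ne_zero (mul_ne_zero hqP hij) hm h1
  obtain ⟨t, ht⟩ : ∃ t, (p * α i j * H.coeff m * Polynomial.X).eval t ≠ 0 := by
    by_contra! hcon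
    exact hne (Polynomial.funext fun t => by rw [hcon, Polynomial.eval_zero])
  simp only [Polynomial.eval_mul, Polynomial.eval_X, mul_ne_zero_iff] at ht
  obtain ⟨⟨⟨ht1, ht2⟩, ht3⟩, ht4⟩ := ht
  have hsub : subst F (α.map (Polynomial.eval t)) = t ^ k • H.map (Polynomial.evalRingHom t) := by
    have h1 := congrArg (MvPolynomial.map (Polynomial.evalRingHom t)) hk
    rw [map_subst _ (by ext x; simp), map_mul, MvPolynomial.map_C] at h1
    rw [MvPolynomial.smul_eq_C_mul]
    simpa using h1
  have hHt : H.map (Polynomial.evalRingHom t) ≠ 0 := fun h0 => ht3 (by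
    have := congrArg (MvPolynomial.coeff m) h0
    rwa [MvPolynomial.coeff_map] at this)
  obtain ⟨q', hq'⟩ := exists_represents (d := d) (A := α.map (Polynomial.eval t))
    (G := subst F (α.map (Polynomial.eval t)))
    (fun h0 => ht2 (by simpa using congrFun (congrFun h0 i) j))
    (by rw [hsub]; exact smul_ne_zero (pow_ne_zero _ ht4) hHt) (isHomogeneous_subst F.2 _)
  refine ⟨q', ?_, _, hq'⟩
  have h2 := hq'.smul one_ne_zero (inv_ne_zero (pow_ne_zero k ht4))
  rw [hsub, smul_smul, inv_mul_cancel₀ (pow_ne_zero k ht4), one_smul, one_smul] at h2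
  refine (h2.eval_ne_zero_iff hP).mpr ?_
  rwa [← hpt]

theorem Represents.exists_smul {q : Ambient d} {A A' : Mat} {G G' : MvPolynomial (Fin 3) ℂ}
    (h : Represents q A G) (h' : Represents q A' G') :
    ∃ r s : ℂ, r ≠ 0 ∧ s ≠ 0 ∧ A' = r • A ∧ G' = s • G := by
  obtain ⟨r, s, hr, hs, hA, hG, -⟩ := exists_repCoords_eq h
  obtain ⟨r', s', hr', hs', hA', hG', -⟩ := exists_repCoords_eq h'
  refine ⟨r'⁻¹ * r, s'⁻¹ * s, mul_ne_zero (inv_ne_zero hr') hr, mul_ne_zero (inv_ne_zero hs') hs,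
    ?_, ?_⟩
  · rw [mul_smul, ← hA, hA', smul_smul, inv_mul_cancel₀ hr', one_smul]
  · rw [mul_smul, ← hG, hG', smul_smul, inv_mul_cancel₀ hs', one_smul]

theorem mem_orbit_iff {q q' : Ambient d} {A : Mat} {G : MvPolynomial (Fin 3) ℂ}
    (h : Represents q A G) :
    q' ∈ orbit q ↔ ∃ g : GL (Fin 3) ℂ, Represents q' (A * (g : Mat)) (subst G (g : Mat)) := by
  refine ⟨?_, fun ⟨g, hg⟩ => ⟨A, G, h, g, hg⟩⟩
  rintro ⟨A', G', h', g, hg⟩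
  obtain ⟨r, s, hr, hs, rfl, rfl⟩ := h.exists_smul h'
  refine ⟨g, ?_⟩
  have := hg.smul (inv_ne_zero hr) (inv_ne_zero hs)
  rwa [subst_smul_left, smul_smul, inv_mul_cancel₀ hs, one_smul, Matrix.smul_mul, smul_smul,
    inv_mul_cancel₀ hr, one_smul] at this

theorem exists_mem_orbit {q : Ambient d} {A : Mat} {G : MvPolynomial (Fin 3) ℂ}
    (h : Represents q A G) (g : GL (Fin 3) ℂ) :
    ∃ q' ∈ orbit q, Represents q' (A * (g : Mat)) (subst G (g : Mat)) := by
  obtain ⟨hA, hG⟩ := h.ne_zero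
  have hAg : A * (g : Mat) ≠ 0 := fun h0 => hA (by
    have := congrArg (· * ((g⁻¹ : GL (Fin 3) ℂ) : Mat)) h0
    simpa [mul_assoc, ← Units.val_mul] using this)
  obtain ⟨q', hq'⟩ := exists_represents hAg (subst_ne_zero hG g)
    (isHomogeneous_subst h.isHomogeneous (g : Mat))
  exact ⟨q', (mem_orbit_iff h).mpr ⟨g, hq'⟩, hq'⟩

theorem mem_orbit_self {q : Ambient d} : q ∈ orbit q := by
  have h := represents_rep q
  rw [mem_orbit_iff h]
  exact ⟨1, by rwa [Units.val_one, mul_one, subst_one]⟩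

theorem orbit_subset_PNC {F : Form d} {α : Matrix (Fin 3) (Fin 3) ℂ[X]}
    {G : MvPolynomial (Fin 3) ℂ} (h : IsLimit F α G) {q : Ambient d}
    (hq : Represents q (α.map (Polynomial.eval 0)) G)
    (h0 : subst (F : MvPolynomial (Fin 3) ℂ) (α.map (Polynomial.eval 0)) = 0) :
    orbit q ⊆ PNC F := by
  intro q' hq'
  obtain ⟨g, hg⟩ := (mem_orbit_iff hq).mp hq'
  constructor
  · refine mem_closure_graph (h.mul g) ?_
    convert hg using 1
    have : (α * (g : Mat).map Polynomial.C).map (Polynomial.evalRingHom 0) =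
        α.map (Polynomial.evalRingHom 0) * ((g : Mat).map Polynomial.C).map
          (Polynomial.evalRingHom 0) := Matrix.map_mul
    simp only [Polynomial.coe_evalRingHom] at this
    rw [this]
    congr 1
    ext i j
    simp
  · obtain ⟨r, s, -, -, hA, -, -⟩ := exists_repCoords_eq hg
    rw [hA, subst_smul F.2, ← subst_subst, h0, subst_zero_left, mul_zero]

/-- The orbit is parametrized by the matrices with `det ≠ 0` in an affine space, where finitely many
nonzero polynomials have a common nonvanishing point. -/
theorem isIrreducible_orbit (q : Ambient d) : IsIrreducible (orbit q) := by
  refine ⟨⟨q, mem_orbit_self⟩, isPreirreducible_of_basicOpen fun P Q a b hP hQ hPne hQne => ?_⟩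
  have hrep := represents_rep q
  set A := q.1.rep
  set G : MvPolynomial (Fin 3) ℂ := ((q.2.rep : Form d) : MvPolynomial (Fin 3) ℂ)
  set Γ : Matrix (Fin 3) (Fin 3) (MvPolynomial (Fin 3 × Fin 3) ℂ) :=
    Matrix.of fun i j => MvPolynomial.X (i, j) with hΓ
  have hΓv : ∀ g : Mat, Γ.map (MvPolynomial.eval fun p => g p.1 p.2) = g := by
    intro g
    ext i j
    simp [hΓ]
  set R : CoordRing → MvPolynomial (Fin 3 × Fin 3) ℂ := fun P =>
    MvPolynomial.aeval (famCoords (A.map MvPolynomial.C * Γ) (subst G Γ)) P with hR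
  have hRv : ∀ (P : CoordRing) (g : Mat), MvPolynomial.eval (fun p => g p.1 p.2) (R P) =
      MvPolynomial.eval (coords (A * g) (subst G g)) P := by
    intro P g
    have h1 : (A.map MvPolynomial.C * Γ).map
        (MvPolynomial.eval fun p : Fin 3 × Fin 3 => g p.1 p.2) = A * g := by
      rw [Matrix.map_mul, hΓv]
      congr 1
      ext i j
      simp
    have h2 : (subst G Γ).map (MvPolynomial.eval fun p => g p.1 p.2) = subst G g := by
      rw [map_eval_subst, hΓv]
    rw [← h1, ← h2, coords_specialize, hR]
    dsimp only
    rw [MvPolynomial.map_aeval, MvPolynomial.coe_eval₂Hom, MvPolynomial.eval,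
      MvPolynomial.coe_eval₂Hom]
    congr 1
    ext1 x
    simp [MvPolynomial.algebraMap_eq]
  have hRne : ∀ P n, IsBihomogeneous P n → (orbit q ∩ basicOpen d P).Nonempty → R P ≠ 0 := by
    rintro P n hP ⟨x, hx, hxP⟩ h0
    obtain ⟨g, hg⟩ := (mem_orbit_iff hrep).mp hx
    refine (hg.eval_ne_zero_iff hP).mp hxP ?_
    rw [← hRv, h0, map_zero]
  have hdet : Γ.det ≠ 0 := by
    intro h0
    have := congrArg (MvPolynomial.eval fun p => (1 : Mat) p.1 p.2) h0
    rw [RingHom.map_det, RingHom.mapMatrix_apply, hΓv, Matrix.det_one, map_zero] at this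
    exact one_ne_zero this
  have hprod : R P * R Q * Γ.det ≠ 0 :=
    mul_ne_zero (mul_ne_zero (hRne P a hP hPne) (hRne Q b hQ hQne)) hdet
  obtain ⟨v, hv⟩ : ∃ v, MvPolynomial.eval v (R P * R Q * Γ.det) ≠ 0 := by
    by_contra! hcon
    exact hprod (MvPolynomial.funext fun v => by rw [hcon, map_zero])
  set g : Mat := Matrix.of fun i j => v (i, j) with hg
  have hgv : v = fun p => g p.1 p.2 := by
    funext p
    simp [hg]
  rw [hgv, map_mul, map_mul, RingHom.map_det, RingHom.mapMatrix_apply, hΓv, mul_ne_zero_iff,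
    mul_ne_zero_iff, hRv, hRv] at hv
  obtain ⟨⟨hvP, hvQ⟩, hvd⟩ := hv
  let g' : GL (Fin 3) ℂ := Matrix.GeneralLinearGroup.mkOfDetNeZero g hvd
  obtain ⟨x, hx, hxr⟩ := exists_mem_orbit hrep g'
  exact ⟨x, hx, (hxr.eval_ne_zero_iff hP).mpr hvP, (hxr.eval_ne_zero_iff hQ).mpr hvQ⟩

/-- The limit is unique, and the orbit is irreducible and contained in the closed cone, so only
maximality remains to be tested. -/
theorem determinesComponent_iff {F : Form d} {α : Matrix (Fin 3) (Fin 3) ℂ[X]}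
    {G : MvPolynomial (Fin 3) ℂ} (h : IsLimit F α G) {q : Ambient d}
    (hq : Represents q (α.map (Polynomial.eval 0)) G)
    (h0 : subst (F : MvPolynomial (Fin 3) ℂ) (α.map (Polynomial.eval 0)) = 0) :
    DeterminesComponent F α ↔
      ∀ W ⊆ PNC F, IsIrreducible W → orbit q ⊆ W → W ⊆ closure (orbit q) := by
  have hsub := orbit_subset_PNC h hq h0
  have hirr := isIrreducible_orbit q
  have h1 : DeterminesComponent F α ↔ ∃ Z ∈ irreducibleComponents (PNC F),
      (Subtype.val '' Z : Set (Ambient d)) = closure (orbit q) := by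
    constructor
    · rintro ⟨q', ⟨G', hG', hq'⟩, hZ⟩
      rw [h.unique hG'] at hq
      rwa [hq.eq hq']
    · exact fun hZ => ⟨q, ⟨G, h, hq⟩, hZ⟩
  rw [h1, exists_mem_irreducibleComponents_iff]
  constructor
  · rintro ⟨-, -, hmax⟩ W hW hWirr hle
    refine subset_closure.trans (hmax (closure W) (closure_minimal hW (isClosed_PNC F)) ?_
      (closure_mono hle))
    exact ⟨hWirr.1.mono subset_closure, hWirr.2.closure⟩
  · intro hmax
    refine ⟨closure_minimal hsub (isClosed_PNC F),
      ⟨hirr.1.mono subset_closure, hirr.2.closure⟩, fun W hW hWirr hle => ?_⟩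
    exact hmax W hW hWirr (subset_closure.trans hle)

end PlaneCurve


/-! ### Recovering a pencil of parabolas from its product -/

section algebraic

variable {R K : Type} [CommRing R] [IsDomain R] [Field K] [Algebra R K]

/-- The monic product has coefficients in the relative algebraic closure of `R`, and coefficients of
its monic divisors are integral over that closure. -/
theorem isAlgebraic_coeff_of_prod_quadratic [FaithfulSMul R K] {a l : K} (hl : l ≠ 0)
    {s : Multiset K}
    (h : ∀ i, IsAlgebraic R ((Polynomial.C l * (s.map fun g =>
      Polynomial.X ^ 2 + Polynomial.C a * Polynomial.X + Polynomial.C g).prod).coeff i))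
    {g : K} (hg : g ∈ s) : IsAlgebraic R a ∧ IsAlgebraic R g := by
  set P := (s.map fun g => Polynomial.X ^ 2 + Polynomial.C a * Polynomial.X + Polynomial.C g).prod
    with hP
  have hq : ∀ g : K, (Polynomial.X ^ 2 + Polynomial.C a * Polynomial.X + Polynomial.C g).Monic :=
    fun g => by monicity!
  have hPm : P.Monic := Polynomial.monic_multiset_prod_of_monic _ _ fun g _ => hq g
  have hl' : IsAlgebraic R l := by
    have := h P.natDegree
    rwa [Polynomial.coeff_C_mul, hPm.coeff_natDegree, mul_one] at this
  have hPc : ∀ i, IsAlgebraic R (P.coeff i) := fun i => by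
    have := hl'.inv.mul (h i)
    rwa [Polynomial.coeff_C_mul, inv_mul_cancel_left₀ hl] at this
  have hlift : P ∈ Polynomial.lifts (algebraMap (Subalgebra.algebraicClosure R K) K) := by
    rw [Polynomial.lifts_iff_coeff_lifts]
    exact fun i => ⟨⟨P.coeff i, hPc i⟩, rfl⟩
  obtain ⟨P', hP', -, hm'⟩ := Polynomial.lifts_and_natDegree_eq_and_monic hlift hPm
  have hint := Polynomial.isIntegral_coeff_of_dvd P' _ hm' (hq g)
    (by rw [hP']; exact Multiset.dvd_prod (Multiset.mem_map_of_mem _ hg))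
  have htr : ∀ x : K, IsIntegral (Subalgebra.algebraicClosure R K) x → IsAlgebraic R x := by
    intro x hx
    have : Algebra.IsAlgebraic R (Subalgebra.algebraicClosure R K) := ⟨fun x => by
      have h1 : IsAlgebraic R (x : K) := x.2
      exact (isAlgebraic_algebraMap_iff (A := K) Subtype.val_injective).mp h1⟩
    exact hx.isAlgebraic.restrictScalars R
  refine ⟨htr _ ?_, htr _ ?_⟩
  · simpa [Polynomial.coeff_X, Polynomial.coeff_C] using hint 1
  · simpa using hint 0

/-- The coefficients of a pencil of parabolas, restricted to a line, are algebraic over the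
coefficients of their product. -/
theorem isAlgebraic_of_parabolas [FaithfulSMul R K] [Algebra ℂ R] [Algebra ℂ K]
    [IsScalarTower ℂ R K] {δ : Multiset ℂ} {A B : ℂ} {l μ ν ρ : K} (hA : A ≠ 0) (hl : l ≠ 0)
    (hμ : μ ≠ 0)
    (h : ∀ i, IsAlgebraic R ((Polynomial.C l * (δ.map fun e =>
      (Polynomial.C ρ + Polynomial.C ν * Polynomial.X) +
        algebraMap ℂ K[X] A * (Polynomial.C μ * Polynomial.X) ^ 2 +
        algebraMap ℂ K[X] B * (Polynomial.C μ * Polynomial.X) -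
        algebraMap ℂ K[X] e).prod).coeff i))
    {e e' : ℂ} (he : e ∈ δ) (he' : e' ∈ δ) (hne : e ≠ e') :
    IsAlgebraic R μ ∧ IsAlgebraic R ν ∧ IsAlgebraic R ρ := by
  have hconst : ∀ x : ℂ, IsAlgebraic R (algebraMap ℂ K x) := fun x => by
    rw [IsScalarTower.algebraMap_apply ℂ R K]
    exact isAlgebraic_algebraMap _
  set t : K := algebraMap ℂ K A * μ ^ 2 with ht
  have hA' : algebraMap ℂ K A ≠ 0 := (map_ne_zero _).mpr hA
  have ht0 : t ≠ 0 := mul_ne_zero hA' (pow_ne_zero 2 hμ)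
  set a : K := (ν + algebraMap ℂ K B * μ) / t with ha
  -- On the line each parabola is `t` times a monic quadratic. Only the constant terms `(ρ - e) / t`
  -- depend on `e`.
  have hfac : ∀ e : ℂ, (Polynomial.C ρ + Polynomial.C ν * Polynomial.X) +
        algebraMap ℂ K[X] A * (Polynomial.C μ * Polynomial.X) ^ 2 +
        algebraMap ℂ K[X] B * (Polynomial.C μ * Polynomial.X) - algebraMap ℂ K[X] e =
      Polynomial.C t * (Polynomial.X ^ 2 + Polynomial.C a * Polynomial.X +
        Polynomial.C ((ρ - algebraMap ℂ K e) / t)) := by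
    intro e
    have h1 : Polynomial.C t * Polynomial.C a = Polynomial.C (ν + algebraMap ℂ K B * μ) := by
      rw [← Polynomial.C_mul, ha, mul_div_cancel₀ _ ht0]
    have h2 : Polynomial.C t * Polynomial.C ((ρ - algebraMap ℂ K e) / t) =
        Polynomial.C (ρ - algebraMap ℂ K e) := by
      rw [← Polynomial.C_mul, mul_div_cancel₀ _ ht0]
    have h3 : ∀ g : K[X], Polynomial.C t * (Polynomial.X ^ 2 + Polynomial.C a * Polynomial.X + g) =
        Polynomial.C t * Polynomial.X ^ 2 + Polynomial.C t * Polynomial.C a * Polynomial.X +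
          Polynomial.C t * g := fun g => by ring
    rw [h3, h1, h2, ht]
    simp only [Polynomial.algebraMap_apply, map_add, map_sub, map_mul, map_pow]
    ring
  have hprod : (δ.map fun e => (Polynomial.C ρ + Polynomial.C ν * Polynomial.X) +
        algebraMap ℂ K[X] A * (Polynomial.C μ * Polynomial.X) ^ 2 +
        algebraMap ℂ K[X] B * (Polynomial.C μ * Polynomial.X) - algebraMap ℂ K[X] e).prod =
      Polynomial.C (t ^ Multiset.card δ) * ((δ.map fun e => (ρ - algebraMap ℂ K e) / t).map fun g =>
        Polynomial.X ^ 2 + Polynomial.C a * Polynomial.X + Polynomial.C g).prod := by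
    rw [Multiset.map_congr rfl fun e _ => hfac e, Multiset.prod_map_mul, Multiset.map_const',
      Multiset.prod_replicate, Multiset.map_map, map_pow]
    rfl
  rw [hprod, ← mul_assoc, ← Polynomial.C_mul] at h
  have key := fun {g} hg => isAlgebraic_coeff_of_prod_quadratic (g := g)
    (mul_ne_zero hl (pow_ne_zero (Multiset.card δ) ht0)) h hg
  obtain ⟨h1, h2⟩ := key (Multiset.mem_map_of_mem _ he)
  obtain ⟨-, h3⟩ := key (Multiset.mem_map_of_mem _ he')
  have hne' : algebraMap ℂ K (e' - e) ≠ 0 := (map_ne_zero _).mpr (sub_ne_zero.mpr hne.symm)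
  -- Here two different members are needed: their constant terms differ by `(e' - e) / t`, which
  -- determines `t`.
  have ht' : IsAlgebraic R t := by
    have h4 := ((h2.sub h3).inv).mul (hconst (e' - e))
    have h5 : ((ρ - algebraMap ℂ K e) / t - (ρ - algebraMap ℂ K e') / t)⁻¹ *
        algebraMap ℂ K (e' - e) = t := by
      have h6 : (ρ - algebraMap ℂ K e) / t - (ρ - algebraMap ℂ K e') / t =
          algebraMap ℂ K (e' - e) / t := by
        rw [map_sub]
        ring
      rw [h6]
      field_simp
    rwa [h5] at h4
  have hμ' : IsAlgebraic R μ := by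
    refine IsAlgebraic.of_pow (n := 2) two_pos ?_
    have h4 := (hconst A).inv.mul ht'
    rwa [ht, inv_mul_cancel_left₀ hA'] at h4
  refine ⟨hμ', ?_, ?_⟩
  · have h4 := (ht'.mul h1).sub ((hconst B).mul hμ')
    rwa [ha, mul_div_cancel₀ _ ht0, add_sub_cancel_right] at h4
  · have h4 := (ht'.mul h2).add (hconst e)
    rwa [mul_div_cancel₀ _ ht0, sub_add_cancel] at h4

theorem isAlgebraic_coeff_aeval {σ : Type} {H : MvPolynomial σ K}
    (hH : ∀ l, H.coeff l ∈ (algebraMap R K).range) {w : σ → K[X]}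
    (hw : ∀ i, w i ∈ (Polynomial.mapRingHom (algebraMap R K)).range) (k : ℕ) :
    IsAlgebraic R ((MvPolynomial.aeval w H).coeff k) := by
  have h1 : MvPolynomial.aeval w H ∈ (Polynomial.mapRingHom (algebraMap R K)).range := by
    rw [MvPolynomial.aeval_def, MvPolynomial.eval₂_eq]
    refine sum_mem fun l _ => mul_mem ?_ (prod_mem fun i _ => pow_mem (hw i) _)
    obtain ⟨r, hr⟩ := hH l
    exact ⟨Polynomial.C r, by rw [← hr]; simp⟩
  obtain ⟨p, hp⟩ := h1
  rw [← hp, Polynomial.coe_mapRingHom, Polynomial.coeff_map]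
  exact isAlgebraic_algebraMap _

end algebraic

/-! ### Dimension of the orbit of the limit -/

namespace PlaneCurve

variable {d : ℕ}

theorem aeval_subst {K L : Type} [CommRing K] [CommRing L] [Algebra ℂ K] [Algebra K L] [Algebra ℂ L]
    [IsScalarTower ℂ K L] (G : MvPolynomial (Fin 3) ℂ) (A : Matrix (Fin 3) (Fin 3) K)
    (w : Fin 3 → L) : MvPolynomial.aeval w (subst G A) =
      MvPolynomial.aeval (fun i => ∑ j, algebraMap K L (A i j) * w j) G := by
  rw [subst_eq, ← AlgHom.coe_toRingHom, MvPolynomial.map_aeval, MvPolynomial.coe_eval₂Hom,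
    MvPolynomial.aeval_def (R := ℂ)]
  congr 1
  · ext1 x
    rw [RingHom.comp_apply, MvPolynomial.algebraMap_apply, AlgHom.coe_toRingHom,
      MvPolynomial.aeval_C, IsScalarTower.algebraMap_apply ℂ K L]
  · funext i
    simp [rowForm]

theorem eval_subst (G : MvPolynomial (Fin 3) ℂ) (A : Mat) (w : Fin 3 → ℂ) :
    MvPolynomial.eval w (subst G A) = MvPolynomial.eval (fun i => ∑ j, A i j * w j) G := by
  have := aeval_subst G A w
  simpa only [MvPolynomial.aeval_eq_eval, Algebra.algebraMap_self, RingHom.id_apply] using this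

/-- The restriction of `G` to the chart `x = 1` is a union of parabolas of a pencil. -/
structure IsParabolas (G : MvPolynomial (Fin 3) ℂ) (δ : Multiset ℂ) (κ A B : ℂ) : Prop where
  kappa_ne : κ ≠ 0
  A_ne : A ≠ 0
  eval_eq : ∀ y z, MvPolynomial.eval ![1, y, z] G =
    κ * (δ.map fun e => z + A * y ^ 2 + B * y - e).prod

theorem IsParabolas.aeval_eq {G : MvPolynomial (Fin 3) ℂ} {δ : Multiset ℂ} {κ A B : ℂ}
    (h : IsParabolas G δ κ A B) {L : Type} [CommRing L] [Algebra ℂ L] (y z : L) :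
    MvPolynomial.aeval ![1, y, z] G = algebraMap ℂ L κ * (δ.map fun e =>
      z + algebraMap ℂ L A * y ^ 2 + algebraMap ℂ L B * y - algebraMap ℂ L e).prod := by
  have h1 : (MvPolynomial.aeval ![1, MvPolynomial.X 0, MvPolynomial.X 1] G :
      MvPolynomial (Fin 2) ℂ) = MvPolynomial.C κ * (δ.map fun e =>
        MvPolynomial.X 1 + MvPolynomial.C A * MvPolynomial.X 0 ^ 2 +
          MvPolynomial.C B * MvPolynomial.X 0 - MvPolynomial.C e).prod := by
    apply MvPolynomial.funext
    intro v
    have h2 : MvPolynomial.eval v (MvPolynomial.aeval ![1, MvPolynomial.X 0, MvPolynomial.X 1] G :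
        MvPolynomial (Fin 2) ℂ) = MvPolynomial.eval ![1, v 0, v 1] G := by
      rw [MvPolynomial.map_aeval, MvPolynomial.coe_eval₂Hom, MvPolynomial.eval]
      change MvPolynomial.eval₂ _ _ G = MvPolynomial.eval₂ _ _ G
      congr 1
      · ext1 x
        simp [MvPolynomial.algebraMap_eq]
      · funext i
        fin_cases i <;> simp
    rw [h2, h.eval_eq, map_mul, MvPolynomial.eval_C, map_multiset_prod, Multiset.map_map]
    congr 2
    refine Multiset.map_congr rfl fun e _ => ?_
    simp
  have h3 := congrArg (MvPolynomial.aeval (R := ℂ) ![y, z]) h1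
  rw [MvPolynomial.comp_aeval_apply, map_mul, MvPolynomial.aeval_C, map_multiset_prod,
    Multiset.map_map] at h3
  convert h3 using 1
  · congr 2
    funext i
    fin_cases i <;> simp
  · congr 2
    refine Multiset.map_congr rfl fun e _ => ?_
    simp

/-- The matrix with the first row of `A`, and zeros elsewhere. -/
def firstRow {R : Type} [Zero R] (A : Matrix (Fin 3) (Fin 3) R) : Matrix (Fin 3) (Fin 3) R :=
  Matrix.of fun i j => if i = 0 then A 0 j else 0

theorem firstRow_map {R S : Type} [CommRing R] [CommRing S] (φ : R →+* S)
    (A : Matrix (Fin 3) (Fin 3) R) : (firstRow A).map φ = firstRow (A.map φ) := by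
  ext i j
  simp [firstRow, apply_ite φ]

theorem firstRow_one_mul (A : Mat) : firstRow 1 * A = firstRow A := by
  ext i j
  rw [Matrix.mul_apply, Fin.sum_univ_three]
  fin_cases i <;> simp [firstRow]

/-- The generic matrix with first column `(1, 0, *)`. -/
def genericFlag : Matrix (Fin 3) (Fin 3) (MvPolynomial (Fin 7) ℂ) :=
  !![1, MvPolynomial.X 0, MvPolynomial.X 1;
    0, MvPolynomial.X 2, MvPolynomial.X 3;
    MvPolynomial.X 4, MvPolynomial.X 5, MvPolynomial.X 6]

theorem genericFlag_map {R : Type} [CommRing R] (φ : MvPolynomial (Fin 7) ℂ →+* R) :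
    genericFlag.map φ = !![1, φ (MvPolynomial.X 0), φ (MvPolynomial.X 1);
      0, φ (MvPolynomial.X 2), φ (MvPolynomial.X 3);
      φ (MvPolynomial.X 4), φ (MvPolynomial.X 5), φ (MvPolynomial.X 6)] := by
  ext i j
  fin_cases i <;> fin_cases j <;> simp [genericFlag]

theorem genericFlag_eval_one :
    genericFlag.map (MvPolynomial.eval ![0, 0, 1, 0, 0, 0, 1]) = (1 : Mat) := by
  rw [genericFlag_map]
  ext i j
  fin_cases i <;> fin_cases j <;> simp [MvPolynomial.eval_X]

variable {G : MvPolynomial (Fin 3) ℂ} {m : Fin 3 →₀ ℕ}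

theorem coeff_genericFlag_ne_zero (hm : G.coeff m ≠ 0) :
    (subst G genericFlag).coeff m ≠ 0 := by
  intro h
  apply hm
  have := congrArg (MvPolynomial.eval ![0, 0, 1, 0, 0, 0, 1]) h
  rwa [← MvPolynomial.coeff_map, map_eval_subst, genericFlag_eval_one, subst_one, map_zero] at this

/-- Invertible specializations of `genericFlag` act and give points of the orbit. For the lower
bound on its dimension this subfamily is enough. -/
theorem affIdeal_orbit_le_ker {q : Ambient d} (hq : Represents q (firstRow 1) G)
    (hm : G.coeff m ≠ 0) :
    affIdeal m (orbit q) ≤ RingHom.ker (famHom m (firstRow genericFlag) (subst G genericFlag)) := by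
  intro P hP
  have hdet : genericFlag.det ≠ 0 := by
    intro h0
    have := congrArg (MvPolynomial.eval ![0, 0, 1, 0, 0, 0, 1]) h0
    rw [RingHom.map_det, RingHom.mapMatrix_apply, genericFlag_eval_one, Matrix.det_one,
      map_zero] at this
    exact one_ne_zero this
  rw [RingHom.mem_ker, famHom_eq_zero_iff hdet (by simp [firstRow, genericFlag])
    (coeff_genericFlag_ne_zero hm)]
  intro v hvD _ hvm
  rw [RingHom.map_det, RingHom.mapMatrix_apply] at hvD
  rw [firstRow_map, map_eval_subst]
  rw [← MvPolynomial.coeff_map, map_eval_subst] at hvm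
  set A : Mat := genericFlag.map (MvPolynomial.eval v) with hA
  obtain ⟨x, hx, hxr⟩ := exists_mem_orbit hq (Matrix.GeneralLinearGroup.mkOfDetNeZero A hvD)
  change Represents x (firstRow 1 * A) (subst G A) at hxr
  rw [firstRow_one_mul] at hxr
  have h00 : firstRow A 0 0 ≠ 0 := by
    rw [hA, genericFlag_map]
    simp [firstRow]
  have := hP x hx ((hxr.mem_chart_iff m).mpr ⟨h00, hvm⟩)
  rwa [hxr.affCoords_eq m] at this

end PlaneCurve


namespace PlaneCurve

variable {d : ℕ} {G : MvPolynomial (Fin 3) ℂ} {m : Fin 3 →₀ ℕ} {δ : Multiset ℂ} {κ A B : ℂ}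

theorem isAlgebraic_fractionRing {τ R : Type} [CommRing R] [IsDomain R] [Algebra ℂ R]
    [Algebra R (FractionRing (MvPolynomial τ ℂ))]
    [IsScalarTower ℂ R (FractionRing (MvPolynomial τ ℂ))]
    (h : ∀ i, IsAlgebraic R (algebraMap (MvPolynomial τ ℂ) (FractionRing (MvPolynomial τ ℂ))
      (MvPolynomial.X i))) : Algebra.IsAlgebraic R (FractionRing (MvPolynomial τ ℂ)) := by
  have hpoly : ∀ p : MvPolynomial τ ℂ, IsAlgebraic R
      (algebraMap (MvPolynomial τ ℂ) (FractionRing (MvPolynomial τ ℂ)) p) := by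
    intro p
    induction p using MvPolynomial.induction_on with
    | C c =>
      rw [← MvPolynomial.algebraMap_eq, ← IsScalarTower.algebraMap_apply,
        IsScalarTower.algebraMap_apply ℂ R]
      exact isAlgebraic_algebraMap _
    | add p q hp hq => rw [map_add]; exact hp.add hq
    | mul_X p i hp => rw [map_mul]; exact hp.mul (h i)
  refine ⟨fun x => ?_⟩
  obtain ⟨p, q, -, rfl⟩ := IsFractionRing.div_surjective (MvPolynomial τ ℂ) x
  rw [div_eq_mul_inv]
  exact (hpoly p).mul (hpoly q).inv

/-- Since the first row is known, one can restrict to `(1 - ξ₀ s, s, 0)` and `(1 - ξ₁ s, 0, s)`,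
where the first linear form is 1, and apply `isAlgebraic_of_parabolas` to each. -/
theorem isAlgebraic_flag_entries {R K : Type} [CommRing R] [IsDomain R] [Field K] [Algebra R K]
    [FaithfulSMul R K] [Algebra ℂ R] [Algebra ℂ K] [IsScalarTower ℂ R K]
    (hG : IsParabolas G δ κ A B) {e e' : ℂ} (he : e ∈ δ) (he' : e' ∈ δ) (hne : e ≠ e')
    {ξ : Fin 7 → K} {l : K} (hl : l ≠ 0)
    (hH : ∀ k, (MvPolynomial.C l * subst G !![1, ξ 0, ξ 1; 0, ξ 2, ξ 3; ξ 4, ξ 5, ξ 6]).coeff k ∈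
      (algebraMap R K).range)
    (hu : ξ 0 ∈ (algebraMap R K).range) (hv : ξ 1 ∈ (algebraMap R K).range)
    (hξ2 : ξ 2 ≠ 0) (hξ3 : ξ 3 ≠ 0) (i : Fin 7) : IsAlgebraic R (ξ i) := by
  set Γ : Matrix (Fin 3) (Fin 3) K := !![1, ξ 0, ξ 1; 0, ξ 2, ξ 3; ξ 4, ξ 5, ξ 6] with hΓ
  have halg : ∀ x ∈ (algebraMap R K).range, IsAlgebraic R x := by
    rintro _ ⟨r, rfl⟩
    exact isAlgebraic_algebraMap _
  have hlin : ∀ ζ ∈ (algebraMap R K).range,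
      (1 - Polynomial.C ζ * Polynomial.X : K[X]) ∈
        (Polynomial.mapRingHom (algebraMap R K)).range := by
    rintro _ ⟨r, rfl⟩
    exact ⟨1 - Polynomial.C r * Polynomial.X, by simp⟩
  have hX : (Polynomial.X : K[X]) ∈ (Polynomial.mapRingHom (algebraMap R K)).range :=
    ⟨Polynomial.X, by simp⟩
  have hκ : l * algebraMap ℂ K κ ≠ 0 := mul_ne_zero hl ((map_ne_zero _).mpr hG.kappa_ne)
  have key : ∀ (w : Fin 3 → K[X]) (μ ν ρ : K),
      (∀ i, w i ∈ (Polynomial.mapRingHom (algebraMap R K)).range) → μ ≠ 0 →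
      (fun i => ∑ j, algebraMap K K[X] (Γ i j) * w j) =
        ![1, Polynomial.C μ * Polynomial.X, Polynomial.C ρ + Polynomial.C ν * Polynomial.X] →
      IsAlgebraic R μ ∧ IsAlgebraic R ν ∧ IsAlgebraic R ρ := by
    intro w μ ν ρ hw hμ hwΓ
    refine isAlgebraic_of_parabolas (B := B) hG.A_ne hκ hμ (fun i => ?_) he he' hne
    have h1 := isAlgebraic_coeff_aeval hH hw i
    rw [map_mul, MvPolynomial.aeval_C, aeval_subst, hwΓ, hG.aeval_eq, ← mul_assoc,
      IsScalarTower.algebraMap_apply ℂ K K[X] κ, ← map_mul] at h1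
    exact h1
  obtain ⟨h2, h5, h4⟩ := key ![1 - Polynomial.C (ξ 0) * Polynomial.X, Polynomial.X, 0] (ξ 2)
    (ξ 5 - ξ 4 * ξ 0) (ξ 4) (fun i => by
      fin_cases i
      · exact hlin _ hu
      · exact hX
      · exact zero_mem _) hξ2 (by
      funext i
      rw [Fin.sum_univ_three]
      fin_cases i <;> simp [hΓ]
      ring)
  obtain ⟨h3, h6, -⟩ := key ![1 - Polynomial.C (ξ 1) * Polynomial.X, 0, Polynomial.X] (ξ 3)
    (ξ 6 - ξ 4 * ξ 1) (ξ 4) (fun i => by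
      fin_cases i
      · exact hlin _ hv
      · exact zero_mem _
      · exact hX) hξ3 (by
      funext i
      rw [Fin.sum_univ_three]
      fin_cases i <;> simp [hΓ]
      ring)
  have h0 := halg _ hu
  have h1 := halg _ hv
  have h5' : IsAlgebraic R (ξ 5) := by
    have := h5.add (h4.mul h0)
    rwa [sub_add_cancel] at this
  have h6' : IsAlgebraic R (ξ 6) := by
    have := h6.add (h4.mul h1)
    rwa [sub_add_cancel] at this
  fin_cases i
  exacts [h0, h1, h2, h3, h4, h5', h6']

/-- The function field of the affine space of the entries of `genericFlag`. -/
abbrev FlagField := FractionRing (MvPolynomial (Fin 7) ℂ)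

/-- The orbit of the union of at least two conics of the pencil is at least seven-dimensional. -/
theorem seven_le_trdeg_orbit {q : Ambient d} (hq : Represents q (firstRow 1) G)
    (hm : G.coeff m ≠ 0) (hG : IsParabolas G δ κ A B) {e e' : ℂ} (he : e ∈ δ) (he' : e' ∈ δ)
    (hne : e ≠ e') : 7 ≤ Algebra.trdeg ℂ (CoordRing ⧸ affIdeal m (orbit q)) := by
  refine le_trans ?_ (le_trdeg_of_le_ker_famHom (affIdeal_orbit_le_ker hq hm))
  set φ := famHom m (firstRow genericFlag) (subst G genericFlag) with hφ
  set ι := algebraMap (MvPolynomial (Fin 7) ℂ) FlagField with hι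
  have hι0 : ∀ x, ι x = 0 ↔ x = 0 := fun x => map_eq_zero_iff _ (IsFractionRing.injective _ _)
  -- The function field in seven variables is algebraic over the coordinates of the family, so these
  -- already have transcendence degree 7. The factor `l` is the normalization of the coefficient at
  -- `m` in the chart.
  have hK : Algebra.IsAlgebraic φ.range FlagField := isAlgebraic_fractionRing fun i => by
    refine isAlgebraic_flag_entries hG he he' hne (ξ := fun i => ι (MvPolynomial.X i))
      (l := (ι ((subst G genericFlag).coeff m))⁻¹) ?_ (fun k => ?_) ?_ ?_ ?_ ?_ i
    · rw [Ne, inv_eq_zero, hι0]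
      exact coeff_genericFlag_ne_zero hm
    · refine ⟨φ.rangeRestrict (MvPolynomial.X (Sum.inr k)), ?_⟩
      change φ (MvPolynomial.X (Sum.inr k)) = _
      rw [MvPolynomial.coeff_C_mul, ← genericFlag_map ι, hι,
        ← map_subst _ (IsScalarTower.algebraMap_eq ℂ _ FlagField).symm, MvPolynomial.coeff_map]
      simp [hφ, famHom, nrm, scale, famCoords]
    · refine ⟨φ.rangeRestrict (MvPolynomial.X (Sum.inl (0, 1))), ?_⟩
      change φ (MvPolynomial.X (Sum.inl (0, 1))) = _
      simp [hφ, famHom, nrm, scale, famCoords, firstRow, genericFlag, hι]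
    · refine ⟨φ.rangeRestrict (MvPolynomial.X (Sum.inl (0, 2))), ?_⟩
      change φ (MvPolynomial.X (Sum.inl (0, 2))) = _
      simp [hφ, famHom, nrm, scale, famCoords, firstRow, genericFlag, hι]
    · rw [Ne, hι0]
      exact MvPolynomial.X_ne_zero _
    · rw [Ne, hι0]
      exact MvPolynomial.X_ne_zero _
  have : FaithfulSMul ℂ φ.range :=
    (faithfulSMul_iff_algebraMap_injective ℂ φ.range).mpr (algebraMap ℂ φ.range).injective
  have htr : Algebra.trdeg ℂ φ.range = Algebra.trdeg ℂ FlagField := by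
    rw [← trdeg_add_eq ℂ φ.range (A := FlagField), trdeg_eq_zero (R := φ.range), add_zero]
  rw [htr, trdeg_fractionRing, Fintype.card_fin]
  norm_num

/-! ### Multiple conics -/

/-- The generic matrix with first column `(1, 0, *)` and middle entry `1`. -/
def genericNormalFlag : Matrix (Fin 3) (Fin 3) (MvPolynomial (Fin 6) ℂ) :=
  !![1, MvPolynomial.X 0, MvPolynomial.X 1;
    0, 1, MvPolynomial.X 2;
    MvPolynomial.X 3, MvPolynomial.X 4, MvPolynomial.X 5]

theorem genericNormalFlag_eval (v : Fin 6 → ℂ) :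
    genericNormalFlag.map (MvPolynomial.eval v) =
      !![1, v 0, v 1; 0, 1, v 2; v 3, v 4, v 5] := by
  ext i j
  fin_cases i <;> fin_cases j <;> simp [genericNormalFlag]

theorem coeff_genericNormalFlag_ne_zero (hm : G.coeff m ≠ 0) :
    (subst G genericNormalFlag).coeff m ≠ 0 := by
  intro h
  apply hm
  have := congrArg (MvPolynomial.eval ![0, 0, 0, 0, 0, 1]) h
  have h1 : genericNormalFlag.map (MvPolynomial.eval ![0, 0, 0, 0, 0, 1]) = (1 : Mat) := by
    rw [genericNormalFlag_eval]
    ext i j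
    fin_cases i <;> fin_cases j <;> simp
  rwa [← MvPolynomial.coeff_map, map_eval_subst, h1, subst_one, map_zero] at this

/-- The stabilizer of a conic and of a point on it. -/
theorem subst_stabilizer (hGd : G.IsHomogeneous d) {S : ℕ} {e : ℂ}
    (hG : IsParabolas G (Multiset.replicate S e) κ A B) (t r : ℂ) :
    ∃ β γ : ℂ, subst G !![1, 0, 0; r, t, 0; γ, β, t ^ 2] = (t ^ 2) ^ S • G := by
  -- Solved from `z' + A (r + t y)² + B (r + t y) - e = t² (z + A y² + B y - e)` with `z' = γ + β y
  -- + t² z`, comparing coefficients of `y` and constants.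
  refine ⟨t ^ 2 * B - t * B - 2 * A * t * r, -t ^ 2 * e + e - A * r ^ 2 - B * r, ?_⟩
  rw [← sub_eq_zero]
  have hhom : ((t ^ 2) ^ S • G).IsHomogeneous d :=
    (MvPolynomial.homogeneousSubmodule (Fin 3) ℂ d).smul_mem _ hGd
  refine eq_zero_of_eval_chart ((isHomogeneous_subst hGd _).sub hhom) fun y z => ?_
  · rw [map_sub, eval_subst, MvPolynomial.smul_eval, hG.eval_eq, Multiset.map_replicate,
      Multiset.prod_replicate, sub_eq_zero]
    have h1 : (fun i => ∑ j, (!![1, 0, 0; r, t, 0; -t ^ 2 * e + e - A * r ^ 2 - B * r,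
        t ^ 2 * B - t * B - 2 * A * t * r, t ^ 2] : Mat) i j * ![1, y, z] j) =
        ![1, r + t * y, -t ^ 2 * e + e - A * r ^ 2 - B * r +
          (t ^ 2 * B - t * B - 2 * A * t * r) * y + t ^ 2 * z] := by
      funext i
      rw [Fin.sum_univ_three]
      fin_cases i <;> simp
    rw [h1, hG.eval_eq, Multiset.map_replicate, Multiset.prod_replicate, mul_left_comm, ← mul_pow]
    congr 2
    ring

theorem nrm_coords_smul (M : Mat) (G : MvPolynomial (Fin 3) ℂ) {s : ℂ} (hs : s ≠ 0) :
    nrm m (coords M (s • G)) = nrm m (coords M G) := by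
  have : coords M (s • G) = scale 1 s (coords M G) := by
    funext i
    cases i <;> simp [coords, scale]
  rw [this, nrm_scale m _ one_ne_zero hs]

/-- The orbit of a multiple conic is at most six-dimensional. -/
theorem trdeg_orbit_le_six {q : Ambient d} (hq : Represents q (firstRow 1) G)
    (hm : G.coeff m ≠ 0) {S : ℕ} {e : ℂ} (hG : IsParabolas G (Multiset.replicate S e) κ A B) :
    Algebra.trdeg ℂ (CoordRing ⧸ affIdeal m (orbit q)) ≤ 6 := by
  have hGd := hq.isHomogeneous
  have hker : RingHom.ker (famHom m (firstRow genericNormalFlag) (subst G genericNormalFlag)) ≤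
      affIdeal m (orbit q) := by
    intro P hP
    rw [RingHom.mem_ker, famHom_eq_zero_iff (D := 1) one_ne_zero
      (by simp [firstRow, genericNormalFlag]) (coeff_genericNormalFlag_ne_zero hm)] at hP
    -- The torus of the stabilizer turns the middle entry into 1, so six parameters suffice where `v
    -- 2 ≠ 0`. This locus is dense, so the vanishing extends to every specialization of
    -- `genericFlag`.
    have hP7 : famHom m (firstRow genericFlag) (subst G genericFlag) P = 0 := by
      rw [famHom_eq_zero_iff (D := MvPolynomial.X 2) (MvPolynomial.X_ne_zero 2)
        (by simp [firstRow, genericFlag]) (coeff_genericFlag_ne_zero hm)]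
      intro v hv _ hvm
      rw [MvPolynomial.eval_X] at hv
      rw [← MvPolynomial.coeff_map, map_eval_subst] at hvm
      rw [firstRow_map, map_eval_subst]
      set M : Mat := genericFlag.map (MvPolynomial.eval v) with hM
      have hM' : M = !![1, v 0, v 1; 0, v 2, v 3; v 4, v 5, v 6] := by
        rw [hM, genericFlag_map]
        simp
      obtain ⟨β, γ, hσ⟩ := subst_stabilizer hGd hG (v 2)⁻¹ 0
      set σ : Mat := !![1, 0, 0; 0, (v 2)⁻¹, 0; γ, β, (v 2)⁻¹ ^ 2] with hσdef
      have hs : ((v 2)⁻¹ ^ 2) ^ S ≠ 0 := pow_ne_zero _ (pow_ne_zero _ (inv_ne_zero hv))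
      obtain ⟨v', hv'⟩ : ∃ v' : Fin 6 → ℂ,
          genericNormalFlag.map (MvPolynomial.eval v') = σ * M := by
        refine ⟨![v 0, v 1, (v 2)⁻¹ * v 3, (σ * M) 2 0, (σ * M) 2 1, (σ * M) 2 2], ?_⟩
        rw [genericNormalFlag_eval]
        ext i j
        fin_cases i <;> fin_cases j <;>
          simp [hσdef, hM', Matrix.mul_apply, Fin.sum_univ_three, hv]
      have hrow : firstRow (σ * M) = firstRow M := by
        ext i j
        simp only [firstRow, Matrix.of_apply, Matrix.mul_apply, Fin.sum_univ_three]
        simp [hσdef]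
      have hsubst : subst G (σ * M) = ((v 2)⁻¹ ^ 2) ^ S • subst G M := by
        rw [← subst_subst, hσ, subst_smul_left]
      have h1 := hP v' (by simp) (by simp [firstRow, genericNormalFlag]) (by
        rw [← MvPolynomial.coeff_map, map_eval_subst, hv', hsubst, MvPolynomial.coeff_smul]
        exact mul_ne_zero hs hvm)
      rw [firstRow_map, map_eval_subst, hv', hrow, hsubst, nrm_coords_smul _ _ hs] at h1
      exact h1
    rw [famHom_eq_zero_iff (D := 1) one_ne_zero
      (by simp [firstRow, genericFlag]) (coeff_genericFlag_ne_zero hm)] at hP7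
    intro x hx hxm
    obtain ⟨g, hg⟩ := (mem_orbit_iff hq).mp hx
    rw [firstRow_one_mul] at hg
    have hg0 : (g : Mat) 0 0 ≠ 0 := by
      have := ((hg.mem_chart_iff m).mp hxm).1
      simpa [firstRow] using this
    set a := ((g : Mat) 0 0)⁻¹ with ha
    have ha0 : a ≠ 0 := inv_ne_zero hg0
    set M : Mat := a • (g : Mat) with hM
    have hM00 : M 0 0 = 1 := by simp [hM, ha, hg0]
    have hgM : Represents x (firstRow M) (subst G M) := by
      have h1 : firstRow M = a • firstRow (g : Mat) := by
        ext i j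
        simp [firstRow, hM]
      rw [h1, hM, subst_smul hGd, ← MvPolynomial.smul_eq_C_mul]
      exact hg.smul ha0 (pow_ne_zero d ha0)
    -- A translation along the parabola removes the entry `(1, 0)` without changing the first row or
    -- the form.
    obtain ⟨β, γ, hσ⟩ := subst_stabilizer hGd hG 1 (-M 1 0)
    set σ : Mat := !![1, 0, 0; -M 1 0, 1, 0; γ, β, 1 ^ 2] with hσdef
    rw [one_pow, one_pow, one_smul] at hσ
    have hrow : firstRow (σ * M) = firstRow M := by
      ext i j
      simp only [firstRow, Matrix.of_apply, Matrix.mul_apply, Fin.sum_univ_three]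
      simp [hσdef]
    have hsubst : subst G (σ * M) = subst G M := by
      rw [← subst_subst, hσ]
    obtain ⟨v, hv⟩ : ∃ v : Fin 7 → ℂ, genericFlag.map (MvPolynomial.eval v) = σ * M := by
      refine ⟨![M 0 1, M 0 2, (σ * M) 1 1, (σ * M) 1 2, (σ * M) 2 0, (σ * M) 2 1, (σ * M) 2 2], ?_⟩
      rw [genericFlag_map]
      ext i j
      fin_cases i <;> fin_cases j <;>
        simp [hσdef, Matrix.mul_apply, Fin.sum_univ_three, hM00]
    have hc := (hgM.mem_chart_iff m).mp hxm
    have h1 := hP7 v (by simp) (by simp [firstRow, genericFlag]) (by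
      rw [← MvPolynomial.coeff_map, map_eval_subst, hv, hsubst]
      exact hc.2)
    rw [firstRow_map, map_eval_subst, hv, hrow, hsubst] at h1
    rwa [hgM.affCoords_eq m]
  have := trdeg_quotient_ker_famHom_le m _ _ hker
  rw [Fintype.card_fin] at this
  exact_mod_cast this


/-! ### Components determined by germs of type V -/

theorem typeVGerm_eval_zero {f : HahnSeries ℚ ℂ} {C : ℚ} {a b c : ℕ} (hf : 1 < f.order)
    (hV : IsTypeV f C a b c) : (typeVGerm f a b c).map (Polynomial.eval 0) = firstRow 1 := by
  have ha := hV.a_pos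
  have hab := hV.a_lt_b
  have hc : 0 < c := by
    have h1 : (0 : ℚ) < C := zero_lt_one.trans (hf.trans hV.order_lt)
    have h2 : (0 : ℚ) < c := by
      rw [hV.hc]
      exact mul_pos h1 (Nat.cast_pos.mpr ha)
    exact_mod_cast h2
  have h0 : ∀ l ≤ 1, f.coeff l = 0 := fun l hl =>
    HahnSeries.coeff_eq_zero_of_lt_order (hl.trans_lt hf)
  have h1 : (truncSubst f a c).eval 0 = 0 := by
    rw [← Polynomial.coeff_zero_eq_eval_zero, truncSubst, Polynomial.finsetSum_coeff]
    refine Finset.sum_eq_zero fun n _ => ?_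
    rw [Polynomial.coeff_monomial]
    split_ifs with hn
    · rw [hn, Nat.cast_zero, zero_div, h0 0 zero_le_one]
    · rfl
  have h2 : (truncDerivSubst f a b c).eval 0 = 0 := by
    rw [← Polynomial.coeff_zero_eq_eval_zero, truncDerivSubst, Polynomial.finsetSum_coeff]
    refine Finset.sum_eq_zero fun n _ => ?_
    rw [Polynomial.coeff_monomial]
    split_ifs with hn
    · have : ((n : ℚ) - b) / a + 1 ≤ 1 := by
        rw [hn, Nat.cast_zero, zero_sub]
        have : -(b : ℚ) / a ≤ 0 :=
          div_nonpos_of_nonpos_of_nonneg (neg_nonpos.mpr (Nat.cast_nonneg b)) (Nat.cast_nonneg a)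
        linarith
      rw [h0 _ this, mul_zero]
    · rfl
  ext i j
  fin_cases i <;> fin_cases j <;>
    simp [typeVGerm, firstRow, h1, h2, ha.ne', (ha.trans hab).ne', hc.ne']

theorem IsTangentBranch.eval_eq_zero {F : MvPolynomial (Fin 3) ℂ} {f : HahnSeries ℚ ℂ}
    (hf : IsTangentBranch F f) : MvPolynomial.eval ![1, 0, 0] F = 0 := by
  obtain ⟨N, hN, hint⟩ := hf.integral
  have hfh := PowerSeries.toPuiseux_ofPuiseux hN (hint N dvd_rfl)
  set h := PowerSeries.ofPuiseux N f
  have h1 := ((isTangentBranch_toPuiseux_iff (F := F) hN h).mp (by rwa [hfh])).2.2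
  have h0 : PowerSeries.constantCoeff h = 0 := by
    rw [← PowerSeries.coeff_zero_eq_constantCoeff_apply, ← PowerSeries.coeff_toPuiseux_div hN,
      hfh, Nat.cast_zero, zero_div]
    exact HahnSeries.coeff_eq_zero_of_lt_order (zero_lt_one.trans hf.one_lt_order)
  have h2 := congrArg PowerSeries.constantCoeff h1
  rw [← Polynomial.eval₂_id, Polynomial.hom_eval₂, RingHom.comp_id, h0, map_zero,
    eval₂_branchPoly _ _ _ (by ext1 c; simp),
    PowerSeries.constantCoeff_X, zero_pow hN.ne', MvPolynomial.aeval_eq_eval] at h2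
  exact h2

/-- The rank-one matrix sends every point to a multiple of `(1 : 0 : 0)`, a point of the curve. Thus
the lift centre lies over the base scheme. -/
theorem subst_firstRow_eq_zero {F : MvPolynomial (Fin 3) ℂ} (hF : F.IsHomogeneous d)
    (h : MvPolynomial.eval ![1, 0, 0] F = 0) : subst F (firstRow 1 : Mat) = 0 := by
  refine eq_zero_of_eval_chart (isHomogeneous_subst hF _) fun y z => ?_
  rw [eval_subst, ← h]
  congr 2
  funext i
  rw [Fin.sum_univ_three]
  fin_cases i <;> simp [firstRow]

theorem determinesComponent_typeVGerm_iff {F : Form d} (hF : F ≠ 0) {f : HahnSeries ℚ ℂ} {C : ℚ}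
    {a b c : ℕ} (hf : IsTangentBranch F f) (hV : IsTypeV f C a b c) :
    DeterminesComponent F (typeVGerm f a b c) ↔
      IsCharacteristicFor F (HahnSeries.truncLT C f) C := by
  obtain ⟨G, δ, κ, A, B, hlim, hκ, hA, heval, hδ⟩ :=
    exists_limit F.2 (fun h => hF (Subtype.ext h)) hf hV
  have hG : IsParabolas G δ κ A B := ⟨hκ, hA, heval⟩
  obtain ⟨m, hm⟩ := MvPolynomial.ne_zero_iff.mp hlim.1
  have hα := typeVGerm_eval_zero hf.one_lt_order hV
  obtain ⟨q, hq⟩ := exists_represents (d := d) (A := firstRow 1) (G := G)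
    (fun h => one_ne_zero (α := ℂ) (by simpa [firstRow] using congrFun (congrFun h 0) 0)) hlim.1
    (hlim.isHomogeneous F.2)
  have hbase : subst (F : MvPolynomial (Fin 3) ℂ) ((typeVGerm f a b c).map (Polynomial.eval 0)) =
      0 := by
    rw [hα]
    exact subst_firstRow_eq_zero F.2 hf.eval_eq_zero
  have hqα : Represents q ((typeVGerm f a b c).map (Polynomial.eval 0)) G := by rwa [hα]
  have hsub := orbit_subset_PNC hlim hqα hbase
  have hne : (orbit q ∩ chart d m).Nonempty :=
    ⟨q, mem_orbit_self, (hq.mem_chart_iff m).mpr ⟨by simp [firstRow], hm⟩⟩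
  rw [determinesComponent_iff hlim hqα hbase]
  constructor
  · intro hcomp
    by_contra hchar
    -- Each `g` is compared with `f` itself; a different coefficient would make `C` characteristic.
    have hall : ∀ e ∈ δ, e = f.coeff C := by
      intro e he
      obtain ⟨g, hg, hgf, rfl⟩ := (hδ e).mp he
      by_contra hne
      exact hchar ⟨g, f, hg, hf, hgf, rfl, hne⟩
    rw [Multiset.eq_replicate_card.mpr hall] at hG
    obtain ⟨W, hW, hWirr, hle, hnot⟩ := not_isComponent_of_trdeg_le hsub (isIrreducible_orbit q) hne
      (trdeg_orbit_le_six hq hm hG)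
    exact hnot (hcomp W hW hWirr (subset_closure.trans hle))
  · rintro ⟨g, h, hg, hh, hgf, hhf, hC⟩ W hW hWirr hle
    exact isComponent_of_le_trdeg hsub (isIrreducible_orbit q) hne
      (seven_le_trdeg_orbit hq hm hG ((hδ _).mpr ⟨g, hg, hgf, rfl⟩)
        ((hδ _).mpr ⟨h, hh, hhf, rfl⟩) hC) hW hWirr hle

theorem exists_isTypeV {F : MvPolynomial (Fin 3) ℂ} {f : HahnSeries ℚ ℂ} {C : ℚ}
    (hf : IsTangentBranch F f) (hC : f.order < C) : ∃ a b c : ℕ, IsTypeV f C a b c := by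
  obtain ⟨n, hn, hint⟩ := hf.integral
  have hC0 : 0 < C := zero_lt_one.trans (hf.one_lt_order.trans hC)
  obtain ⟨k, hk⟩ := hint n dvd_rfl f.order fun h =>
    hf.ne_zero (HahnSeries.coeff_order_eq_zero.mp h)
  obtain ⟨P, hP⟩ : ∃ P : ℕ, C * C.den = P := by
    refine ⟨C.num.toNat, ?_⟩
    rw [Rat.mul_den_eq_num]
    exact_mod_cast (Int.toNat_of_nonneg (Rat.num_nonneg.mpr hC0.le)).symm
  have hle : k * C.den ≤ n * P := by
    have : ((k * C.den : ℕ) : ℚ) ≤ (n * P : ℕ) := by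
      push_cast
      rw [← hk, ← hP]
      have : (0 : ℚ) ≤ n * C.den := by positivity
      nlinarith
    exact_mod_cast this
  -- The factor `n` clears the exponents of `f`, the denominator that of `C`, and the 2 absorbs the
  -- half in `b / a`.
  refine ⟨2 * n * C.den, n * P - k * C.den + 2 * n * C.den, 2 * n * P, hC, ?_, ?_, ?_, ?_⟩
  · have := C.den_pos
    positivity
  · push_cast
    rw [← hP]
    ring
  · push_cast [Nat.cast_sub hle]
    rw [← hP, ← hk]
    ring
  · intro l hl _
    exact hint _ ⟨2 * C.den, by ring⟩ l hl

end PlaneCurve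

end

theorem proposition4p12 (d : ℕ) (F : PlaneCurve.Form d) (hF : F ≠ 0) :
    {C : ℚ | PlaneCurve.IsCharacteristic F C}.Finite ∧
    (∀ (f : HahnSeries ℚ ℂ) (C : ℚ) (a b c : ℕ),
      PlaneCurve.IsTangentBranch F f → PlaneCurve.IsTypeV f C a b c →
      (PlaneCurve.DeterminesComponent F (PlaneCurve.typeVGerm f a b c) ↔
        PlaneCurve.IsCharacteristicFor F (HahnSeries.truncLT C f) C)) ∧
    (∀ C : ℚ, PlaneCurve.IsCharacteristic F C ↔
      ∃ (f : HahnSeries ℚ ℂ) (a b c : ℕ),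
        PlaneCurve.IsTangentBranch F f ∧ PlaneCurve.IsTypeV f C a b c ∧
        PlaneCurve.DeterminesComponent F (PlaneCurve.typeVGerm f a b c)) := by
  refine ⟨PlaneCurve.finite_isCharacteristic F.2 fun h => hF (Subtype.ext h),
    fun f C a b c hf hV => PlaneCurve.determinesComponent_typeVGerm_iff hF hf hV, fun C => ⟨?_, ?_⟩⟩
  · rintro ⟨φ, hφ, g, h, hg, hh, rfl, hhφ, hC⟩
    -- A nonzero truncation contains the initial term of `g`.
    have hord : g.order < C := by
      by_contra! hle
      apply hφ
      ext l
      rw [HahnSeries.coeff_truncLT, HahnSeries.coeff_zero]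
      split_ifs with hl
      · exact HahnSeries.coeff_eq_zero_of_lt_order (hl.trans_le hle)
      · rfl
    obtain ⟨a, b, c, hV⟩ := PlaneCurve.exists_isTypeV hg hord
    exact ⟨g, a, b, c, hg, hV, (PlaneCurve.determinesComponent_typeVGerm_iff hF hg hV).mpr
      ⟨g, h, hg, hh, rfl, hhφ, hC⟩⟩
  · rintro ⟨f, a, b, c, hf, hV, hdet⟩
    refine ⟨HahnSeries.truncLT C f, fun h0 => ?_,
      (PlaneCurve.determinesComponent_typeVGerm_iff hF hf hV).mp hdet⟩
    have := congrArg (fun x => x.coeff f.order) h0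
    simp only [HahnSeries.coeff_truncLT, if_pos hV.order_lt, HahnSeries.coeff_zero] at this
    exact hf.ne_zero (HahnSeries.coeff_order_eq_zero.mp this)
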